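/- **Notation.** For $U\subset\mathbb R^2$ and $r>0$ let $U_r=\{x\in U:\operatorname{dist}(x,\partial U)>r\}$. Fix a length $\rho_0>0$. For $U$ open and $u$ on $U$ (scalar or tensor valued), with $\nabla^i u$ the vector of all weak derivatives of order $i$, put $$\|u\|_{H^k(U)}=\rho_0^{-1}\Big(\sum_{i=0}^k\rho_0^{2i}\int_U|\nabla^iu|^2\Big)^{1/2},\qquad \|u\|_{W^{k,\infty}(U)}=\sum_{i=0}^k\rho_0^i\|\nabla^iu\|_{L^\infty(U)},$$ and, for $k=0,1,2,\dots$ and $s\in(0,1)$, $$\|u\|_{H^{k+s}(U)}=\|u\|_{H^k(U)}+\rho_0^{k+s-1}[\nabla^ku]_s,\qquad [v]_s=\Big(\int_U\int_U\frac{|v(x)-v(y)|^2}{|x-y|^{2+2s}}\,dx\,dy\Big)^{1/2}.$$ The boundary of a bounded domain $\Omega\subset\mathbb R^2$ is of *Lipschitz class with constants* $\rho_0,M_0>0$ if for every $P\in\partial\Omega$ there are a rigid change of coordinates taking $P$ to the origin $O$ and a function $\psi$ on $I=(-\rho_0,\rho_0)$ with $\psi(0)=0$ and $$\sup_I|\psi|+\rho_0\sup_{t\ne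 u\in I}\frac{|\psi(t)-\psi(u)|}{|t-u|}\le M_0\rho_0,$$ such that in the new coordinates $\Omega\cap B_{\rho_0}(O)=\{x\in B_{\rho_0}(O): x_2>\psi(x_1)\}$. For a fourth order tensor $\mathbb C=(C_{ijkl})$ and $2\times2$ matrices $A,B$ write $(\mathbb CA)_{ij}=\sum_{k,l}C_{ijkl}A_{kl}$, $A\cdot B=\sum_{i,j}A_{ij}B_{ij}$, $|A|=(A\cdot A)^{1/2}$. **Proposition ($H^s$-regularity).** Let $h,M_0,M_1,M_2,M_3,\xi_0,\sigma>0$ and $s\in(0,1)$. There is a constant $C>0$, depending only on $h,M_0,M_1,M_2,M_3,\xi_0,s,\sigma$, such that the following holds for all $\rho_0>0$ and $\xi_1>0$. Let $\Omega\subset\mathbb R^2$ be a bounded domain with boundary of Lipschitz class with constants $\rho_0,M_0$ and $|\Omega|\le M_1\rho_0^2$. Let $\mathbb C\in W^{2,\infty}(\Omega)\cap H^{2+s}(\Omega)$ be a fourth order tensor field such that, for a.e. $x\in\Omega$, $\mathbb C(x)A=(\mathbb C(x)A)^T$ and $\mathbb C(x)A\cdot B=A\cdot\mathbb C(x)B$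 for all $2\times2$ matrices $A,B$, and $\xi_0|A|^2\le\mathbb C(x)A\cdot A\le\xi_1|A|^2$ for all symmetric $2\times 2$ matrices $A$, and such that $$\|\mathbb C\|_{W^{2,\infty}(\Omega)}\le M_2,\qquad \|\mathbb C\|_{H^{2+s}(\Omega)}\le M_3.$$ Let $\mathbb P=\frac{h^3}{12}\mathbb C$, let $g\in H^s(\Omega)$, and let $w\in H^2(\Omega)$ be a weak solution of $\operatorname{div}(\operatorname{div}(\mathbb P\nabla^2w))=g$ in $\Omega$, that is, $$\int_\Omega\mathbb P\nabla^2w\cdot\nabla^2\varphi=\int_\Omega g\varphi\qquad\text{for all }\varphi\in C_c^\infty(\Omega).$$ Then $w\in H^{4+s}(\Omega_{\sigma\rho_0})$ and $$\|w\|_{H^{4+s}(\Omega_{\sigma\rho_0})}\le C\left(\|w\|_{H^2(\Omega_{\frac{\sigma}{2}\rho_0})}+\rho_0^4\|g\|_{H^s(\Omega)}\right).$$ -/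

import Mathlib

open MeasureTheory
open scoped ENNReal ContDiff

namespace KirchhoffPlate

/-- The Euclidean plane. -/
abbrev Plane : Type := EuclideanSpace ℝ (Fin 2)

/-- Fourth order tensors on the plane, given by their Cartesian components `C (i, j, k, l)` and
normed by the Euclidean norm of the list of components. -/
abbrev Tensor4 : Type := EuclideanSpace ℝ (Fin 2 × Fin 2 × Fin 2 × Fin 2)

/-- `U_r = {x ∈ U | dist (x, ∂U) > r}`. -/
def innerPart (U : Set Plane) (r : ℝ) : Set Plane :=
  {x | x ∈ U ∧ r < Metric.infDist x (frontier U)}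

/-! ### Boundaries of Lipschitz class -/

/-- The dimensionally homogeneous norm
`‖ψ‖_{C^{0,1}(I)} = sup_I |ψ| + ρ₀ sup_{t ≠ u} |ψ t - ψ u| / |t - u|`,
with values in `[0, ∞]` (the terms with `t = u` are zero). -/
noncomputable def lipNorm (ρ₀ : ℝ) (I : Set ℝ) (ψ : ℝ → ℝ) : ℝ≥0∞ :=
  (⨆ t ∈ I, ‖ψ t‖ₑ) + ENNReal.ofReal ρ₀ * ⨆ t ∈ I, ⨆ u ∈ I, ‖ψ t - ψ u‖ₑ / ‖t - u‖ₑ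

/-- The boundary of `Ω` is of Lipschitz class (that is, of class `C^{0,1}`) with constants `ρ₀` and
`M₀`: near each boundary point `P`, after a rigid change of coordinates `T` that moves `P` to the
origin, `Ω` is the region above the graph of a function with controlled `C^{0,1}` norm. -/
def IsLipschitzBoundary (Ω : Set Plane) (ρ₀ M₀ : ℝ) : Prop :=
  ∀ P ∈ frontier Ω, ∃ T : Plane ≃ᵢ Plane, T P = 0 ∧ ∃ ψ : ℝ → ℝ,
    ψ 0 = 0 ∧
    lipNorm ρ₀ (Set.Ioo (-ρ₀) ρ₀) ψ ≤ ENNReal.ofReal (M₀ * ρ₀) ∧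
    (T '' Ω) ∩ Metric.ball 0 ρ₀ = {x | x ∈ Metric.ball (0 : Plane) ρ₀ ∧ ψ (x 0) < x 1}

/-! ### Weak derivatives -/

/-- `φ ∈ C_c^∞(U)`. -/
def IsTestFunction (U : Set Plane) (φ : Plane → ℝ) : Prop :=
  ContDiff ℝ ∞ φ ∧ HasCompactSupport φ ∧ tsupport φ ⊆ U

/-- The classical partial derivative `∂_{α 0} ⋯ ∂_{α (n-1)} φ`. -/
noncomputable def partialDeriv {n : ℕ} (α : Fin n → Fin 2) (φ : Plane → ℝ) (x : Plane) : ℝ :=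
  iteratedFDeriv ℝ n φ x (fun j => EuclideanSpace.single (α j) (1 : ℝ))

section WeakDerivatives

variable {F : Type*} [NormedAddCommGroup F] [NormedSpace ℝ F]

/-- `v` is the weak derivative `∂_{α 0} ⋯ ∂_{α (n-1)} u` in the open set `U`. For `n = 0` this says
that `u = v` almost everywhere in `U`. -/
def IsWeakDeriv (U : Set Plane) {n : ℕ} (α : Fin n → Fin 2) (u v : Plane → F) : Prop :=
  LocallyIntegrableOn u U ∧ LocallyIntegrableOn v U ∧
    ∀ φ : Plane → ℝ, IsTestFunction U φ →
      ∫ x in U, partialDeriv α φ x • u x = (-1 : ℝ) ^ n • ∫ x in U, φ x • v x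

/-- Weak derivatives in an open set are unique up to null sets. -/
theorem IsWeakDeriv.ae_eq [CompleteSpace F] {U : Set Plane} (hU : IsOpen U) {n : ℕ}
    {α : Fin n → Fin 2} {u v₁ v₂ : Plane → F}
    (h₁ : IsWeakDeriv U α u v₁) (h₂ : IsWeakDeriv U α u v₂) :
    ∀ᵐ x ∂(volume.restrict U), v₁ x = v₂ x := by
  have key : ∀ (v : Plane → F) (φ : Plane → ℝ), LocallyIntegrableOn v U → IsTestFunction U φ →
      IntegrableOn (fun x => φ x • v x) U := by
    intro v φ hv hφ
    have hK : IntegrableOn v (tsupport φ) :=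
      hv.integrableOn_compact_subset hφ.2.2 hφ.2.1
    have h1 : IntegrableOn (fun x => φ x • v x) (tsupport φ) :=
      hK.continuousOn_smul hφ.1.continuous.continuousOn hφ.2.1
    refine ((integrableOn_iff_integrable_of_support_subset ?_).1 h1).integrableOn
    exact (Function.support_smul_subset_left φ v).trans (subset_tsupport φ)
  have hz := hU.ae_eq_zero_of_integral_contDiff_smul_eq_zero (μ := volume)
    (h₁.2.1.sub h₂.2.1) (fun φ hs hc ht => by
      have e : ∫ x, φ x • (v₁ - v₂) x = ∫ x in U, φ x • (v₁ - v₂) x := by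
        refine (setIntegral_eq_integral_of_forall_compl_eq_zero fun x hx => ?_).symm
        rw [image_eq_zero_of_notMem_tsupport fun hx' => hx (ht hx'), zero_smul]
      rw [e]
      simp only [Pi.sub_apply, smul_sub]
      rw [integral_sub (key v₁ φ h₁.2.1 ⟨hs, hc, ht⟩) (key v₂ φ h₂.2.1 ⟨hs, hc, ht⟩),
        sub_eq_zero]
      have h3 := (h₁.2.2 φ ⟨hs, hc, ht⟩).symm.trans (h₂.2.2 φ ⟨hs, hc, ht⟩)
      exact smul_right_injective F (pow_ne_zero n (by norm_num : (-1 : ℝ) ≠ 0)) h3)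
  rw [ae_restrict_iff' hU.measurableSet]
  filter_upwards [hz] with x hx hxU
  exact sub_eq_zero.1 (hx hxU)

open Classical in
/-- The weak derivative `∂_{α 0} ⋯ ∂_{α (n-1)} u` in `U`, unique up to null sets
(and `0` by convention if there is none). -/
noncomputable def weakDeriv (U : Set Plane) {n : ℕ} (α : Fin n → Fin 2) (u : Plane → F) :
    Plane → F :=
  if h : ∃ v, IsWeakDeriv U α u v then h.choose else 0

/-- All weak derivatives of `u` in `U` of order at most `k` exist. -/
def HasWeakDerivs (U : Set Plane) (k : ℕ) (u : Plane → F) : Prop :=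
  ∀ n ≤ k, ∀ α : Fin n → Fin 2, ∃ v, IsWeakDeriv U α u v

/-- `|∇^n u (x)|²`, the sum of the squares of all weak derivatives of order `n`. -/
noncomputable def gradSq (U : Set Plane) (n : ℕ) (u : Plane → F) (x : Plane) : ℝ :=
  ∑ α : Fin n → Fin 2, ‖weakDeriv U α u x‖ ^ 2

/-! ### Sobolev spaces and their dimensionally homogeneous norms, with values in `[0, ∞]` -/

/-- `‖u‖_{H^k(U)} = ρ₀⁻¹ (∑_{i ≤ k} ρ₀^{2i} ∫_U |∇^i u|²)^{1/2}`. -/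
noncomputable def sobolevNorm (ρ₀ : ℝ) (U : Set Plane) (k : ℕ) (u : Plane → F) : ℝ≥0∞ :=
  ENNReal.ofReal ρ₀⁻¹ *
    (∑ i ∈ Finset.range (k + 1), ENNReal.ofReal (ρ₀ ^ (2 * i)) *
      ∫⁻ x in U, ENNReal.ofReal (gradSq U i u x)) ^ (1 / 2 : ℝ)

/-- The Gagliardo seminorm of the weak derivatives of order `k`:
`[∇^k u]_s = (∫_U ∫_U |∇^k u (x) - ∇^k u (y)|² / |x - y|^{2 + 2s} dx dy)^{1/2}`. -/
noncomputable def gagliardoSeminorm (U : Set Plane) (k : ℕ) (s : ℝ) (u : Plane → F) : ℝ≥0∞ :=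
  (∫⁻ y in U, ∫⁻ x in U, ENNReal.ofReal
    ((∑ α : Fin k → Fin 2, ‖weakDeriv U α u x - weakDeriv U α u y‖ ^ 2) /
      ‖x - y‖ ^ (2 + 2 * s))) ^ (1 / 2 : ℝ)

/-- `‖u‖_{H^{k+s}(U)} = ‖u‖_{H^k(U)} + ρ₀^{k+s-1} [∇^k u]_s`, for `0 < s < 1`. -/
noncomputable def fracSobolevNorm (ρ₀ : ℝ) (U : Set Plane) (k : ℕ) (s : ℝ) (u : Plane → F) :
    ℝ≥0∞ :=
  sobolevNorm ρ₀ U k u + ENNReal.ofReal (ρ₀ ^ ((k : ℝ) + s - 1)) * gagliardoSeminorm U k s u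

/-- `‖u‖_{W^{k,∞}(U)} = ∑_{i ≤ k} ρ₀^i ‖∇^i u‖_{L^∞(U)}`. -/
noncomputable def supSobolevNorm (ρ₀ : ℝ) (U : Set Plane) (k : ℕ) (u : Plane → F) : ℝ≥0∞ :=
  ∑ i ∈ Finset.range (k + 1), ENNReal.ofReal (ρ₀ ^ i) *
    essSup (fun x => ENNReal.ofReal (Real.sqrt (gradSq U i u x))) (volume.restrict U)

/-- `u ∈ H^k(U)`. -/
def MemSobolev (U : Set Plane) (k : ℕ) (u : Plane → F) : Prop :=
  HasWeakDerivs U k u ∧ sobolevNorm 1 U k u < ⊤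

/-- `u ∈ H^{k+s}(U)`, for `0 < s < 1`. -/
def MemFracSobolev (U : Set Plane) (k : ℕ) (s : ℝ) (u : Plane → F) : Prop :=
  HasWeakDerivs U k u ∧ fracSobolevNorm 1 U k s u < ⊤

/-- `u ∈ W^{k,∞}(U)`. -/
def MemSupSobolev (U : Set Plane) (k : ℕ) (u : Plane → F) : Prop :=
  HasWeakDerivs U k u ∧ supSobolevNorm 1 U k u < ⊤

end WeakDerivatives

/-! ### Elasticity tensors and the plate equation -/

/-- `(L A)_{ij} = L_{ijkl} A_{kl}`. -/
def Tensor4.app (L : Tensor4) (A : Matrix (Fin 2) (Fin 2) ℝ) : Matrix (Fin 2) (Fin 2) ℝ :=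
  Matrix.of fun i j => ∑ k, ∑ l, L (i, j, k, l) * A k l

/-- `A · B = A_{ij} B_{ij}`; in particular `|A|² = A · A`. -/
def matDot (A B : Matrix (Fin 2) (Fin 2) ℝ) : ℝ :=
  ∑ i, ∑ j, A i j * B i j

/-- The symmetry conditions `C A = (C A)ᵀ` and `C A · B = A · C B`, for all matrices `A`, `B`. -/
def Tensor4.IsSymm (L : Tensor4) : Prop :=
  (∀ A : Matrix (Fin 2) (Fin 2) ℝ, L.app A = (L.app A).transpose) ∧
  ∀ A B : Matrix (Fin 2) (Fin 2) ℝ, matDot (L.app A) B = matDot A (L.app B)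

/-- Strong convexity: `ξ₀ |A|² ≤ C A · A ≤ ξ₁ |A|²` for all symmetric matrices `A`. -/
def Tensor4.IsStronglyConvex (L : Tensor4) (ξ₀ ξ₁ : ℝ) : Prop :=
  ∀ A : Matrix (Fin 2) (Fin 2) ℝ, A.IsSymm →
    ξ₀ * matDot A A ≤ matDot (L.app A) A ∧ matDot (L.app A) A ≤ ξ₁ * matDot A A

/-- The plate tensor `(h³ / 12) C`. -/
noncomputable def plateTensor (h : ℝ) (C : Plane → Tensor4) (x : Plane) : Tensor4 :=
  (h ^ 3 / 12) • C x

/-- The Hessian matrix `∇²w` made of the weak derivatives of `w` in `U`. -/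
noncomputable def weakHessian (U : Set Plane) (w : Plane → ℝ) (x : Plane) :
    Matrix (Fin 2) (Fin 2) ℝ :=
  Matrix.of fun i j => weakDeriv U ![i, j] w x

/-- The Hessian matrix `∇²φ` of a smooth function. -/
noncomputable def hessian (φ : Plane → ℝ) (x : Plane) : Matrix (Fin 2) (Fin 2) ℝ :=
  Matrix.of fun i j => partialDeriv ![i, j] φ x

/-- `w` solves `div (div (ℙ ∇²w)) = g` in `U`, in the weak sense:
`∫_U ℙ ∇²w · ∇²φ = ∫_U g φ` for all `φ ∈ C_c^∞(U)`. -/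
def IsWeakPlateSolution (U : Set Plane) (ℙ : Plane → Tensor4) (g w : Plane → ℝ) : Prop :=
  ∀ φ : Plane → ℝ, IsTestFunction U φ →
    ∫ x in U, matDot ((ℙ x).app (weakHessian U w x)) (hessian φ x) = ∫ x in U, g x * φ x

end KirchhoffPlate

open KirchhoffPlate

namespace KirchhoffPlate
open Filter Topology

/-! The proof is Nirenberg's method of translations. A dilation reduces everything to `ρ₀ = 1`: the
weighted norms are scale invariant and only `g` picks up the factor `ρ₀ ^ 4`. Then everything is
carried to elements of `L²` of the whole plane. The coefficients are replaced by `κ I + χ (h³/12 C -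
κ I)` with `κ = h³/12 ξ₀` and a cutoff `χ ≥ 0`. This is coercive with constant `κ` on Hessians of
test functions and equals `h³/12 C` where `χ = 1`. For a cutoff `ζ` the product `ζ w` solves a
system on the plane (`Sys`) with data `F`, `b`, `c`, entering with two, one and no derivatives
(`Sys.localize`).

The analytic core is one energy estimate, `norm_T_DD_sub_le`. If `v` lies in `H²`, then for every
translation `T h` the norm of `T h ∇²v - ∇²v` is at most a constant times `∑ ‖T h F - F‖ + M ‖h‖`.
It follows by subtracting the equation from its translate and testing with `T h v - v`. Read for
small multiples of the coordinate vectors it says that `F ∈ H¹` gives `v ∈ H³`. Squared and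
integrated against `‖h‖ ^ (-2 - 2s)` it says that `F ∈ H^s` gives `v ∈ H^{2+s}`, because on the
plane the Gagliardo seminorm is this weighted `L²` norm of the differences.

Differentiating the system (`Sys.deriv`) moves `b` into `F` and `c` into `b`. Hence three steps on
shrinking interior parts suffice. `UH.stage_one` uses the system itself and goes from `H²` to `H³`;
`UH.stage_two` differentiates once and reaches `H⁴`; `UH.stage_three` differentiates twice, so that
`g` has arrived in `F`, where `H^s` is enough, and reaches `H^{4+s}`. The products met in the last
step are handled by `HS.mulL`. Its only delicate term is a factor in `L^∞ ∩ H^s` times a function in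
`H²`, which is bounded in dimension two (`CB.of_norm_le`).

Constants are not tracked through the bootstrap. The argument runs for the family of all admissible
data at once: `UH` asks for one constant valid for every member, and this gives a constant depending
only on the listed parameters. -/

/-- Square integrable functions on the plane. -/
abbrev L2 : Type := Lp ℝ 2 (volume : Measure Plane)

/-- The coordinate vectors of the plane. -/
noncomputable abbrev vec (a : Fin 2) : Plane := EuclideanSpace.single a (1 : ℝ)

/-! ### Test functions and their density in `L²` -/

/-- Smooth compactly supported functions on the plane. -/
structure TF where
  /-- the underlying function -/
  toFun : Plane → ℝ
  smooth : ContDiff ℝ ∞ toFun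
  supp : HasCompactSupport toFun

instance : CoeFun TF (fun _ => Plane → ℝ) := ⟨TF.toFun⟩

namespace TF

@[ext] theorem ext {f g : TF} (h : ∀ x, f x = g x) : f = g := by
  cases f; cases g; congr; exact funext h

theorem continuous (f : TF) : Continuous f := f.smooth.continuous

theorem differentiable (f : TF) : Differentiable ℝ f := f.smooth.differentiable (by simp)

/-- Derivative in the direction `h`. -/
noncomputable def D (h : Plane) (f : TF) : TF where
  toFun x := fderiv ℝ f x h
  smooth := (f.smooth.fderiv_right (m := ∞) (by simp)).clm_apply contDiff_const
  supp := f.supp.fderiv_apply (𝕜 := ℝ) h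

/-- Partial derivative. -/
noncomputable abbrev d (a : Fin 2) (f : TF) : TF := f.D (vec a)

/-- Translation. -/
def shift (h : Plane) (f : TF) : TF where
  toFun x := f (x + h)
  smooth := f.smooth.comp (contDiff_id.add contDiff_const)
  supp := f.supp.comp_homeomorph (Homeomorph.addRight h)

/-- Pointwise product. -/
def mul (f g : TF) : TF where
  toFun x := f x * g x
  smooth := f.smooth.mul g.smooth
  supp := f.supp.mul_right

/-- Pointwise difference. -/
def sub (f g : TF) : TF where
  toFun x := f x - g x
  smooth := f.smooth.sub g.smooth
  supp := f.supp.sub g.supp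

theorem D_apply (h : Plane) (f : TF) (x : Plane) : f.D h x = fderiv ℝ f x h := rfl
theorem shift_apply (h : Plane) (f : TF) (x : Plane) : f.shift h x = f (x + h) := rfl
theorem mul_apply (f g : TF) (x : Plane) : f.mul g x = f x * g x := rfl
theorem sub_apply (f g : TF) (x : Plane) : f.sub g x = f x - g x := rfl

theorem D_shift (h k : Plane) (f : TF) : (f.shift h).D k = (f.D k).shift h := by
  ext x
  simp only [D_apply, shift_apply]
  have : (f.shift h : Plane → ℝ) = fun x => f (x + h) := rfl
  rw [this, fderiv_comp_add_right]

theorem D_mul (h : Plane) (f g : TF) (x : Plane) :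
    (f.mul g).D h x = f x * g.D h x + g x * f.D h x := by
  have : (f.mul g : Plane → ℝ) = fun x => f x * g x := rfl
  simp only [D_apply]
  rw [this, fderiv_fun_mul (f.differentiable x) (g.differentiable x)]
  simp

theorem D_comm (h k : Plane) (f : TF) : (f.D h).D k = (f.D k).D h := by
  ext x
  have h2 : ContDiff ℝ ∞ (fderiv ℝ f) := f.smooth.fderiv_right (m := ∞) (by simp)
  have key : ∀ h k : Plane, (f.D h).D k x = fderiv ℝ (fderiv ℝ f) x k h := by
    intro h k
    have : (f.D h : Plane → ℝ) = fun x => fderiv ℝ f x h := rfl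
    rw [D_apply, this, fderiv_clm_apply (h2.differentiable (by simp) x) (by fun_prop)]
    simp
  rw [key, key]
  have hs : IsSymmSndFDerivAt ℝ f x := f.smooth.contDiffAt.isSymmSndFDerivAt (by
    simp only [minSmoothness_of_isRCLikeNormedField]; exact WithTop.coe_le_coe.2 (le_top : (2 : ℕ∞) ≤ ⊤))
  exact hs k h

theorem eq_sum_vec (h : Plane) : h = ∑ a, h a • vec a := by
  ext i
  fin_cases i <;> simp [Fin.sum_univ_two]

theorem D_eq_sum (h : Plane) (f : TF) (x : Plane) : f.D h x = ∑ a, h a * f.d a x := by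
  simp only [d, D_apply]
  conv_lhs => rw [eq_sum_vec h]
  simp

theorem memLp (f : TF) (p : ℝ≥0∞) : MemLp f p volume :=
  f.continuous.memLp_of_hasCompactSupport f.supp

/-- The class of a test function in `L²`. -/
noncomputable def toL2 (f : TF) : L2 := (f.memLp 2).toLp

theorem coeFn_toL2 (f : TF) : (f.toL2 : Plane → ℝ) =ᵐ[volume] f := MemLp.coeFn_toLp _

theorem toL2_sub (f g : TF) : (f.sub g).toL2 = f.toL2 - g.toL2 :=
  MemLp.toLp_sub (f.memLp 2) (g.memLp 2)

theorem exists_bound (f : TF) : ∃ A, 0 ≤ A ∧ ∀ x, |f x| ≤ A := by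
  obtain ⟨A, hA⟩ := f.continuous.bounded_above_of_compact_support f.supp
  exact ⟨A, (norm_nonneg _).trans (hA 0), hA⟩

theorem integral_D_mul (h : Plane) (f g : TF) :
    ∫ x, f.D h x * g x = - ∫ x, f x * g.D h x := by
  have := integral_mul_fderiv_eq_neg_fderiv_mul_of_integrable (μ := (volume : Measure Plane))
    (f := f) (g := g) (v := h) ?_ ?_ ?_ (fun x _ => f.differentiable x)
    (fun x _ => g.differentiable x)
  · simp only [D_apply]; rw [this]; simp
  · exact memLp_one_iff_integrable.1 (((f.D h).mul g).memLp 1)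
  · exact memLp_one_iff_integrable.1 ((f.mul (g.D h)).memLp 1)
  · exact memLp_one_iff_integrable.1 ((f.mul g).memLp 1)

end TF

theorem dense_toL2 : DenseRange TF.toL2 := by
  have := Lp.dense_hasCompactSupport_contDiff (E := Plane) (F := ℝ) (μ := volume) (p := 2) (by simp)
  refine this.mono ?_
  rintro f ⟨g, hfg, h1, h2⟩
  refine ⟨⟨g, h2, h1⟩, ?_⟩
  apply Lp.ext
  exact (TF.coeFn_toL2 _).trans hfg.symm

theorem inner_eq_integral (u v : L2) : inner ℝ u v = ∫ x, u x * v x := by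
  rw [L2.inner_def]
  congr 1; ext x; simp [mul_comm]

theorem inner_toL2 (u : L2) (f : TF) : inner ℝ u f.toL2 = ∫ x, u x * f x := by
  rw [inner_eq_integral]
  apply integral_congr_ae
  filter_upwards [f.coeFn_toL2] with x hx
  rw [hx]

theorem ext_toL2 {u v : L2} (h : ∀ f : TF, inner ℝ u f.toL2 = inner ℝ v f.toL2) : u = v := by
  rw [← sub_eq_zero]
  have : ∀ w : L2, inner ℝ (u - v) w = 0 := by
    intro w
    refine dense_toL2.induction_on (p := fun w => inner ℝ (u - v) w = 0) w
      (isClosed_eq (by fun_prop) continuous_const) ?_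
    intro f
    rw [inner_sub_left, h f, sub_self]
  exact inner_self_eq_zero.1 (this (u - v))

/-- To bound the norm of an element of `L²` it is enough to test with smooth functions. -/
theorem norm_le_of_inner_le {u : L2} {c : ℝ} (hc : 0 ≤ c)
    (h : ∀ f : TF, |inner ℝ u f.toL2| ≤ c * ‖f.toL2‖) : ‖u‖ ≤ c := by
  have : ∀ w : L2, |inner ℝ u w| ≤ c * ‖w‖ := by
    intro w
    refine dense_toL2.induction_on (p := fun w => |inner ℝ u w| ≤ c * ‖w‖) w
      (isClosed_le (by fun_prop) (by fun_prop)) h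
  have h1 := this u
  rw [real_inner_self_eq_norm_sq, abs_of_nonneg (by positivity)] at h1
  by_contra! h2
  nlinarith [norm_nonneg u]

/-! ### Translations -/

/-- Translation `(T h u)(x) = u (x + h)`. -/
noncomputable def T (h : Plane) : L2 →ₗᵢ[ℝ] L2 :=
  Lp.compMeasurePreservingₗᵢ ℝ (fun x => x + h) (measurePreserving_add_right volume h)

theorem coeFn_T (h : Plane) (u : L2) : (T h u : Plane → ℝ) =ᵐ[volume] fun x => u (x + h) :=
  Lp.coeFn_compMeasurePreserving u (measurePreserving_add_right volume h)

theorem ae_shift {p : Plane → Prop} (h : Plane) (hp : ∀ᵐ x, p x) : ∀ᵐ x, p (x + h) :=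
  (measurePreserving_add_right (volume : Measure Plane) h).quasiMeasurePreserving.ae hp

theorem T_toL2 (h : Plane) (f : TF) : T h f.toL2 = (f.shift h).toL2 := by
  apply Lp.ext
  filter_upwards [coeFn_T h f.toL2, (f.shift h).coeFn_toL2, ae_shift h f.coeFn_toL2] with x h1 h2 h3
  rw [h1, h2, h3, TF.shift_apply]

theorem inner_T_left (h : Plane) (u v : L2) : inner ℝ (T h u) v = inner ℝ u (T (-h) v) := by
  rw [inner_eq_integral, inner_eq_integral,
    ← integral_add_right_eq_self (fun x => u x * (T (-h) v) x) h]
  apply integral_congr_ae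
  filter_upwards [coeFn_T h u, ae_shift h (coeFn_T (-h) v)] with x h1 h2
  rw [h1, h2]; simp

theorem T_zero (u : L2) : T 0 u = u := by
  apply Lp.ext
  filter_upwards [coeFn_T 0 u] with x h1
  rw [h1, add_zero]

theorem norm_T (h : Plane) (u : L2) : ‖T h u‖ = ‖u‖ := (T h).norm_map u

/-- Convergence of mollifications and measurability of `h ↦ ‖T h u - u‖` both rest on this. -/
theorem continuous_T (u : L2) : Continuous fun h => T h u := by
  have hg : Continuous fun h : Plane => (⟨fun x => x + h, by fun_prop⟩ : C(Plane, Plane)) :=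
    ContinuousMap.continuous_of_continuous_uncurry _ (by
      simp only [Function.uncurry_def, ContinuousMap.coe_mk]; fun_prop)
  exact Continuous.compMeasurePreservingLp (f := fun _ => u) continuous_const hg
    (fun h => measurePreserving_add_right volume h) (by simp)

/-! ### Multiplication by bounded functions -/

/-- Almost everywhere bounded by `A`. -/
def CB (A : ℝ) (q : L2) : Prop := ∀ᵐ x, |q x| ≤ A

theorem CB.memLp {A : ℝ} {q : L2} (hq : CB A q) : MemLp q ∞ volume :=
  memLp_top_of_bound (Lp.aestronglyMeasurable q) A hq

theorem CB.mono {A B : ℝ} {q : L2} (hq : CB A q) (h : A ≤ B) : CB B q := by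
  filter_upwards [hq] with x hx using hx.trans h

theorem CB.of_TF (f : TF) {A : ℝ} (h : ∀ x, |f x| ≤ A) : CB A f.toL2 := by
  filter_upwards [f.coeFn_toL2] with x hx
  rw [hx]; exact h x

theorem CB.nonneg {A : ℝ} {q : L2} (hq : CB A q) : 0 ≤ A := by
  obtain ⟨x, hx⟩ := hq.exists
  exact (abs_nonneg _).trans hx

open Classical in
/-- Multiplication by a bounded function (and `0` by convention if `q` is not bounded). -/
noncomputable def mul (q : L2) : L2 →L[ℝ] L2 :=
  if h : MemLp q ∞ volume then
    (ContinuousLinearMap.mul ℝ ℝ).holderL volume ∞ 2 2 (h.toLp : Lp ℝ ∞ volume) else 0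

theorem coeFn_mul {A : ℝ} {q : L2} (hq : CB A q) (u : L2) :
    (mul q u : Plane → ℝ) =ᵐ[volume] fun x => q x * u x := by
  rw [mul, dif_pos hq.memLp]
  simp only [ContinuousLinearMap.holderL_apply_apply]
  filter_upwards [ContinuousLinearMap.coeFn_holder (r := 2) (ContinuousLinearMap.mul ℝ ℝ)
    (hq.memLp.toLp : Lp ℝ ∞ volume) u, hq.memLp.coeFn_toLp] with x h1 h2
  rw [h1, h2]; simp

theorem norm_mul_le {A : ℝ} {q : L2} (hq : CB A q) (u : L2) : ‖mul q u‖ ≤ A * ‖u‖ := by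
  refine Lp.norm_le_mul_norm_of_ae_le_mul ?_
  filter_upwards [coeFn_mul hq u, hq] with x h1 h2
  rw [h1, norm_mul]
  exact mul_le_mul_of_nonneg_right h2 (norm_nonneg _)

theorem mul_comm' {A B : ℝ} {q u : L2} (hq : CB A q) (hu : CB B u) : mul q u = mul u q := by
  apply Lp.ext
  filter_upwards [coeFn_mul hq u, coeFn_mul hu q] with x h1 h2
  rw [h1, h2, mul_comm]

theorem inner_mul_left {A : ℝ} {q : L2} (hq : CB A q) (u v : L2) :
    inner ℝ (mul q u) v = inner ℝ u (mul q v) := by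
  rw [inner_eq_integral, inner_eq_integral]
  apply integral_congr_ae
  filter_upwards [coeFn_mul hq u, coeFn_mul hq v] with x h1 h2
  rw [h1, h2]; ring

theorem CB.mulL {A B : ℝ} {q u : L2} (hq : CB A q) (hu : CB B u) :
    CB (A * B) (mul q u) := by
  filter_upwards [coeFn_mul hq u, hq, hu] with x h1 h2 h3
  rw [h1, abs_mul]
  exact mul_le_mul h2 h3 (abs_nonneg _) ((abs_nonneg _).trans h2)

theorem CB.add {A B : ℝ} {q u : L2} (hq : CB A q) (hu : CB B u) : CB (A + B) (q + u) := by
  filter_upwards [Lp.coeFn_add q u, hq, hu] with x h1 h2 h3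
  rw [h1]
  exact (abs_add_le _ _).trans (add_le_add h2 h3)

theorem CB.sub {A B : ℝ} {q u : L2} (hq : CB A q) (hu : CB B u) : CB (A + B) (q - u) := by
  filter_upwards [Lp.coeFn_sub q u, hq, hu] with x h1 h2 h3
  rw [h1]
  exact (abs_sub _ _).trans (add_le_add h2 h3)

theorem CB.translate {A : ℝ} {q : L2} (hq : CB A q) (h : Plane) : CB A (T h q) := by
  filter_upwards [coeFn_T h q, ae_shift h hq] with x h1 h2
  rw [h1]; exact h2

theorem mul_sub_left {A B : ℝ} {q r : L2} (hq : CB A q) (hr : CB B r) (u : L2) :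
    mul (q - r) u = mul q u - mul r u := by
  apply Lp.ext
  filter_upwards [coeFn_mul hq u, coeFn_mul hr u, coeFn_mul (hq.sub hr) u, Lp.coeFn_sub q r,
    Lp.coeFn_sub (mul q u) (mul r u)] with x h1 h2 h3 h4 h5
  rw [h3, h5, Pi.sub_apply, h1, h2, h4, Pi.sub_apply]; ring

theorem mul_mul {A B : ℝ} {q r : L2} (hq : CB A q) (hr : CB B r) (u : L2) :
    mul (mul q r) u = mul q (mul r u) := by
  apply Lp.ext
  filter_upwards [coeFn_mul hq r, coeFn_mul hr u, coeFn_mul (hq.mulL hr) u,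
    coeFn_mul hq (mul r u)] with x h1 h2 h3 h4
  rw [h3, h4, h1, h2]; ring

theorem T_mul {A : ℝ} {q : L2} (hq : CB A q) (h : Plane) (u : L2) :
    T h (mul q u) = mul (T h q) (T h u) := by
  apply Lp.ext
  filter_upwards [coeFn_T h (mul q u), ae_shift h (coeFn_mul hq u), coeFn_mul (hq.translate h) (T h u),
    coeFn_T h q, coeFn_T h u] with x h1 h2 h3 h4 h5
  rw [h1, h2, h3, h4, h5]

theorem exists_CB (f : TF) : ∃ A, CB A f.toL2 := by
  obtain ⟨A, _, hA⟩ := f.exists_bound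
  exact ⟨A, CB.of_TF f hA⟩

theorem mul_toL2 (f g : TF) : mul f.toL2 g.toL2 = (f.mul g).toL2 := by
  obtain ⟨A, hA⟩ := exists_CB f
  apply Lp.ext
  filter_upwards [coeFn_mul hA g.toL2, f.coeFn_toL2, g.coeFn_toL2, (f.mul g).coeFn_toL2]
    with x h1 h2 h3 h4
  rw [h1, h2, h3, h4, TF.mul_apply]

/-! ### Weak derivatives on the plane -/

/-- `v` is the weak derivative `∂_a u` on the whole plane. -/
def WD (a : Fin 2) (u v : L2) : Prop :=
  ∀ f : TF, inner ℝ u (f.d a).toL2 = - inner ℝ v f.toL2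

theorem WD.unique {a : Fin 2} {u v w : L2} (h1 : WD a u v) (h2 : WD a u w) : v = w := by
  apply ext_toL2
  intro f
  rw [← neg_inj, ← h1 f, h2 f]

open Classical in
/-- The weak derivative `∂_a u` (and `0` by convention if there is none in `L²`). -/
noncomputable def D (a : Fin 2) (u : L2) : L2 := if h : ∃ v, WD a u v then h.choose else 0

theorem WD.D_eq {a : Fin 2} {u v : L2} (h : WD a u v) : D a u = v := by
  have h' : ∃ v, WD a u v := ⟨v, h⟩
  rw [D, dif_pos h']
  exact h'.choose_spec.unique h

theorem WD.wd {a : Fin 2} {u v : L2} (h : WD a u v) : WD a u (D a u) := by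
  rwa [h.D_eq]

theorem WD.add {a : Fin 2} {u v u' v' : L2} (h : WD a u v) (h' : WD a u' v') :
    WD a (u + u') (v + v') := by
  intro f
  rw [inner_add_left, inner_add_left, h f, h' f]; ring

theorem WD.sub {a : Fin 2} {u v u' v' : L2} (h : WD a u v) (h' : WD a u' v') :
    WD a (u - u') (v - v') := by
  intro f
  rw [inner_sub_left, inner_sub_left, h f, h' f]; ring

theorem WD.smul {a : Fin 2} {u v : L2} (c : ℝ) (h : WD a u v) : WD a (c • u) (c • v) := by
  intro f
  rw [real_inner_smul_left, real_inner_smul_left, h f]; ring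

theorem WD.sum {ι : Type*} (t : Finset ι) {a : Fin 2} {u v : ι → L2}
    (h : ∀ i ∈ t, WD a (u i) (v i)) : WD a (∑ i ∈ t, u i) (∑ i ∈ t, v i) := by
  intro f
  rw [sum_inner, sum_inner, ← Finset.sum_neg_distrib]
  exact Finset.sum_congr rfl fun i hi => h i hi f

theorem WD.toL2 (a : Fin 2) (f : TF) : WD a f.toL2 (f.d a).toL2 := by
  intro g
  have h : ∀ f g : TF, inner ℝ f.toL2 g.toL2 = ∫ x, f x * g x := by
    intro f g
    rw [inner_toL2]
    apply integral_congr_ae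
    filter_upwards [f.coeFn_toL2] with x hx
    rw [hx]
  rw [h, h, TF.integral_D_mul, neg_neg]

theorem D_toL2 (a : Fin 2) (f : TF) : D a f.toL2 = (f.d a).toL2 := (WD.toL2 a f).D_eq

theorem WD.translate {a : Fin 2} {u v : L2} (h : WD a u v) (k : Plane) : WD a (T k u) (T k v) := by
  intro f
  rw [inner_T_left, inner_T_left, T_toL2, T_toL2, ← TF.D_shift, h]

/-- Weak derivatives commute. -/
theorem WD.comm {a b : Fin 2} {u ua uab ub : L2} (h1 : WD a u ua) (h2 : WD b ua uab)
    (h3 : WD b u ub) : WD a ub uab := by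
  intro f
  have e1 := h3 (f.d a)
  have e2 := h1 (f.d b)
  have e3 := h2 f
  rw [TF.d, TF.d, TF.D_comm] at e1
  linarith

/-- Weak differentiability is a closed condition. -/
theorem WD.of_tendsto {a : Fin 2} {ι : Type*} {l : Filter ι} [l.NeBot] {u v : ι → L2} {u₀ v₀ : L2}
    (h : ∀ i, WD a (u i) (v i)) (hu : Tendsto u l (𝓝 u₀)) (hv : Tendsto v l (𝓝 v₀)) :
    WD a u₀ v₀ := by
  intro f
  have h1 : Tendsto (fun i => inner ℝ (u i) (f.d a).toL2) l (𝓝 (inner ℝ u₀ (f.d a).toL2)) :=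
    hu.inner tendsto_const_nhds
  have h2 : Tendsto (fun i => - inner ℝ (v i) f.toL2) l (𝓝 (- inner ℝ v₀ f.toL2)) :=
    (hv.inner tendsto_const_nhds).neg
  refine tendsto_nhds_unique h1 (h2.congr fun i => (h i f).symm)

/-- Product rule with a test function. -/
theorem WD.mul_TF {a : Fin 2} {u v : L2} (h : WD a u v) (ζ : TF) :
    WD a (mul ζ.toL2 u) (mul ζ.toL2 v + mul (ζ.d a).toL2 u) := by
  intro f
  obtain ⟨A, hA⟩ := exists_CB ζ
  obtain ⟨B, hB⟩ := exists_CB (ζ.d a)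
  rw [inner_add_left, inner_mul_left hA, inner_mul_left hA, inner_mul_left hB, mul_toL2, mul_toL2,
    mul_toL2]
  have h1 := h (ζ.mul f)
  have h2 : ((ζ.mul f).d a).toL2 = (ζ.mul (f.d a)).toL2 + ((ζ.d a).mul f).toL2 := by
    apply Lp.ext
    filter_upwards [((ζ.mul f).d a).coeFn_toL2, (ζ.mul (f.d a)).coeFn_toL2,
      ((ζ.d a).mul f).coeFn_toL2,
      Lp.coeFn_add (ζ.mul (f.d a)).toL2 ((ζ.d a).mul f).toL2] with x h1 h2 h3 h4
    rw [h1, h4, Pi.add_apply, h2, h3, TF.D_mul, TF.mul_apply, TF.mul_apply]; ring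
  rw [h2, inner_add_right] at h1
  linarith


/-! ### Difference quotients -/

theorem locallyIntegrable (u : L2) : LocallyIntegrable u volume :=
  (Lp.memLp u).locallyIntegrable (by norm_num)

-- The pairing is the convolution of `u` with the reflection of `f`, evaluated at `-(t • h)`. The
-- derivative falls on the smooth factor, so `u` need not be differentiable.
open scoped Convolution in
theorem hasDerivAt_inner_T (u : L2) (f : TF) (h : Plane) (t : ℝ) :
    HasDerivAt (fun t : ℝ => inner ℝ u (T (t • h) f.toL2))
      (inner ℝ u (T (t • h) (f.D h).toL2)) t := by
  set g : Plane → ℝ := fun y => f (-y) with hg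
  have gs : ContDiff ℝ ∞ g := f.smooth.comp contDiff_neg
  have gc : HasCompactSupport g := f.supp.comp_homeomorph (Homeomorph.neg Plane)
  have conv : ∀ (f : TF) k, inner ℝ u (T k f.toL2) =
      ((u : Plane → ℝ) ⋆[ContinuousLinearMap.mul ℝ ℝ, volume] fun y => f (-y)) (-k) := by
    intro f k
    rw [T_toL2, inner_toL2, convolution_def]
    congr 1; ext x
    simp [TF.shift_apply, add_comm]
  have h1 := gc.hasFDerivAt_convolution_right (ContinuousLinearMap.mul ℝ ℝ)
    (locallyIntegrable u) (gs.of_le (by simp)) (-(t • h))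
  have h2 : HasDerivAt (fun t : ℝ => -(t • h)) (-h) t := by
    simpa using ((hasDerivAt_id t).smul_const h).fun_neg
  have h3 := h1.comp_hasDerivAt t h2
  simp only [conv]
  convert! h3 using 1
  rw [convolution_precompR_apply (hf := locallyIntegrable u) (hcg := gc.fderiv (𝕜 := ℝ))
    (hg := gs.continuous_fderiv (by simp))]
  congr 1
  ext y
  have hd : fderiv ℝ g y = - fderiv ℝ f (-y) := by
    have h4 := (f.differentiable (-y)).hasFDerivAt.comp y (hasFDerivAt_id y).neg
    refine h4.fderiv.trans ?_
    ext; simp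
  rw [TF.D_apply, hd]
  simp

/-- A function with bounded difference quotients in a coordinate direction is weakly
differentiable in that direction. -/
theorem exists_WD_of_norm_sub_le {u : L2} {a : Fin 2} {K : ℝ}
    (h : ∀ t : ℝ, 0 < t → t ≤ 1 → ‖T (t • vec a) u - u‖ ≤ K * t) :
    ∃ v, WD a u v ∧ ‖v‖ ≤ K := by
  set t : ℕ → ℝ := fun n => 1 / ((n : ℝ) + 1) with ht
  have t0 : ∀ n, 0 < t n := fun n => by positivity
  have t1 : ∀ n, t n ≤ 1 := fun n => by
    rw [ht]; simp only; rw [div_le_one (by positivity)]; linarith [(Nat.cast_nonneg n : (0:ℝ) ≤ n)]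
  set w : ℕ → L2 := fun n => (t n)⁻¹ • (T (t n • vec a) u - u) with hw
  have wK : ∀ n, ‖w n‖ ≤ K := by
    intro n
    rw [hw]; simp only
    rw [norm_smul, norm_inv, Real.norm_of_nonneg (t0 n).le, inv_mul_le_iff₀ (t0 n), mul_comm]
    exact h _ (t0 n) (t1 n)
  -- Banach–Alaoglu: the bounded difference quotients converge weakly along an ultrafilter finer
  -- than `atTop`. The limit is the derivative sought.
  have hcpt := WeakDual.isCompact_closedBall (0 : StrongDual ℝ L2) K
  set ℓ : ℕ → WeakDual ℝ L2 := fun n =>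
    StrongDual.toWeakDual (InnerProductSpace.toDual ℝ L2 (w n)) with hℓ
  obtain ⟨L, hL, hle⟩ := hcpt.ultrafilter_le_nhds (Ultrafilter.map ℓ (hyperfilter ℕ)) (by
    rw [le_principal_iff, Ultrafilter.mem_coe, Ultrafilter.mem_map]
    refine Filter.univ_mem' fun n => ?_
    simp only [Set.mem_preimage, mem_closedBall_zero_iff]
    exact ((InnerProductSpace.toDual ℝ L2).norm_map (w n)).trans_le (wK n))
  have hLt : Tendsto ℓ (hyperfilter ℕ) (𝓝 L) := hle
  refine ⟨(InnerProductSpace.toDual ℝ L2).symm (WeakDual.toStrongDual L), fun f => ?_, ?_⟩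
  · have e1 : Tendsto (fun n => inner ℝ (w n) f.toL2) (hyperfilter ℕ) (𝓝 (L f.toL2)) :=
      (WeakDual.eval_continuous f.toL2).continuousAt.tendsto.comp hLt
    -- With the translation moved onto `f`, the pairing becomes the slope at `0` of a function that
    -- `hasDerivAt_inner_T` differentiates.
    have e2 : Tendsto (fun n => inner ℝ (w n) f.toL2) atTop (𝓝 (- inner ℝ u (f.d a).toL2)) := by
      have d := (hasDerivAt_inner_T u f (-vec a) 0).tendsto_slope_zero
      have tt : Tendsto t atTop (𝓝[≠] 0) := by
        refine tendsto_nhdsWithin_iff.2 ⟨tendsto_one_div_add_atTop_nhds_zero_nat, ?_⟩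
        exact Eventually.of_forall fun n => (t0 n).ne'
      have d2 := d.comp tt
      have e3 : (f.D (-vec a)).toL2 = - (f.d a).toL2 := by
        apply Lp.ext
        filter_upwards [(f.D (-vec a)).coeFn_toL2, (f.d a).coeFn_toL2,
          Lp.coeFn_neg (f.d a).toL2] with x h1 h2 h3
        rw [h1, h3, Pi.neg_apply, h2, TF.D_apply, TF.D_apply, map_neg]
      rw [zero_smul, T_zero, e3, T_zero, inner_neg_right] at d2
      refine d2.congr fun n => ?_
      simp only [Function.comp_apply, hw, zero_add]
      rw [real_inner_smul_left, inner_sub_left, inner_T_left, smul_neg, smul_eq_mul]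
    have e3 := tendsto_nhds_unique e1 (e2.mono_left Nat.hyperfilter_le_atTop)
    rw [InnerProductSpace.toDual_symm_apply]
    change _ = - L f.toL2
    rw [e3, neg_neg]
  · rw [LinearIsometryEquiv.norm_map]
    simpa using hL

/-- Mean value inequality for `t ↦ ⟨u, T (-t h) f⟩` on `[0, 1]`. The bound `N` is left open so that
both the `L²` estimate (`N = M ‖f‖₂`) and the `L^∞` estimate (`N = A ‖f‖₁`) follow. -/
theorem abs_inner_T_sub_le {u : L2} {v : Fin 2 → L2} (hv : ∀ a, WD a u (v a)) (h : Plane) (f : TF)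
    {N : ℝ} (hN : ∀ a k, |inner ℝ (v a) (f.shift k).toL2| ≤ N) :
    |inner ℝ (T h u - u) f.toL2| ≤ 2 * N * ‖h‖ := by
  have key : ∀ t : ℝ, HasDerivAt (fun t : ℝ => inner ℝ u (T (t • (-h)) f.toL2))
      (∑ a, h a * inner ℝ (v a) (f.shift (t • (-h))).toL2) t := by
    intro t
    convert hasDerivAt_inner_T u f (-h) t using 1
    have e : ∀ a, inner ℝ (v a) (f.shift (t • (-h))).toL2 =
        - ∫ x, u x * (f.d a) (x + t • (-h)) := by
      intro a
      rw [← neg_eq_iff_eq_neg, ← hv a, inner_toL2, TF.d, TF.D_shift]; rfl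
    have hi : ∀ a, Integrable fun x => u x * (f.d a) (x + t • (-h)) := fun a =>
      MemLp.integrable_mul (Lp.memLp u) (((f.d a).shift (t • (-h))).memLp 2)
    simp only [e]
    rw [T_toL2, inner_toL2, Fin.sum_univ_two, mul_neg, mul_neg, ← integral_const_mul,
      ← integral_const_mul, ← neg_add, ← integral_add ((hi 0).const_mul _) ((hi 1).const_mul _),
      ← integral_neg]
    congr 1; ext x
    have := TF.D_eq_sum (-h) f (x + t • (-h))
    rw [Fin.sum_univ_two] at this
    rw [TF.shift_apply, this]
    simp only [PiLp.neg_apply]; ring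
  have hb : ∀ t ∈ Set.Ico (0:ℝ) 1,
      ‖∑ a, h a * inner ℝ (v a) (f.shift (t • (-h))).toL2‖ ≤ 2 * N * ‖h‖ := by
    intro t _
    refine (norm_sum_le _ _).trans ?_
    rw [Fin.sum_univ_two, norm_mul, norm_mul]
    have h0 := PiLp.norm_apply_le h 0
    have h1 := PiLp.norm_apply_le h 1
    have n0 := hN 0 (t • (-h))
    have n1 := hN 1 (t • (-h))
    rw [← Real.norm_eq_abs] at n0 n1
    have := mul_le_mul h0 n0 (norm_nonneg _) (norm_nonneg _)
    have := mul_le_mul h1 n1 (norm_nonneg _) (norm_nonneg _)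
    linarith
  have := norm_image_sub_le_of_norm_deriv_le_segment_01' (fun t _ => (key t).hasDerivWithinAt) hb
  rw [inner_sub_left, inner_T_left]
  simpa [T_zero, zero_smul] using this

/-- Differences are bounded by the gradient. -/
theorem norm_T_sub_le {u : L2} {v : Fin 2 → L2} (hv : ∀ a, WD a u (v a)) {M : ℝ}
    (hM : ∀ a, ‖v a‖ ≤ M) (h : Plane) : ‖T h u - u‖ ≤ 2 * M * ‖h‖ := by
  have M0 : 0 ≤ M := (norm_nonneg _).trans (hM 0)
  refine norm_le_of_inner_le (by positivity) fun f => ?_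
  refine (abs_inner_T_sub_le hv h f (N := M * ‖f.toL2‖) fun a k => ?_).trans_eq (by ring)
  rw [← T_toL2]
  refine (abs_real_inner_le_norm _ _).trans ?_
  rw [norm_T]
  exact mul_le_mul_of_nonneg_right (hM a) (norm_nonneg _)

open scoped Convolution in
/-- Almost everywhere bounds by duality. -/
theorem CB.of_inner_le {u : L2} {c : ℝ} (h : ∀ f : TF, |inner ℝ u f.toL2| ≤ c * ∫ x, |f x|) :
    CB c u := by
  -- Test with mollifiers of unit mass centred at a Lebesgue point `x`; the pairings converge to `u
  -- x`.
  let φ : ℕ → ContDiffBump (0 : Plane) := fun n =>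
    ⟨1 / ((n : ℝ) + 1), 2 / ((n : ℝ) + 1), by positivity, by gcongr; norm_num⟩
  have h1 : Tendsto (fun n => (φ n).rOut) atTop (𝓝 0) := by
    have := (tendsto_one_div_add_atTop_nhds_zero_nat (𝕜 := ℝ)).const_mul 2
    simpa [φ, div_eq_mul_inv] using this
  have h2 : ∀ᶠ n in atTop, (φ n).rOut ≤ 2 * (φ n).rIn :=
    Eventually.of_forall fun n => by simp only [φ]; rw [mul_one_div]
  filter_upwards [ContDiffBump.ae_convolution_tendsto_right_of_locallyIntegrable (μ := volume)
    h1 h2 (locallyIntegrable u)] with x hx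
  refine le_of_tendsto hx.abs (Eventually.of_forall fun n => ?_)
  let f : TF := ⟨fun y => (φ n).normed volume (x - y),
    (φ n).contDiff_normed.comp (contDiff_const.sub contDiff_id),
    ((φ n).hasCompactSupport_normed).comp_homeomorph (Homeomorph.subLeft x)⟩
  have e1 : (((φ n).normed volume) ⋆[ContinuousLinearMap.lsmul ℝ ℝ, volume] (u : Plane → ℝ)) x
      = inner ℝ u f.toL2 := by
    rw [convolution_eq_swap, inner_toL2]
    congr 1; ext y
    simp [f, mul_comm]
  have e2 : ∫ y, |f y| = 1 := by
    have : ∀ y, |f y| = (φ n).normed volume (x - y) := fun y =>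
      abs_of_nonneg ((φ n).nonneg_normed _)
    simp only [this]
    rw [integral_sub_left_eq_self (fun y => (φ n).normed volume y), (φ n).integral_normed]
  have := h f
  rw [e2, mul_one] at this
  rw [e1]; exact this

theorem abs_inner_toL2_le {u : L2} {A : ℝ} (hu : CB A u) (f : TF) :
    |inner ℝ u f.toL2| ≤ A * ∫ x, |f x| := by
  rw [inner_toL2, ← integral_const_mul]
  refine (abs_integral_le_integral_abs).trans ?_
  have hi := (memLp_one_iff_integrable.1 (f.memLp 1)).abs
  refine integral_mono_of_nonneg (Eventually.of_forall fun x => abs_nonneg _) (hi.const_mul A) ?_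
  filter_upwards [hu] with x hx
  simp only [abs_mul]
  exact mul_le_mul_of_nonneg_right hx (abs_nonneg _)

theorem CB.translate_sub {q : L2} {v : Fin 2 → L2} (hv : ∀ a, WD a q (v a)) {A : ℝ} (hA : ∀ a, CB A (v a))
    (h : Plane) : CB (2 * A * ‖h‖) (T h q - q) := by
  refine CB.of_inner_le fun f => ?_
  refine (abs_inner_T_sub_le hv h f (N := A * ∫ x, |f x|) fun a k => ?_).trans_eq (by ring)
  refine (abs_inner_toL2_le (hA a) _).trans_eq ?_
  congr 1
  exact integral_add_right_eq_self (fun x => |f x|) k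

/-! ### Density of test functions -/

/-- `f` is the mollification of `z` with the kernel `φ`. -/
def IsMoll (φ : ContDiffBump (0 : Plane)) (f : TF) (z : L2) : Prop :=
  ∀ g : TF, inner ℝ f.toL2 g.toL2 = ∫ h, φ.normed volume h * inner ℝ (T (-h) z) g.toL2

/-- Mollification averages translates, and translation preserves weak derivatives; defining `IsMoll`
by pairings avoids differentiating a convolution of an `L²` function. -/
theorem IsMoll.d {φ : ContDiffBump (0 : Plane)} {f : TF} {z v : L2} {a : Fin 2}
    (h : IsMoll φ f z) (hv : WD a z v) : IsMoll φ (f.d a) v := by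
  intro g
  have h1 := WD.toL2 a f g
  rw [h (g.d a)] at h1
  rw [← neg_inj, ← h1, ← integral_neg]
  congr 1; ext k
  rw [(hv.translate (-k)) g]; ring

/-- The mollification is an average, of total mass one, of translates of `z` by vectors shorter than
`φ.rOut`. -/
theorem IsMoll.norm_sub_le {φ : ContDiffBump (0 : Plane)} {f : TF} {z : L2} {ε : ℝ}
    (h : IsMoll φ f z) (hε : ∀ k : Plane, ‖k‖ < φ.rOut → ‖T k z - z‖ ≤ ε) :
    ‖f.toL2 - z‖ ≤ ε := by
  have ε0 : 0 ≤ ε := (norm_nonneg _).trans (hε 0 (by simpa using φ.rOut_pos))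
  refine norm_le_of_inner_le ε0 fun g => ?_
  have hint : ∀ G : Plane → ℝ, Continuous G → Integrable fun k => φ.normed volume k * G k := by
    intro G hG
    exact (φ.continuous_normed.mul hG).integrable_of_hasCompactSupport
      φ.hasCompactSupport_normed.mul_right
  have e : inner ℝ (f.toL2 - z) g.toL2 =
      ∫ k, φ.normed volume k * inner ℝ (T (-k) z - z) g.toL2 := by
    have : ∀ k, φ.normed volume k * inner ℝ (T (-k) z - z) g.toL2 =
        φ.normed volume k * inner ℝ (T (-k) z) g.toL2 - φ.normed volume k * inner ℝ z g.toL2 := by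
      intro k; rw [inner_sub_left]; ring
    simp only [this]
    rw [integral_sub (hint (fun k => inner ℝ (T (-k) z) g.toL2)
      (((continuous_T z).comp continuous_neg).inner continuous_const))
      (hint _ continuous_const), ← h g, integral_mul_const, φ.integral_normed, one_mul,
      inner_sub_left]
  rw [e]
  have hb : ∀ k, ‖φ.normed volume k * inner ℝ (T (-k) z - z) g.toL2‖ ≤
      φ.normed volume k * (ε * ‖g.toL2‖) := by
    intro k
    rw [norm_mul, Real.norm_of_nonneg (φ.nonneg_normed k)]
    by_cases hk : ‖k‖ < φ.rOut
    · refine mul_le_mul_of_nonneg_left ?_ (φ.nonneg_normed k)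
      refine (abs_real_inner_le_norm _ _).trans ?_
      exact mul_le_mul_of_nonneg_right (hε _ (by rwa [norm_neg])) (norm_nonneg _)
    · have : φ.normed volume k = 0 := by
        have : k ∉ Function.support (φ.normed volume) := by
          rw [φ.support_normed_eq]; simpa using hk
        simpa using this
      simp [this]
  refine (norm_integral_le_of_norm_le (hint _ continuous_const) (Eventually.of_forall hb)).trans_eq ?_
  rw [integral_mul_const, φ.integral_normed, one_mul]

-- Bounded support of `z` makes the convolution a genuine test function; the defining identity is
-- then Fubini.
open scoped Convolution in
theorem exists_isMoll {z : L2} {R : ℝ} (hz : ∀ᵐ x, R < ‖x‖ → z x = 0)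
    (φ : ContDiffBump (0 : Plane)) : ∃ f, IsMoll φ f z := by
  set z' : Plane → ℝ := (Metric.closedBall (0 : Plane) R).indicator z with hz'
  have hzz : z' =ᵐ[volume] z := by
    filter_upwards [hz] with x hx
    by_cases hR : x ∈ Metric.closedBall (0 : Plane) R
    · rw [hz', Set.indicator_of_mem hR]
    · rw [hz', Set.indicator_of_notMem hR, hx (by simpa using hR)]
  have zc : HasCompactSupport z' := by
    refine HasCompactSupport.of_support_subset_isCompact (isCompact_closedBall (0 : Plane) R) ?_
    exact Set.support_indicator_subset
  have zm : MemLp z' 2 volume := (memLp_congr_ae hzz).2 (Lp.memLp z)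
  have zi : Integrable z' := by
    rw [hz', integrable_indicator_iff Metric.isClosed_closedBall.measurableSet]
    exact (locallyIntegrable z).integrableOn_isCompact (isCompact_closedBall _ _)
  refine ⟨⟨φ.normed volume ⋆[ContinuousLinearMap.mul ℝ ℝ, volume] z',
    φ.hasCompactSupport_normed.contDiff_convolution_left _ φ.contDiff_normed zi.locallyIntegrable,
    φ.hasCompactSupport_normed.convolution _ zc⟩, fun g => ?_⟩
  have e1 : ∀ k, inner ℝ (T (-k) z) g.toL2 = ∫ x, z' (x - k) * g x := by
    intro k
    rw [inner_toL2]
    apply integral_congr_ae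
    filter_upwards [coeFn_T (-k) z, ae_shift (-k) hzz] with x h1 h2
    rw [h1, ← h2, sub_eq_add_neg]
  rw [real_inner_comm, inner_toL2]
  simp only [e1, ← integral_const_mul]
  have hI := Integrable.convolution_integrand (ContinuousLinearMap.mul ℝ ℝ)
    (memLp_one_iff_integrable.1 ((⟨φ.normed volume, φ.contDiff_normed,
      φ.hasCompactSupport_normed⟩ : TF).memLp 1)) zi (ν := volume) (μ := volume)
  obtain ⟨A, _, hA⟩ := g.exists_bound
  have hI2 : Integrable (fun p : Plane × Plane =>
      φ.normed volume p.2 * (z' (p.1 - p.2) * g p.1)) (volume.prod volume) := by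
    have := hI.bdd_mul (f := fun p : Plane × Plane => g p.1) (c := A)
      (g.continuous.comp continuous_fst).aestronglyMeasurable (Eventually.of_forall fun p => hA _)
    refine this.congr (Eventually.of_forall fun p => ?_)
    simp; ring
  rw [← integral_integral_swap hI2]
  apply integral_congr_ae
  filter_upwards [g.coeFn_toL2] with x hx
  rw [hx, convolution_def]
  simp only [ContinuousLinearMap.mul_apply']
  rw [mul_comm, ← integral_mul_const]
  congr 1; ext t; ring

/-- A single kernel has to serve `z` together with its weak derivatives, which are listed in `y`. -/
theorem exists_moll_family {z : L2} {R : ℝ} (hz : ∀ᵐ x, R < ‖x‖ → z x = 0) {ι : Type*} [Finite ι]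
    (y : ι → L2) {ε : ℝ} (hε : 0 < ε) :
    ∃ (φ : ContDiffBump (0 : Plane)) (f : TF), IsMoll φ f z ∧
      ∀ i k, ‖k‖ < φ.rOut → ‖T k (y i) - y i‖ ≤ ε := by
  have h1 : ∀ i, ∀ᶠ k in 𝓝 (0 : Plane), ‖T k (y i) - y i‖ < ε := by
    intro i
    have : Tendsto (fun k => ‖T k (y i) - y i‖) (𝓝 0) (𝓝 ‖T 0 (y i) - y i‖) :=
      (((continuous_T (y i)).sub continuous_const).norm).tendsto 0
    rw [T_zero, sub_self, norm_zero] at this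
    exact this.eventually_lt_const hε
  obtain ⟨δ, hδ, hb⟩ := Metric.eventually_nhds_iff.1 (eventually_all.2 h1)
  let φ : ContDiffBump (0 : Plane) := ⟨δ / 2, δ, by positivity, by linarith⟩
  obtain ⟨f, hf⟩ := exists_isMoll hz φ
  exact ⟨φ, f, hf, fun i k hk => (hb (by simpa using hk) i).le⟩

/-! ### Cutoffs at large scale and approximation by test functions -/

/-- A fixed cutoff function. -/
noncomputable def cut (R : ℝ) (hR : R ≠ 0) : TF where
  toFun x := (⟨1, 2, one_pos, one_lt_two⟩ : ContDiffBump (0 : Plane)) (R⁻¹ • x)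
  smooth := (ContDiffBump.contDiff _).comp (contDiff_const_smul _)
  supp := (ContDiffBump.hasCompactSupport _).comp_homeomorph
    (Homeomorph.smulOfNeZero R⁻¹ (inv_ne_zero hR))

theorem cut_eq_one {R : ℝ} (hR : 0 < R) {x : Plane} (hx : ‖x‖ ≤ R) : cut R hR.ne' x = 1 := by
  refine ContDiffBump.one_of_mem_closedBall _ ?_
  rw [mem_closedBall_zero_iff, norm_smul, norm_inv, Real.norm_of_nonneg hR.le]
  rw [inv_mul_le_iff₀ hR]; simpa using hx

theorem cut_eq_zero {R : ℝ} (hR : 0 < R) {x : Plane} (hx : 2 * R ≤ ‖x‖) : cut R hR.ne' x = 0 := by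
  refine ContDiffBump.zero_of_le_dist _ ?_
  rw [dist_zero_right, norm_smul, norm_inv, Real.norm_of_nonneg hR.le]
  rw [le_inv_mul_iff₀ hR]; linarith

theorem abs_cut_le {R : ℝ} (hR : 0 < R) (x : Plane) : |cut R hR.ne' x| ≤ 1 := by
  have : cut R hR.ne' x = (⟨1, 2, one_pos, one_lt_two⟩ : ContDiffBump (0 : Plane)) (R⁻¹ • x) := rfl
  rw [this, abs_of_nonneg (ContDiffBump.nonneg' _ _)]
  exact ContDiffBump.le_one _

theorem D_cut {R : ℝ} (hR : 0 < R) (h : Plane) (x : Plane) :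
    (cut R hR.ne').D h x = R⁻¹ * (cut 1 one_ne_zero).D h (R⁻¹ • x) := by
  set b : ContDiffBump (0 : Plane) := ⟨1, 2, one_pos, one_lt_two⟩ with hb
  have e : ∀ (S : ℝ) (hS : S ≠ 0) (x : Plane), (cut S hS).D h x = S⁻¹ * fderiv ℝ b (S⁻¹ • x) h := by
    intro S hS x
    have : (cut S hS : Plane → ℝ) = fun x => b (S⁻¹ • x) := rfl
    rw [TF.D_apply, this, fderiv_comp_smul]
    simp
  rw [e, e]; simp

theorem D_D_cut {R : ℝ} (hR : 0 < R) (h k : Plane) (x : Plane) :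
    ((cut R hR.ne').D h).D k x = R⁻¹ * R⁻¹ * ((cut 1 one_ne_zero).D h).D k (R⁻¹ • x) := by
  have : ((cut R hR.ne').D h : Plane → ℝ) = fun x => R⁻¹ * (cut 1 one_ne_zero).D h (R⁻¹ • x) :=
    funext fun x => D_cut hR h x
  rw [TF.D_apply, this, fderiv_const_mul, fderiv_comp_smul]
  · simp [TF.D_apply, mul_assoc]
  · exact (((cut 1 one_ne_zero).D h).differentiable _).comp x (by fun_prop)

/-- First derivatives scale like `R⁻¹` and second ones like `R⁻²`; the condition `1 ≤ R` lets one
rate cover both. -/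
theorem exists_cut_bound : ∃ A : ℝ, 0 ≤ A ∧ ∀ (R : ℝ) (hR : 0 < R), 1 ≤ R →
    (∀ a, CB (A * R⁻¹) ((cut R hR.ne').d a).toL2) ∧
    ∀ a b, CB (A * R⁻¹) (((cut R hR.ne').d a).d b).toL2 := by
  choose A hA0 hA using fun a => ((cut 1 one_ne_zero).d a).exists_bound
  choose B hB0 hB using fun p : Fin 2 × Fin 2 => (((cut 1 one_ne_zero).d p.1).d p.2).exists_bound
  refine ⟨∑ a, A a + ∑ p, B p, by
    have := Finset.sum_nonneg fun a (_ : a ∈ Finset.univ) => hA0 a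
    have := Finset.sum_nonneg fun a (_ : a ∈ Finset.univ) => hB0 a
    linarith, fun R hR h1 => ⟨fun a => CB.of_TF _ fun x => ?_, fun a b => CB.of_TF _ fun x => ?_⟩⟩
  · rw [D_cut hR, abs_mul, abs_of_nonneg (inv_nonneg.2 hR.le), mul_comm]
    refine mul_le_mul_of_nonneg_right ((hA a _).trans ?_) (inv_nonneg.2 hR.le)
    have := Finset.single_le_sum (fun a _ => hA0 a) (Finset.mem_univ a)
    have := Finset.sum_nonneg fun a (_ : a ∈ Finset.univ) => hB0 a
    linarith
  · rw [D_D_cut hR, abs_mul, abs_of_nonneg (by positivity), mul_comm]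
    have h2 : R⁻¹ * R⁻¹ ≤ R⁻¹ := mul_le_of_le_one_left (inv_nonneg.2 hR.le) (inv_le_one_of_one_le₀ h1)
    have h3 : |(((cut 1 one_ne_zero).d a).d b) (R⁻¹ • x)| ≤ ∑ a, A a + ∑ p, B p := by
      refine (hB (a, b) _).trans ?_
      have := Finset.single_le_sum (fun a _ => hB0 a) (Finset.mem_univ (a, b))
      have := Finset.sum_nonneg fun a (_ : a ∈ Finset.univ) => hA0 a
      linarith
    exact mul_le_mul h3 h2 (by positivity) ((abs_nonneg _).trans h3)

/-- On a fixed test function the cutoff eventually acts as the identity. Density and the bound `1`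
for the cutoffs do the rest. -/
theorem tendsto_mul_cut (u : L2) {r : ℕ → ℝ} (r0 : ∀ n, 0 < r n) (hr : Tendsto r atTop atTop) :
    Tendsto (fun n => mul (cut (r n) (r0 n).ne').toL2 u) atTop (𝓝 u) := by
  rw [Metric.tendsto_atTop]
  intro ε hε
  obtain ⟨f, hf⟩ := dense_toL2.exists_dist_lt u (half_pos hε)
  obtain ⟨R, hR⟩ := f.supp.isCompact.isBounded.subset_closedBall (0 : Plane)
  obtain ⟨N, hN⟩ := eventually_atTop.1 (hr.eventually_ge_atTop R)
  refine ⟨N, fun n hn => ?_⟩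
  have hc : CB 1 (cut (r n) (r0 n).ne').toL2 := CB.of_TF _ (abs_cut_le (r0 n))
  have e : mul (cut (r n) (r0 n).ne').toL2 f.toL2 = f.toL2 := by
    rw [mul_toL2]
    congr 1
    ext x
    rw [TF.mul_apply]
    by_cases hx : ‖x‖ ≤ r n
    · rw [cut_eq_one (r0 n) hx, one_mul]
    · have : f x = 0 := image_eq_zero_of_notMem_tsupport fun h => hx (by
        have := hR h
        rw [mem_closedBall_zero_iff] at this
        exact this.trans (hN n hn))
      rw [this, mul_zero]
  have e2 : mul (cut (r n) (r0 n).ne').toL2 u - u =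
      mul (cut (r n) (r0 n).ne').toL2 (u - f.toL2) + (f.toL2 - u) := by
    rw [map_sub, e]; abel
  rw [dist_eq_norm, e2]
  rw [dist_eq_norm] at hf
  refine (norm_add_le _ _).trans_lt ?_
  have := norm_mul_le hc (u - f.toL2)
  rw [norm_sub_rev f.toL2 u]
  linarith

theorem tendsto_mul_zero (u : L2) {q : ℕ → L2} {A : ℝ} {r : ℕ → ℝ} (hr : Tendsto r atTop atTop)
    (h : ∀ n, CB (A * (r n)⁻¹) (q n)) : Tendsto (fun n => mul (q n) u) atTop (𝓝 0) := by
  refine squeeze_zero_norm (fun n => norm_mul_le (h n) u) ?_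
  have := ((tendsto_inv_atTop_zero.comp hr).const_mul A).mul_const ‖u‖
  simpa using this

theorem mul_cut_ae_zero {R : ℝ} (hR : 0 < R) (u : L2) :
    ∀ᵐ x, 2 * R < ‖x‖ → mul (cut R hR.ne').toL2 u x = 0 := by
  filter_upwards [coeFn_mul (CB.of_TF _ (abs_cut_le hR)) u, (cut R hR.ne').coeFn_toL2]
    with x h1 h2 hx
  rw [h1, h2, cut_eq_zero hR hx.le, zero_mul]

/-- Cut off at a large radius, then mollify. The term in which the derivative hits the cutoff tends
to zero by `tendsto_mul_zero`. -/
theorem exists_TF_near {u v : L2} {a : Fin 2} (h : WD a u v) {ε : ℝ} (hε : 0 < ε) :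
    ∃ f : TF, ‖f.toL2 - u‖ < ε ∧ ‖(f.d a).toL2 - v‖ < ε := by
  obtain ⟨A, A0, hA⟩ := exists_cut_bound
  let r : ℕ → ℝ := fun n => n + 1
  have r0 : ∀ n, 0 < r n := fun n => by positivity
  have r1 : ∀ n, 1 ≤ r n := fun n => by simp [r]
  have hr : Tendsto r atTop atTop := tendsto_atTop_add_const_right _ _ tendsto_natCast_atTop_atTop
  let c : ℕ → TF := fun n => cut (r n) (r0 n).ne'
  have t1 : Tendsto (fun n => mul (c n).toL2 u) atTop (𝓝 u) := tendsto_mul_cut u r0 hr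
  have t2 : Tendsto (fun n => mul (c n).toL2 v + mul ((c n).d a).toL2 u) atTop (𝓝 (v + 0)) :=
    (tendsto_mul_cut v r0 hr).add (tendsto_mul_zero u hr fun n => (hA _ (r0 n) (r1 n)).1 a)
  rw [add_zero] at t2
  obtain ⟨n, n1, n2⟩ := ((Metric.tendsto_nhds.1 t1 (ε / 2) (half_pos hε)).and
    (Metric.tendsto_nhds.1 t2 (ε / 2) (half_pos hε))).exists
  have w := h.mul_TF (c n)
  obtain ⟨φ, f, hf, hk⟩ := exists_moll_family (mul_cut_ae_zero (r0 n) u)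
    (![mul (c n).toL2 u, mul (c n).toL2 v + mul ((c n).d a).toL2 u] : Fin 2 → L2)
    (show 0 < ε / 2 by positivity)
  have m1 := hf.norm_sub_le (hk 0)
  have m2 := (hf.d w).norm_sub_le (hk 1)
  rw [dist_eq_norm] at n1 n2
  refine ⟨f, ?_, ?_⟩
  · refine (norm_sub_le_norm_sub_add_norm_sub _ (mul (c n).toL2 u) _).trans_lt ?_
    linarith
  · refine (norm_sub_le_norm_sub_add_norm_sub _ (mul (c n).toL2 v + mul ((c n).d a).toL2 u) _).trans_lt ?_
    linarith

theorem exists_TF_near_two {z : L2} {z1 : Fin 2 → L2} {z2 : Fin 2 → Fin 2 → L2}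
    (h1 : ∀ a, WD a z (z1 a)) (h2 : ∀ a b, WD b (z1 a) (z2 a b)) {ε : ℝ} (hε : 0 < ε) :
    ∃ f : TF, ‖f.toL2 - z‖ < ε ∧ (∀ a, ‖(f.d a).toL2 - z1 a‖ < ε) ∧
      ∀ a b, ‖((f.d a).d b).toL2 - z2 a b‖ < ε := by
  obtain ⟨A, A0, hA⟩ := exists_cut_bound
  let r : ℕ → ℝ := fun n => n + 1
  have r0 : ∀ n, 0 < r n := fun n => by positivity
  have r1 : ∀ n, 1 ≤ r n := fun n => by simp [r]
  have hr : Tendsto r atTop atTop := tendsto_atTop_add_const_right _ _ tendsto_natCast_atTop_atTop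
  let c : ℕ → TF := fun n => cut (r n) (r0 n).ne'
  let y : ℕ → L2 := fun n => mul (c n).toL2 z
  let y1 : ℕ → Fin 2 → L2 := fun n a => mul (c n).toL2 (z1 a) + mul ((c n).d a).toL2 z
  let y2 : ℕ → Fin 2 × Fin 2 → L2 := fun n p =>
    (mul (c n).toL2 (z2 p.1 p.2) + mul ((c n).d p.2).toL2 (z1 p.1)) +
    (mul ((c n).d p.1).toL2 (z1 p.2) + mul (((c n).d p.1).d p.2).toL2 z)
  have t0 : Tendsto y atTop (𝓝 z) := tendsto_mul_cut z r0 hr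
  have t1 : ∀ a, Tendsto (fun n => y1 n a) atTop (𝓝 (z1 a)) := fun a => by
    simpa using (tendsto_mul_cut (z1 a) r0 hr).add
      (tendsto_mul_zero z hr fun n => (hA _ (r0 n) (r1 n)).1 a)
  have t2 : ∀ p : Fin 2 × Fin 2, Tendsto (fun n => y2 n p) atTop (𝓝 (z2 p.1 p.2)) := fun p => by
    simpa using ((tendsto_mul_cut (z2 p.1 p.2) r0 hr).add
      (tendsto_mul_zero (z1 p.1) hr fun n => (hA _ (r0 n) (r1 n)).1 p.2)).add
      ((tendsto_mul_zero (z1 p.2) hr fun n => (hA _ (r0 n) (r1 n)).1 p.1).add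
      (tendsto_mul_zero z hr fun n => (hA _ (r0 n) (r1 n)).2 p.1 p.2))
  obtain ⟨n, n0, n1, n2⟩ := ((Metric.tendsto_nhds.1 t0 (ε / 2) (half_pos hε)).and
    ((eventually_all.2 fun a => Metric.tendsto_nhds.1 (t1 a) (ε / 2) (half_pos hε)).and
    (eventually_all.2 fun a => Metric.tendsto_nhds.1 (t2 a) (ε / 2) (half_pos hε)))).exists
  have w1 : ∀ a, WD a (y n) (y1 n a) := fun a => (h1 a).mul_TF (c n)
  have w2 : ∀ a b, WD b (y1 n a) (y2 n (a, b)) := fun a b =>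
    ((h2 a b).mul_TF (c n)).add ((h1 b).mul_TF ((c n).d a))
  obtain ⟨φ, f, hf, hk⟩ := exists_moll_family (mul_cut_ae_zero (r0 n) z)
    (Sum.elim (fun _ : Unit => y n) (Sum.elim (y1 n) (y2 n))) (show 0 < ε / 2 by positivity)
  have m0 := hf.norm_sub_le (hk (Sum.inl ()))
  have m1 := fun a => (hf.d (w1 a)).norm_sub_le (hk (Sum.inr (Sum.inl a)))
  have m2 := fun a b => ((hf.d (w1 a)).d (w2 a b)).norm_sub_le (hk (Sum.inr (Sum.inr (a, b))))
  simp only [dist_eq_norm] at n0 n1 n2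
  refine ⟨f, ?_, fun a => ?_, fun a b => ?_⟩
  · refine (norm_sub_le_norm_sub_add_norm_sub _ (y n) _).trans_lt ?_
    linarith
  · refine (norm_sub_le_norm_sub_add_norm_sub _ (y1 n a) _).trans_lt ?_
    linarith [n1 a, m1 a]
  · refine (norm_sub_le_norm_sub_add_norm_sub _ (y2 n (a, b)) _).trans_lt ?_
    linarith [n2 (a, b), m2 a b]

/-- Product rule with a bounded weakly differentiable factor. -/
theorem WD.mulL {a : Fin 2} {q q' u v : L2} {A B : ℝ} (hq : WD a q q') (h : WD a u v)
    (hA : CB A q) (hB : CB B q') :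
    WD a (mul q u) (mul q v + mul q' u) := by
  choose f hf1 hf2 using fun n : ℕ => exists_TF_near h (show (0 : ℝ) < 1 / (n + 1) by positivity)
  have lim := tendsto_one_div_add_atTop_nhds_zero_nat (𝕜 := ℝ)
  have t1 : Tendsto (fun n => (f n).toL2) atTop (𝓝 u) :=
    tendsto_iff_norm_sub_tendsto_zero.2 (squeeze_zero (fun n => norm_nonneg _)
      (fun n => (hf1 n).le) lim)
  have t2 : Tendsto (fun n => ((f n).d a).toL2) atTop (𝓝 v) :=
    tendsto_iff_norm_sub_tendsto_zero.2 (squeeze_zero (fun n => norm_nonneg _)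
      (fun n => (hf2 n).le) lim)
  refine WD.of_tendsto (l := atTop) (fun n => ?_) (((mul q).continuous.tendsto u).comp t1)
    ((((mul q).continuous.tendsto v).comp t2).add
      (((mul q').continuous.tendsto u).comp t1))
  obtain ⟨C, hC⟩ := exists_CB (f n)
  obtain ⟨E, hE⟩ := exists_CB ((f n).d a)
  simp only [Function.comp_apply]
  -- The roles are exchanged: `q` is now the weakly differentiable function and `f n` the smooth
  -- factor.
  rw [mul_comm' hA hC, mul_comm' hA hE, mul_comm' hB hC, add_comm]
  exact hq.mul_TF (f n)


/-! ### A pointwise bound in two dimensions -/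

theorem TF.hasCompactSupport_line (f : TF) (p : Plane) (a : Fin 2) :
    HasCompactSupport fun t : ℝ => f (p + t • vec a) := by
  have : Isometry fun t : ℝ => p + t • vec a := by
    refine Isometry.of_dist_eq fun s t => ?_
    rw [dist_add_left, dist_eq_norm, ← sub_smul, norm_smul]
    simp [dist_eq_norm]
  exact f.supp.comp_isClosedEmbedding this.isClosedEmbedding

theorem TF.abs_le_integral_line (f : TF) (p : Plane) (a : Fin 2) :
    |f p| ≤ ∫ t : ℝ, |f.d a (p + t • vec a)| := by
  have hc : ContDiff ℝ ∞ fun t : ℝ => f (p + t • vec a) :=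
    f.smooth.comp (contDiff_const.add (contDiff_id.smul contDiff_const))
  have h1 := (f.hasCompactSupport_line p a).integral_Iic_deriv_eq (hc.of_le (by simp)) 0
  have hd : ∀ t : ℝ, deriv (fun t : ℝ => f (p + t • vec a)) t = f.d a (p + t • vec a) := by
    intro t
    have h2 : HasDerivAt (fun t : ℝ => p + t • vec a) (vec a) t := by
      simpa using ((hasDerivAt_id t).smul_const (vec a)).const_add p
    exact ((f.differentiable (p + t • vec a)).hasFDerivAt.comp_hasDerivAt t h2).deriv
  simp only [hd, zero_smul, add_zero] at h1
  rw [← h1]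
  refine (abs_integral_le_integral_abs).trans (setIntegral_le_integral ?_ ?_)
  · refine (Continuous.integrable_of_hasCompactSupport ?_ ((f.d a).hasCompactSupport_line p a)).abs
    exact (f.d a).continuous.comp (by fun_prop)
  · exact Eventually.of_forall fun t => abs_nonneg _

theorem measurePreserving_prod_plane :
    MeasurePreserving (fun p : ℝ × ℝ => (!₂[p.1, p.2] : Plane)) :=
  (PiLp.volume_preserving_toLp (Fin 2)).comp (volume_preserving_finTwoArrow ℝ).symm

theorem measurableEmbedding_prod_plane :
    MeasurableEmbedding (fun p : ℝ × ℝ => (!₂[p.1, p.2] : Plane)) :=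
  (MeasurableEquiv.toLp 2 (Fin 2 → ℝ)).measurableEmbedding.comp
    (MeasurableEquiv.finTwoArrow (α := ℝ)).symm.measurableEmbedding

/-- The fundamental theorem of calculus in each of the two coordinates, followed by Fubini. -/
theorem TF.abs_le_integral (f : TF) (x : Plane) : |f x| ≤ ∫ y, |(f.d 0).d 1 y| := by
  set G : Plane → ℝ := fun y => |(f.d 0).d 1 (y + x)| with hG
  have hi : Integrable G :=
    (memLp_one_iff_integrable.1 ((((f.d 0).d 1).shift x).memLp 1)).abs
  have hi2 : Integrable (fun p : ℝ × ℝ => G !₂[p.1, p.2]) (volume.prod volume) :=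
    (measurePreserving_prod_plane.integrable_comp_emb measurableEmbedding_prod_plane).2 hi
  have e : ∫ y, |(f.d 0).d 1 y| = ∫ s : ℝ, ∫ t : ℝ, G !₂[s, t] := by
    rw [← integral_add_right_eq_self _ x]
    change ∫ y, G y = _
    rw [← measurePreserving_prod_plane.integral_comp measurableEmbedding_prod_plane]
    exact integral_prod _ hi2
  rw [e]
  refine (f.abs_le_integral_line x 0).trans ?_
  refine integral_mono_of_nonneg (Eventually.of_forall fun t => abs_nonneg _)
    hi2.integral_prod_left (Eventually.of_forall fun s => ?_)
  refine ((f.d 0).abs_le_integral_line _ 1).trans_eq ?_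
  congr 1; ext t
  rw [hG]
  simp only
  congr 2
  ext i
  fin_cases i <;> simp [add_comm]

theorem TF.integral_abs_mul_le (f g : TF) {M : ℝ} (hf : ‖f.toL2‖ ≤ M) (hg : ‖g.toL2‖ ≤ M) :
    ∫ x, |f x * g x| ≤ M ^ 2 := by
  have sq : ∀ f : TF, ∫ x, f x * f x = ‖f.toL2‖ ^ 2 := by
    intro f
    rw [← real_inner_self_eq_norm_sq, inner_toL2]
    apply integral_congr_ae
    filter_upwards [f.coeFn_toL2] with x hx
    rw [hx]
  have hi : ∀ f : TF, Integrable fun x => f x * f x := fun f =>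
    memLp_one_iff_integrable.1 ((f.mul f).memLp 1)
  have h1 : ∫ x, |f x * g x| ≤ ∫ x, (1 / 2 : ℝ) * (f x * f x + g x * g x) := by
    refine integral_mono_of_nonneg (Eventually.of_forall fun t => abs_nonneg _)
      (((hi f).add (hi g)).const_mul _) (Eventually.of_forall fun x => ?_)
    simp only
    rw [abs_mul, ← abs_mul_abs_self (f x), ← abs_mul_abs_self (g x)]
    nlinarith [sq_nonneg (|f x| - |g x|)]
  rw [integral_const_mul, integral_add (hi f) (hi g), sq, sq] at h1
  nlinarith [norm_nonneg f.toL2, norm_nonneg g.toL2]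

/-- The `L¹` bound on `∂₀∂₁` is applied to `f²`: its mixed derivative is `2 (f ∂₀∂₁f + ∂₀f ∂₁f)`, a
sum of products of `L²` functions. -/
theorem TF.abs_le_of_norm_le (f : TF) {M : ℝ} (h0 : ‖f.toL2‖ ≤ M) (h1 : ∀ a, ‖(f.d a).toL2‖ ≤ M)
    (h2 : ∀ a b, ‖((f.d a).d b).toL2‖ ≤ M) (x : Plane) : |f x| ≤ 2 * M := by
  have M0 : 0 ≤ M := (norm_nonneg _).trans h0
  have e0 : ((f.mul f).d 0 : Plane → ℝ) = fun x => 2 * f.mul (f.d 0) x := by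
    ext x; rw [TF.D_mul, TF.mul_apply]; ring
  have e1 : ∀ x, ((f.mul f).d 0).d 1 x = 2 * (f x * (f.d 0).d 1 x + f.d 0 x * f.d 1 x) := by
    intro x
    rw [TF.D_apply, e0, fderiv_const_mul ((f.mul (f.d 0)).differentiable x)]
    rw [← TF.D_mul]; rfl
  have hb := (f.mul f).abs_le_integral x
  simp only [e1] at hb
  have hi : ∀ f g : TF, Integrable fun x => |f x * g x| := fun f g =>
    (memLp_one_iff_integrable.1 ((f.mul g).memLp 1)).abs
  have hb2 : ∫ y, |2 * (f y * (f.d 0).d 1 y + f.d 0 y * f.d 1 y)| ≤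
      ∫ y, 2 * (|f y * (f.d 0).d 1 y| + |f.d 0 y * f.d 1 y|) := by
    refine integral_mono_of_nonneg (Eventually.of_forall fun t => abs_nonneg _)
      (((hi _ _).add (hi _ _)).const_mul _) (Eventually.of_forall fun x => ?_)
    simp only
    rw [abs_mul, abs_two]
    exact mul_le_mul_of_nonneg_left (abs_add_le _ _) (by norm_num)
  rw [integral_const_mul, integral_add (hi _ _) (hi _ _)] at hb2
  have k1 := TF.integral_abs_mul_le f ((f.d 0).d 1) h0 (h2 0 1)
  have k2 := TF.integral_abs_mul_le (f.d 0) (f.d 1) (h1 0) (h1 1)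
  have : |f x| ^ 2 ≤ (2 * M) ^ 2 := by
    rw [TF.mul_apply, abs_mul, ← sq] at hb
    nlinarith
  exact abs_le_of_sq_le_sq' (by simpa using this) (by positivity) |> fun h => abs_le.2 h

/-- `H²` functions of two variables are bounded. -/
theorem CB.of_norm_le {z : L2} {z1 : Fin 2 → L2} {z2 : Fin 2 → Fin 2 → L2}
    (w1 : ∀ a, WD a z (z1 a)) (w2 : ∀ a b, WD b (z1 a) (z2 a b)) {M : ℝ}
    (h0 : ‖z‖ ≤ M) (h1 : ∀ a, ‖z1 a‖ ≤ M) (h2 : ∀ a b, ‖z2 a b‖ ≤ M) : CB (2 * M) z := by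
  refine CB.of_inner_le fun g => ?_
  refine le_of_forall_pos_le_add fun ε hε => ?_
  set I := ∫ x, |g x| with hI
  have I0 : 0 ≤ I := integral_nonneg fun x => abs_nonneg _
  -- Approximation within `η` costs `2 η I` in the pointwise bound and `η ‖g‖` in the pairing,
  -- together at most `ε`.
  set η := ε / (2 * I + ‖g.toL2‖ + 1) with hη
  have η0 : 0 < η := by positivity
  obtain ⟨f, f0, f1, f2⟩ := exists_TF_near_two w1 w2 η0
  have hf : ∀ {p q : L2}, ‖p - q‖ < η → ‖q‖ ≤ M → ‖p‖ ≤ M + η := by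
    intro p q h1 h2
    linarith [norm_le_norm_add_norm_sub' p q]
  have hb : CB (2 * (M + η)) f.toL2 := CB.of_TF f (f.abs_le_of_norm_le (hf f0 h0)
    (fun a => hf (f1 a) (h1 a)) (fun a b => hf (f2 a b) (h2 a b)))
  have k1 := abs_inner_toL2_le hb g
  have k2 : |inner ℝ (f.toL2 - z) g.toL2| ≤ η * ‖g.toL2‖ :=
    (abs_real_inner_le_norm _ _).trans (mul_le_mul_of_nonneg_right f0.le (norm_nonneg _))
  have e : inner ℝ z g.toL2 = inner ℝ f.toL2 g.toL2 - inner ℝ (f.toL2 - z) g.toL2 := by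
    rw [inner_sub_left]; ring
  have k3 : η * (2 * I + ‖g.toL2‖ + 1) = ε := by rw [hη]; field_simp
  rw [e]
  refine (abs_sub _ _).trans ?_
  nlinarith

/-! ### The fractional seminorm -/

/-- The weighted norm `(∫ f(h)² / |h|^{2+2s} dh)^{1/2}`. -/
noncomputable def FN (s : ℝ) (f : Plane → ℝ) : ℝ≥0∞ :=
  eLpNorm (fun h => f h / ‖h‖ ^ (1 + s)) 2 volume

/-- The Gagliardo seminorm of order `s` of `u` is at most `M`. -/
def FB (s M : ℝ) (u : L2) : Prop := FN s (fun h => ‖T h u - u‖) ≤ ENNReal.ofReal M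

theorem FN_mono {s : ℝ} {f g : Plane → ℝ} (h0 : ∀ h, 0 ≤ f h) (h : ∀ h, f h ≤ g h) :
    FN s f ≤ FN s g := by
  refine eLpNorm_mono_real fun x => ?_
  rw [Real.norm_of_nonneg (div_nonneg (h0 x) (by positivity))]
  exact div_le_div_of_nonneg_right (h x) (by positivity)

theorem measurable_div_rpow {s : ℝ} {f : Plane → ℝ} (hf : Continuous f) :
    AEStronglyMeasurable (fun h => f h / ‖h‖ ^ (1 + s)) volume :=
  (hf.measurable.div (measurable_norm.pow_const _)).aestronglyMeasurable

theorem FN_add_le {s : ℝ} {f g : Plane → ℝ} (hf : Continuous f) (hg : Continuous g) :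
    FN s (fun h => f h + g h) ≤ FN s f + FN s g := by
  unfold FN
  simp only [add_div]
  exact eLpNorm_add_le (measurable_div_rpow hf) (measurable_div_rpow hg) (by norm_num)

theorem FN_const_mul {s : ℝ} {f : Plane → ℝ} {c : ℝ} (hc : 0 ≤ c) :
    FN s (fun h => c * f h) = ENNReal.ofReal c * FN s f := by
  unfold FN
  simp only [mul_div_assoc]
  have := eLpNorm_const_smul c (fun h => f h / ‖h‖ ^ (1 + s)) 2 (volume : Measure Plane)
  rw [Real.enorm_of_nonneg hc] at this
  exact this

theorem FN_sum_le {s : ℝ} {ι : Type*} (t : Finset ι) (f : ι → Plane → ℝ)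
    (hf : ∀ i, Continuous (f i)) : FN s (fun h => ∑ i ∈ t, f i h) ≤ ∑ i ∈ t, FN s (f i) := by
  classical
  induction t using Finset.induction_on with
  | empty => simp [FN]
  | insert a t ha ih =>
    simp only [Finset.sum_insert ha]
    exact (FN_add_le (hf a) (continuous_finsetSum _ fun i _ => hf i)).trans (by gcongr)

/-- In polar coordinates the integrand is `y ^ (1 - 2s)` up to radius one, integrable since `s < 1`,
and `y ^ (-1 - 2s)` beyond, integrable since `s > 0`. -/
theorem FN_min_lt_top {s : ℝ} (hs : s ∈ Set.Ioo (0 : ℝ) 1) :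
    FN s (fun h => min 1 ‖h‖) < ⊤ := by
  have hm := measurable_div_rpow (s := s) (f := fun h : Plane => min 1 ‖h‖) (by fun_prop)
  suffices MemLp (fun h : Plane => min 1 ‖h‖ / ‖h‖ ^ (1 + s)) 2 volume from this.2
  rw [memLp_two_iff_integrable_sq hm]
  refine (integrable_fun_norm_addHaar (volume : Measure Plane)
    (f := fun y => (min 1 y / y ^ (1 + s)) ^ 2)).2 ?_
  simp only [finrank_euclideanSpace, Fintype.card_fin, smul_eq_mul]
  have hy1 : ∀ {y c : ℝ}, 0 < y → y ^ (1 + c) = y * y ^ c := fun h => by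
    rw [Real.rpow_add h, Real.rpow_one]
  rw [← Set.Ioc_union_Ioi_eq_Ioi zero_le_one]
  refine IntegrableOn.union ?_ ?_
  · have := (intervalIntegral.intervalIntegrable_rpow' (a := 0) (b := 1)
      (show -1 < 1 - 2 * s by linarith [hs.2])).1
    refine this.congr_fun (fun y hy => ?_) measurableSet_Ioc
    have y0 : 0 < y := hy.1
    simp only
    rw [min_eq_right hy.2, div_pow, ← Real.rpow_natCast (y ^ (1 + s)), ← Real.rpow_mul y0.le,
      pow_one, ← Real.rpow_natCast y, ← Real.rpow_sub y0, ← hy1 y0]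
    congr 1; push_cast; ring
  · have := integrableOn_Ioi_rpow_of_lt (a := -1 - 2 * s) (by linarith [hs.1]) (c := 1) one_pos
    refine this.congr_fun (fun y hy => ?_) measurableSet_Ioi
    have y0 : 0 < y := one_pos.trans hy
    simp only
    rw [min_eq_left (le_of_lt hy), div_pow, ← Real.rpow_natCast (y ^ (1 + s)), ← Real.rpow_mul y0.le,
      pow_one, one_pow, one_div, ← Real.rpow_neg y0.le, ← hy1 y0]
    congr 1; push_cast; ring

/-- The constant in the embedding of `H¹` into `H^s`. -/
noncomputable def cs (s : ℝ) : ℝ := (FN s (fun h => min 1 ‖h‖)).toReal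

theorem cs_nonneg (s : ℝ) : 0 ≤ cs s := ENNReal.toReal_nonneg

theorem continuous_norm_T_sub (u : L2) : Continuous fun h => ‖T h u - u‖ :=
  ((continuous_T u).sub continuous_const).norm

/-- Minkowski's inequality in the weighted norm: domination of differences for each translation
passes to the seminorms. The term with `min 1 ‖k‖` is the contribution of functions with Lipschitz
differences in `L²`. -/
theorem FB.of_le {s : ℝ} (hs : s ∈ Set.Ioo (0 : ℝ) 1) {ι : Type*} (t : Finset ι) {u : L2}
    {w : ι → L2} {B c : ι → ℝ} {d : ℝ} (hd : 0 ≤ d) (hc : ∀ i ∈ t, 0 ≤ c i) (hB : ∀ i ∈ t, 0 ≤ B i)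
    (hw : ∀ i ∈ t, FB s (B i) (w i))
    (h : ∀ k, ‖T k u - u‖ ≤ ∑ i ∈ t, c i * ‖T k (w i) - w i‖ + d * min 1 ‖k‖) :
    FB s (∑ i ∈ t, c i * B i + d * cs s) u := by
  unfold FB
  refine (FN_mono (fun _ => norm_nonneg _) h).trans ?_
  refine (FN_add_le (continuous_finsetSum _ fun i _ =>
    continuous_const.mul (continuous_norm_T_sub _)) (by fun_prop)).trans ?_
  rw [ENNReal.ofReal_add (Finset.sum_nonneg fun i hi => mul_nonneg (hc i hi) (hB i hi))
    (mul_nonneg hd (cs_nonneg s)), FN_const_mul hd, ENNReal.ofReal_mul hd, cs,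
    ENNReal.ofReal_toReal (FN_min_lt_top hs).ne]
  gcongr
  refine (FN_sum_le t (fun i k => c i * ‖T k (w i) - w i‖)
    fun i => continuous_const.mul (continuous_norm_T_sub _)).trans ?_
  rw [ENNReal.ofReal_sum_of_nonneg fun i hi => mul_nonneg (hc i hi) (hB i hi)]
  refine Finset.sum_le_sum fun i hi => ?_
  rw [FN_const_mul (hc i hi), ENNReal.ofReal_mul (hc i hi)]
  gcongr
  exact hw i hi

theorem FB.mono {s M N : ℝ} {u : L2} (h : FB s M u) (hMN : M ≤ N) : FB s N u :=
  h.trans (ENNReal.ofReal_le_ofReal hMN)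

/-! ### Scales of Sobolev classes with constants -/

/-- `u` and its weak derivatives up to order `k` have `L²` norm at most `M`, and those of order `k`
satisfy the additional condition `B M`. -/
def HG (B : ℝ → L2 → Prop) : ℕ → ℝ → L2 → Prop
  | 0, M, u => ‖u‖ ≤ M ∧ B M u
  | k + 1, M, u => ‖u‖ ≤ M ∧ ∀ a, WD a u (D a u) ∧ HG B k M (D a u)

/-- As `HG`, with bounds in `L²` and in `L^∞`. -/
def WG (B : ℝ → L2 → Prop) : ℕ → ℝ → L2 → Prop
  | 0, A, q => CB A q ∧ ‖q‖ ≤ A ∧ B A q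
  | k + 1, A, q => CB A q ∧ ‖q‖ ≤ A ∧ ∀ a, WD a q (D a q) ∧ WG B k A (D a q)

/-- The class `H^k`. -/
abbrev H : ℕ → ℝ → L2 → Prop := HG fun _ _ => True
/-- The class `H^{k+s}`. -/
abbrev HS (s : ℝ) : ℕ → ℝ → L2 → Prop := HG (FB s)

/-- Conditions on `B` under which the classes `HG B k` behave like normed spaces. -/
structure IsBase (B : ℝ → L2 → Prop) : Prop where
  mono : ∀ {M N u}, B M u → M ≤ N → B N u
  add : ∀ {M N u v}, 0 ≤ M → 0 ≤ N → B M u → B N v → B (M + N) (u + v)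
  smul : ∀ {M u} (c : ℝ), 0 ≤ M → B M u → B (|c| * M) (c • u)

theorem isBase_true : IsBase fun _ _ => True := ⟨fun _ _ => trivial, fun _ _ _ _ => trivial,
  fun _ _ _ => trivial⟩

theorem isBase_FB {s : ℝ} (hs : s ∈ Set.Ioo (0 : ℝ) 1) : IsBase (FB s) where
  mono h h' := h.mono h'
  add {M N u v} hM hN hu hv := by
    have := FB.of_le hs (u := u + v) (t := (Finset.univ : Finset (Fin 2))) (w := ![u, v])
      (B := ![M, N]) (c := fun _ => 1) le_rfl (by simp) (by simp [Fin.forall_fin_two, hM, hN])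
      (by simp [Fin.forall_fin_two, hu, hv]) (fun k => by
        simp only [Fin.sum_univ_two, Matrix.cons_val_zero, Matrix.cons_val_one, one_mul,
          zero_mul, add_zero]
        rw [map_add, add_sub_add_comm]
        exact norm_add_le _ _)
    simpa [Fin.sum_univ_two] using this
  smul {M u} c hM hu := by
    have := FB.of_le hs (u := c • u) (t := (Finset.univ : Finset (Fin 1))) (w := ![u])
      (B := ![M]) (c := fun _ => |c|) le_rfl (by simp) (by simp [hM])
      (by simp [hu]) (fun k => by
        simp only [Fin.sum_univ_one, Matrix.cons_val_zero, zero_mul, add_zero]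
        rw [map_smul, ← smul_sub, norm_smul, Real.norm_eq_abs])
    simpa using this

section HG
variable {B : ℝ → L2 → Prop}

theorem HG.norm_le : ∀ {k : ℕ} {M : ℝ} {u : L2}, HG B k M u → ‖u‖ ≤ M
  | 0, _, _, h => h.1
  | _ + 1, _, _, h => h.1

theorem HG.nonneg {k : ℕ} {M : ℝ} {u : L2} (h : HG B k M u) : 0 ≤ M :=
  (norm_nonneg _).trans h.norm_le

theorem HG.wd {k : ℕ} {M : ℝ} {u : L2} (h : HG B (k + 1) M u) (a : Fin 2) : WD a u (D a u) :=
  (h.2 a).1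

theorem HG.D {k : ℕ} {M : ℝ} {u : L2} (h : HG B (k + 1) M u) (a : Fin 2) :
    HG B k M (KirchhoffPlate.D a u) := (h.2 a).2

/-- By uniqueness any weak derivatives `v a` may stand in for the chosen ones `D a u`. -/
theorem HG.succ {k : ℕ} {M : ℝ} {u : L2} {v : Fin 2 → L2} (h0 : ‖u‖ ≤ M)
    (h1 : ∀ a, WD a u (v a)) (h2 : ∀ a, HG B k M (v a)) : HG B (k + 1) M u :=
  ⟨h0, fun a => ⟨(h1 a).wd, by rw [(h1 a).D_eq]; exact h2 a⟩⟩

theorem HG.mono (hB : IsBase B) : ∀ {k : ℕ} {M N : ℝ} {u : L2}, HG B k M u → M ≤ N → HG B k N u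
  | 0, _, _, _, h, h' => ⟨h.1.trans h', hB.mono h.2 h'⟩
  | _ + 1, _, _, _, h, h' => ⟨h.1.trans h', fun a => ⟨h.wd a, (h.D a).mono hB h'⟩⟩

theorem HG.add (hB : IsBase B) : ∀ {k : ℕ} {M N : ℝ} {u v : L2}, HG B k M u → HG B k N v →
    HG B k (M + N) (u + v)
  | 0, _, _, _, _, h, h' => ⟨(norm_add_le _ _).trans (add_le_add h.1 h'.1),
      hB.add h.nonneg h'.nonneg h.2 h'.2⟩
  | _ + 1, _, _, _, _, h, h' => HG.succ ((norm_add_le _ _).trans (add_le_add h.1 h'.1))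
      (fun a => (h.wd a).add (h'.wd a)) fun a => (h.D a).add hB (h'.D a)

theorem HG.smul (hB : IsBase B) (c : ℝ) : ∀ {k : ℕ} {M : ℝ} {u : L2}, HG B k M u →
    HG B k (|c| * M) (c • u)
  | 0, _, _, h => ⟨(norm_smul_le _ _).trans (mul_le_mul_of_nonneg_left h.1 (abs_nonneg c)),
      hB.smul c h.nonneg h.2⟩
  | _ + 1, _, _, h => HG.succ
      ((norm_smul_le _ _).trans (mul_le_mul_of_nonneg_left h.1 (abs_nonneg c)))
      (fun a => (h.wd a).smul c) fun a => (h.D a).smul hB c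

theorem HG.sum (hB : IsBase B) {k : ℕ} {ι : Type*} {t : Finset ι} (ht : t.Nonempty) {M : ι → ℝ}
    {u : ι → L2} (h : ∀ i ∈ t, HG B k (M i) (u i)) : HG B k (∑ i ∈ t, M i) (∑ i ∈ t, u i) := by
  classical
  induction ht using Finset.Nonempty.cons_induction with
  | singleton a => simpa using h
  | cons a t ha _ ih =>
    rw [Finset.sum_cons, Finset.sum_cons]
    exact (h a (Finset.mem_cons_self _ _)).add hB (ih fun i hi => h i (Finset.mem_cons_of_mem hi))

theorem HG.weaken : ∀ {k : ℕ} {M : ℝ} {u : L2}, HG B k M u → H k M u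
  | 0, _, _, h => ⟨h.1, trivial⟩
  | _ + 1, _, _, h => ⟨h.1, fun a => ⟨h.wd a, (h.D a).weaken⟩⟩

theorem HG.pred : ∀ {k : ℕ} {M : ℝ} {u : L2}, HG B (k + 1) M u → H k M u
  | 0, _, _, h => ⟨h.1, trivial⟩
  | _ + 1, _, _, h => ⟨h.1, fun a => ⟨h.wd a, (h.D a).pred⟩⟩

theorem WG.hg : ∀ {k : ℕ} {A : ℝ} {q : L2}, WG B k A q → HG B k A q
  | 0, _, _, h => h.2
  | _ + 1, _, _, h => ⟨h.2.1, fun a => ⟨(h.2.2 a).1, (h.2.2 a).2.hg⟩⟩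

theorem WG.cb : ∀ {k : ℕ} {A : ℝ} {q : L2}, WG B k A q → CB A q
  | 0, _, _, h => h.1
  | _ + 1, _, _, h => h.1

theorem WG.nonneg {k : ℕ} {A : ℝ} {q : L2} (h : WG B k A q) : 0 ≤ A := h.cb.nonneg

theorem WG.wd {k : ℕ} {A : ℝ} {q : L2} (h : WG B (k + 1) A q) (a : Fin 2) : WD a q (D a q) :=
  (h.2.2 a).1

theorem WG.D {k : ℕ} {A : ℝ} {q : L2} (h : WG B (k + 1) A q) (a : Fin 2) :
    WG B k A (KirchhoffPlate.D a q) := (h.2.2 a).2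

theorem WG.succ {k : ℕ} {M : ℝ} {u : L2} {v : Fin 2 → L2} (h0 : CB M u) (h0' : ‖u‖ ≤ M)
    (h1 : ∀ a, WD a u (v a)) (h2 : ∀ a, WG B k M (v a)) : WG B (k + 1) M u :=
  ⟨h0, h0', fun a => ⟨(h1 a).wd, by rw [(h1 a).D_eq]; exact h2 a⟩⟩

theorem WG.weaken : ∀ {k : ℕ} {A : ℝ} {q : L2}, WG B k A q → WG (fun _ _ => True) k A q
  | 0, _, _, h => ⟨h.1, h.2.1, trivial⟩
  | _ + 1, _, _, h => ⟨h.1, h.2.1, fun a => ⟨h.wd a, (h.D a).weaken⟩⟩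

theorem WG.pred : ∀ {k : ℕ} {A : ℝ} {q : L2}, WG B (k + 1) A q → WG (fun _ _ => True) k A q
  | 0, _, _, h => ⟨h.1, h.2.1, trivial⟩
  | _ + 1, _, _, h => ⟨h.1, h.2.1, fun a => ⟨h.wd a, (h.D a).pred⟩⟩

end HG

/-! ### Products and embeddings -/

/-- Products in `H^k`. -/
theorem HG.mulL : ∀ {k : ℕ} {A M : ℝ} {q u : L2}, WG (fun _ _ => True) k A q → H k M u →
    H k (2 ^ k * A * M) (mul q u)
  | 0, A, M, q, u, hq, hu => ⟨by
      rw [pow_zero, one_mul]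
      exact (norm_mul_le hq.cb u).trans (mul_le_mul_of_nonneg_left hu.1 hq.nonneg), trivial⟩
  | k + 1, A, M, q, u, hq, hu => by
      have A0 := hq.nonneg
      have M0 := hu.nonneg
      refine HG.succ ?_ (fun a => (hq.wd a).mulL (hu.wd a) hq.cb (hq.D a).cb) fun a => ?_
      · refine (norm_mul_le hq.cb u).trans ((mul_le_mul_of_nonneg_left hu.1 A0).trans ?_)
        rw [mul_assoc]
        exact le_mul_of_one_le_left (by positivity) (one_le_pow₀ one_le_two)
      -- The Leibniz rule gives two terms for every derivative, whence the factor `2 ^ k`.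
      · have h1 := HG.mulL hq.pred (hu.D a)
        have h2 := HG.mulL (hq.D a) hu.pred
        refine (h1.add isBase_true h2).mono isBase_true (le_of_eq ?_)
        ring

theorem HG.cb {B : ℝ → L2 → Prop} {M : ℝ} {u : L2} (hu : HG B 2 M u) : CB (2 * M) u :=
  CB.of_norm_le hu.wd (fun a b => (hu.D a).wd b) hu.norm_le (fun a => (hu.D a).norm_le)
    fun a b => ((hu.D a).D b).norm_le

theorem H.norm_T_sub_le {M : ℝ} {u : L2} (hu : H 1 M u) (h : Plane) :
    ‖T h u - u‖ ≤ 2 * M * min 1 ‖h‖ := by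
  have M0 := hu.nonneg
  rw [mul_min_of_nonneg _ _ (by positivity)]
  refine le_min ?_ (KirchhoffPlate.norm_T_sub_le hu.wd (fun a => (hu.D a).norm_le) h)
  refine (norm_sub_le _ _).trans ?_
  rw [norm_T]
  linarith [hu.norm_le]

/-- A constant depending only on `s`. -/
noncomputable def ks (s : ℝ) : ℝ := 2 * (1 + cs s)

theorem one_le_ks (s : ℝ) : 1 ≤ ks s := by
  have := cs_nonneg s
  unfold ks; linarith

theorem H.fb {s : ℝ} (hs : s ∈ Set.Ioo (0 : ℝ) 1) {M : ℝ} {u : L2} (hu : H 1 M u) :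
    FB s (ks s * M) u := by
  have M0 := hu.nonneg
  have := FB.of_le hs (u := u) (∅ : Finset Unit) (w := fun _ => 0) (B := 0) (c := 0)
    (d := 2 * M) (by positivity) (by simp) (by simp) (by simp) (fun k => by
      simpa using H.norm_T_sub_le hu k)
  refine this.mono ?_
  simp only [Finset.sum_empty, zero_add]
  unfold ks; nlinarith

theorem H.hs {s : ℝ} (hs : s ∈ Set.Ioo (0 : ℝ) 1) : ∀ {k : ℕ} {M : ℝ} {u : L2}, H (k + 1) M u →
    HS s k (ks s * M) u
  | 0, _, _, h => ⟨h.norm_le.trans (le_mul_of_one_le_left h.nonneg (one_le_ks s)), H.fb hs h⟩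
  | _ + 1, _, _, h => ⟨h.norm_le.trans (le_mul_of_one_le_left h.nonneg (one_le_ks s)),
      fun a => ⟨h.wd a, H.hs hs (h.D a)⟩⟩

/-- In this form each difference is multiplied by a bounded factor, so that `norm_mul_le` applies to
both terms. -/
theorem T_mul_sub {A B : ℝ} {q u : L2} (hq : CB A q) (hu : CB B u) (h : Plane) :
    T h (mul q u) - mul q u = mul (T h u) (T h q - q) + mul q (T h u - u) := by
  rw [T_mul hq, map_sub, map_sub, mul_comm' (hq.translate h) (hu.translate h),
    mul_comm' (hu.translate h) hq]
  abel

/-- Products in `H^{k+s}`. -/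
theorem HS.mulL {s : ℝ} (hs : s ∈ Set.Ioo (0 : ℝ) 1) : ∀ {k : ℕ} {A M : ℝ} {q u : L2},
    WG (FB s) k A q → H (k + 1) M u → H 2 M u → HS s k (ks s * 2 ^ (k + 1) * A * M) (mul q u)
  | 0, A, M, q, u, hq, hu, hu2 => by
      have A0 := hq.nonneg
      have M0 := hu.nonneg
      have k1 := one_le_ks s
      have c0 := cs_nonneg s
      refine ⟨?_, ?_⟩
      · refine (norm_mul_le hq.cb u).trans ((mul_le_mul_of_nonneg_left hu.norm_le A0).trans ?_)
        have : 0 ≤ A * M := by positivity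
        rw [mul_assoc]
        refine le_mul_of_one_le_left this ?_
        norm_num; linarith
      -- The `H^s` seminorm of `q` is multiplied by the supremum of `u`, at most `2 * M` because `u`
      -- is in `H²`; the difference of `u` is of Lipschitz type because `u` is in `H¹`.
      · have := FB.of_le hs (u := mul q u) (Finset.univ : Finset Unit) (w := fun _ => q)
          (B := fun _ => A) (c := fun _ => 2 * M) (d := A * (2 * M)) (by positivity)
          (fun _ _ => by positivity) (fun _ _ => A0) (fun _ _ => hq.2.2) (fun k => by
            rw [T_mul_sub hq.cb hu2.cb]
            refine (norm_add_le _ _).trans ?_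
            simp only [Finset.univ_unique, Finset.sum_singleton]
            refine add_le_add (norm_mul_le (hu2.cb.translate k) _) ?_
            refine (norm_mul_le hq.cb _).trans ?_
            rw [mul_assoc]
            exact mul_le_mul_of_nonneg_left (H.norm_T_sub_le hu k) A0)
        refine this.mono ?_
        simp only [Finset.univ_unique, Finset.sum_singleton]
        have : 0 ≤ A * M := by positivity
        have : 0 ≤ A * M * cs s := by positivity
        unfold ks; norm_num; nlinarith
  | k + 1, A, M, q, u, hq, hu, hu2 => by
      have A0 := hq.nonneg
      have M0 := hu.nonneg
      have k1 := one_le_ks s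
      refine HG.succ ?_ (fun a => (hq.wd a).mulL (hu.wd a) hq.cb (hq.D a).cb) fun a => ?_
      · refine (norm_mul_le hq.cb u).trans ((mul_le_mul_of_nonneg_left hu.norm_le A0).trans ?_)
        rw [mul_assoc]
        refine le_mul_of_one_le_left (by positivity) (one_le_mul_of_one_le_of_one_le k1
          (one_le_pow₀ one_le_two))
      -- The term `q ∂u` is in `H^{k+1}` and is covered by the embedding. Only `∂q u` needs the
      -- induction, and there `u` itself remains, so its `H²` bound is kept.
      · have h1 := H.hs hs (HG.mulL hq.weaken (hu.D a))
        have h2 := HS.mulL hs (hq.D a) hu.pred hu2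
        refine (h1.add (isBase_FB hs) h2).mono (isBase_FB hs) (le_of_eq ?_)
        ring


/-! ### The energy estimate for differences -/

/-- Pairs of coordinate directions. -/
abbrev Pair : Type := Fin 2 × Fin 2

/-- Second partial derivatives of a test function. -/
noncomputable def TF.dd (p : Pair) (f : TF) : TF := (f.d p.1).d p.2

/-- Second weak derivatives. -/
noncomputable def DD (p : Pair) (u : L2) : L2 := D p.2 (D p.1 u)

theorem HG.DD {B : ℝ → L2 → Prop} {k : ℕ} {M : ℝ} {u : L2} (h : HG B (k + 2) M u) (p : Pair) :
    HG B k M (DD p u) := (h.D p.1).D p.2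

theorem HG.D_comm {B : ℝ → L2 → Prop} {k : ℕ} {M : ℝ} {u : L2} (h : HG B (k + 2) M u)
    (a b : Fin 2) : KirchhoffPlate.D a (KirchhoffPlate.D b u) = KirchhoffPlate.D b (KirchhoffPlate.D a u) :=
  ((h.wd a).comm ((h.D a).wd b) (h.wd b)).D_eq

theorem HG.DD_D {B : ℝ → L2 → Prop} {k : ℕ} {M : ℝ} {u : L2} (h : HG B (k + 3) M u)
    (a : Fin 2) (p : Pair) : KirchhoffPlate.DD p (KirchhoffPlate.D a u) =
      KirchhoffPlate.D a (KirchhoffPlate.DD p u) := by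
  unfold KirchhoffPlate.DD
  rw [(h.D p.1).D_comm a p.2, h.D_comm a p.1]

theorem TF.toL2_dd_shift (h : Plane) (p : Pair) (f : TF) :
    ((f.shift h).dd p).toL2 = T h (f.dd p).toL2 := by
  rw [TF.dd, TF.dd, TF.d, TF.d, TF.D_shift, TF.D_shift, T_toL2]

/-- The weak form of `div div (P ∇²v) = div div F - div b + c`. -/
def Sys (P : Pair → Pair → L2 →L[ℝ] L2) (v : L2) (F : Pair → L2) (b : Fin 2 → L2) (c : L2) : Prop :=
  ∀ f : TF, ∑ p, inner ℝ (∑ q, P p q (DD q v)) (f.dd p).toL2 =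
    ∑ p, inner ℝ (F p) (f.dd p).toL2 + ∑ i, inner ℝ (b i) (f.d i).toL2 + inner ℝ c f.toL2

/-- Bounded, Lipschitz and coercive coefficients. -/
structure IsCoef (A ξ : ℝ) (P : Pair → Pair → L2 →L[ℝ] L2) : Prop where
  norm_le : ∀ p q u, ‖P p q u‖ ≤ A * ‖u‖
  comm_le : ∀ p q h u, ‖T h (P p q u) - P p q (T h u)‖ ≤ A * ‖h‖ * ‖u‖
  coercive : ∀ f : TF, ξ * ∑ p, ‖(f.dd p).toL2‖ ^ 2 ≤
    ∑ p, inner ℝ (∑ q, P p q (f.dd q).toL2) (f.dd p).toL2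

theorem norm_dd_le_sum (f : TF) (p : Pair) : ‖(f.dd p).toL2‖ ≤ ∑ p, ‖(f.dd p).toL2‖ :=
  Finset.single_le_sum (f := fun p => ‖(f.dd p).toL2‖) (fun _ _ => norm_nonneg _)
    (Finset.mem_univ p)

/-- The equation is tested with `f` and with its shift by `-h`, and the two are subtracted. `F`
keeps the difference. For `b` and `c`, which are merely in `L²`, the difference goes to the test
function and costs one derivative of it times `‖h‖`. The commutator of translation and coefficients
costs `A ‖h‖`. -/
theorem step_test {A ξ M : ℝ} {P : Pair → Pair → L2 →L[ℝ] L2} (hP : IsCoef A ξ P) {v : L2}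
    {F : Pair → L2} {b : Fin 2 → L2} {c : L2} (hA : 0 ≤ A) (hv : H 2 M v) (hb : ∀ i, ‖b i‖ ≤ M)
    (hc : ‖c‖ ≤ M) (hs : Sys P v F b c) (h : Plane) (f : TF) :
    ∑ p, inner ℝ (∑ q, P p q (T h (DD q v) - DD q v)) (f.dd p).toL2 ≤
      (∑ p, ‖T h (F p) - F p‖ + (4 + 16 * A) * (M * ‖h‖)) * ∑ p, ‖(f.dd p).toL2‖ +
      2 * (M * ‖h‖) * ∑ i, ‖(f.d i).toL2‖ := by
  have M0 := hv.nonneg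
  set S := ∑ p, ‖(f.dd p).toL2‖ with hS
  set S1 := ∑ i, ‖(f.d i).toL2‖ with hS1
  have S0 : 0 ≤ S := Finset.sum_nonneg fun _ _ => norm_nonneg _
  have hfS := norm_dd_le_sum f
  set f' := f.shift (-h) with hf'
  have e1 := hs f'
  have e0 := hs f
  have hd : ∀ i, (f'.d i).toL2 = T (-h) (f.d i).toL2 := fun i => by
    rw [hf', TF.d, TF.D_shift, T_toL2]
  have split : ∑ p, inner ℝ (∑ q, P p q (T h (DD q v) - DD q v)) (f.dd p).toL2 =
      ∑ p, inner ℝ (T h (F p) - F p) (f.dd p).toL2 +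
      ∑ i, inner ℝ (b i) (T (-h) (f.d i).toL2 - (f.d i).toL2) +
      inner ℝ c (T (-h) f.toL2 - f.toL2) -
      ∑ p, ∑ q, inner ℝ (T h (P p q (DD q v)) - P p q (T h (DD q v))) (f.dd p).toL2 := by
    have k1 : ∀ p, inner ℝ (∑ q, P p q (DD q v)) (f'.dd p).toL2 =
        ∑ q, inner ℝ (T h (P p q (DD q v))) (f.dd p).toL2 := by
      intro p
      rw [TF.toL2_dd_shift, sum_inner]
      exact Finset.sum_congr rfl fun q _ => (inner_T_left _ _ _).symm
    have k2 : ∀ p, inner ℝ (F p) (f'.dd p).toL2 = inner ℝ (T h (F p)) (f.dd p).toL2 := by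
      intro p
      rw [TF.toL2_dd_shift, inner_T_left]
    simp only [k1, k2, hd] at e1
    rw [← T_toL2] at e1
    simp only [sum_inner] at e0
    simp only [map_sub, inner_sub_left, inner_sub_right, Finset.sum_sub_distrib, sum_inner]
    linarith
  rw [split]
  have b1 : ∑ p, inner ℝ (T h (F p) - F p) (f.dd p).toL2 ≤ (∑ p, ‖T h (F p) - F p‖) * S := by
    rw [Finset.sum_mul]
    refine Finset.sum_le_sum fun p _ => (real_inner_le_norm _ _).trans ?_
    exact mul_le_mul_of_nonneg_left (hfS p) (norm_nonneg _)
  have b2 : ∑ i, inner ℝ (b i) (T (-h) (f.d i).toL2 - (f.d i).toL2) ≤ 4 * (M * ‖h‖) * S := by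
    have : ∀ i, inner ℝ (b i) (T (-h) (f.d i).toL2 - (f.d i).toL2) ≤ 2 * (M * ‖h‖) * S := by
      intro i
      refine (real_inner_le_norm _ _).trans ?_
      have := norm_T_sub_le (fun a => WD.toL2 a (f.d i)) (fun a => hfS (i, a)) (-h)
      rw [norm_neg] at this
      refine (mul_le_mul (hb i) this (norm_nonneg _) M0).trans_eq (by ring)
    rw [Fin.sum_univ_two]
    linarith [this 0, this 1]
  have b3 : inner ℝ c (T (-h) f.toL2 - f.toL2) ≤ 2 * (M * ‖h‖) * S1 := by
    refine (real_inner_le_norm _ _).trans ?_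
    have := norm_T_sub_le (fun a => WD.toL2 a f) (M := S1) (fun a =>
      Finset.single_le_sum (f := fun i => ‖(f.d i).toL2‖) (fun _ _ => norm_nonneg _)
        (Finset.mem_univ a)) (-h)
    rw [norm_neg] at this
    exact (mul_le_mul hc this (norm_nonneg _) M0).trans_eq (by ring)
  have b4 : - ∑ p, ∑ q, inner ℝ (T h (P p q (DD q v)) - P p q (T h (DD q v))) (f.dd p).toL2 ≤
      16 * A * (M * ‖h‖) * S := by
    have : ∀ p q, -(inner ℝ (T h (P p q (DD q v)) - P p q (T h (DD q v))) (f.dd p).toL2) ≤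
        A * (M * ‖h‖) * S := by
      intro p q
      refine (neg_le_abs _).trans ((abs_real_inner_le_norm _ _).trans ?_)
      refine mul_le_mul ((hP.comm_le p q h _).trans ?_) (hfS p) (norm_nonneg _) (by positivity)
      have := mul_le_mul_of_nonneg_left (hv.DD q).norm_le (show 0 ≤ A * ‖h‖ by positivity)
      linarith
    simp only [← Finset.sum_neg_distrib]
    refine (Finset.sum_le_sum fun p _ => Finset.sum_le_sum fun q _ => this p q).trans_eq ?_
    simp; ring
  linarith

theorem exists_seq_TF {z : L2} {z1 : Fin 2 → L2} {z2 : Fin 2 → Fin 2 → L2}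
    (h1 : ∀ a, WD a z (z1 a)) (h2 : ∀ a b, WD b (z1 a) (z2 a b)) :
    ∃ f : ℕ → TF, (∀ a, Tendsto (fun n => ((f n).d a).toL2) atTop (𝓝 (z1 a))) ∧
      ∀ p : Pair, Tendsto (fun n => ((f n).dd p).toL2) atTop (𝓝 (z2 p.1 p.2)) := by
  choose f _ f1 f2 using fun n : ℕ =>
    exists_TF_near_two h1 h2 (show (0 : ℝ) < 1 / (n + 1) by positivity)
  have lim := tendsto_one_div_add_atTop_nhds_zero_nat (𝕜 := ℝ)
  exact ⟨f, fun a => tendsto_iff_norm_sub_tendsto_zero.2 (squeeze_zero (fun n => norm_nonneg _)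
    (fun n => (f1 n a).le) lim), fun p => tendsto_iff_norm_sub_tendsto_zero.2
    (squeeze_zero (fun n => norm_nonneg _) (fun n => (f2 n p.1 p.2).le) lim)⟩

/-- The constant in the energy estimate. -/
noncomputable def stepConst (A ξ : ℝ) : ℝ := 4 / ξ * (4 + 16 * A) + 1 + 32 / ξ

theorem one_le_stepConst {A ξ : ℝ} (hA : 0 ≤ A) (hξ : 0 < ξ) : 1 ≤ stepConst A ξ := by
  have h1 : 0 ≤ 4 / ξ * (4 + 16 * A) := by positivity
  have h2 : 0 ≤ 32 / ξ := by positivity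
  unfold stepConst; linarith

/-- The energy estimate for the differences of the second derivatives. -/
theorem norm_T_DD_sub_le {A ξ M : ℝ} {P : Pair → Pair → L2 →L[ℝ] L2} (hP : IsCoef A ξ P)
    (hA : 0 ≤ A) (hξ : 0 < ξ) {v : L2} {F : Pair → L2} {b : Fin 2 → L2} {c : L2} (hv : H 2 M v)
    (hb : ∀ i, ‖b i‖ ≤ M) (hc : ‖c‖ ≤ M) (hs : Sys P v F b c) (h : Plane) (p : Pair) :
    ‖T h (DD p v) - DD p v‖ ≤ stepConst A ξ * (∑ p, ‖T h (F p) - F p‖ + M * ‖h‖) := by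
  have M0 := hv.nonneg
  -- The natural test function is `T h v - v` itself, reached as a limit of smooth ones together
  -- with its first and second derivatives.
  obtain ⟨f, f1, f2⟩ := exists_seq_TF (z := T h v - v) (z1 := fun a => T h (D a v) - D a v)
    (z2 := fun a b => T h (D b (D a v)) - D b (D a v))
    (fun a => ((hv.wd a).translate h).sub (hv.wd a))
    (fun a b => (((hv.D a).wd b).translate h).sub ((hv.D a).wd b))
  replace f2 : ∀ p : Pair, Tendsto (fun n => ((f n).dd p).toL2) atTop
    (𝓝 (T h (DD p v) - DD p v)) := f2
  set z : Pair → L2 := fun p => T h (DD p v) - DD p v with hz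
  have coer : ξ * ∑ p, ‖z p‖ ^ 2 ≤ ∑ p, inner ℝ (∑ q, P p q (z q)) (z p) := by
    refine le_of_tendsto_of_tendsto' (b := atTop) (f := fun n => ξ * ∑ p, ‖((f n).dd p).toL2‖ ^ 2)
      (g := fun n => ∑ p, inner ℝ (∑ q, P p q ((f n).dd q).toL2) ((f n).dd p).toL2) ?_ ?_
      fun n => hP.coercive (f n)
    · exact (tendsto_finsetSum _ fun p _ => ((f2 p).norm.pow 2)).const_mul ξ
    · refine tendsto_finsetSum _ fun p _ => Tendsto.inner ?_ (f2 p)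
      exact tendsto_finsetSum _ fun q _ => ((P p q).continuous.tendsto _).comp (f2 q)
  have bound : ∑ p, inner ℝ (∑ q, P p q (z q)) (z p) ≤
      (∑ p, ‖T h (F p) - F p‖ + (4 + 16 * A) * (M * ‖h‖)) * ∑ p, ‖z p‖ +
      2 * (M * ‖h‖) * ∑ i, ‖T h (D i v) - D i v‖ := by
    refine le_of_tendsto_of_tendsto' (b := atTop)
      (f := fun n => ∑ p, inner ℝ (∑ q, P p q (z q)) ((f n).dd p).toL2)
      (g := fun n => (∑ p, ‖T h (F p) - F p‖ + (4 + 16 * A) * (M * ‖h‖)) *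
        ∑ p, ‖((f n).dd p).toL2‖ + 2 * (M * ‖h‖) * ∑ i, ‖((f n).d i).toL2‖) ?_ ?_
      fun n => step_test hP hA hv hb hc hs h (f n)
    · exact tendsto_finsetSum _ fun p _ => Tendsto.inner tendsto_const_nhds (f2 p)
    · exact ((tendsto_finsetSum _ fun p _ => (f2 p).norm).const_mul _).add
        ((tendsto_finsetSum _ fun i _ => (f1 i).norm).const_mul _)
  set S := ∑ p, ‖z p‖ with hS
  have S0 : 0 ≤ S := Finset.sum_nonneg fun _ _ => norm_nonneg _
  -- Cauchy–Schwarz over the four index pairs.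
  have hS2 : S ^ 2 ≤ 4 * ∑ p, ‖z p‖ ^ 2 := by
    have := sq_sum_le_card_mul_sum_sq (s := (Finset.univ : Finset Pair)) (f := fun p => ‖z p‖)
    simpa using this
  set Y := M * ‖h‖ with hY
  have Y0 : 0 ≤ Y := by positivity
  set X := ∑ p, ‖T h (F p) - F p‖ with hX
  have X0 : 0 ≤ X := Finset.sum_nonneg fun _ _ => norm_nonneg _
  have hS1 : ∑ i, ‖T h (D i v) - D i v‖ ≤ 4 * Y := by
    have : ∀ i, ‖T h (D i v) - D i v‖ ≤ 2 * M * ‖h‖ := fun i =>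
      norm_T_sub_le (hv.D i).wd (fun a => ((hv.D i).D a).norm_le) h
    rw [Fin.sum_univ_two]
    rw [hY]; linarith [this 0, this 1]
  refine (Finset.single_le_sum (f := fun p => ‖z p‖) (fun _ _ => norm_nonneg _)
    (Finset.mem_univ p)).trans ?_
  change S ≤ _
  have main : ξ * S ^ 2 ≤ 4 * ((X + (4 + 16 * A) * Y) * S + 2 * Y * (4 * Y)) := by
    have h1 : ξ * S ^ 2 ≤ 4 * (ξ * ∑ p, ‖z p‖ ^ 2) := by nlinarith
    have h2 : 2 * Y * ∑ i, ‖T h (D i v) - D i v‖ ≤ 2 * Y * (4 * Y) :=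
      mul_le_mul_of_nonneg_left hS1 (by positivity)
    linarith
  have hK : stepConst A ξ * (X + Y) =
      (4 * (X + (4 + 16 * A) * Y) + 32 * Y) / ξ + Y + (4 * (3 + 16 * A) / ξ + 1 + 32 / ξ) * X := by
    unfold stepConst; field_simp; ring
  rw [hK]
  have hX2 : 0 ≤ (4 * (3 + 16 * A) / ξ + 1 + 32 / ξ) * X := by positivity
  -- If `S ≤ Y` the claim is immediate. Otherwise `Y * Y ≤ Y * S`, and one factor `S` cancels from
  -- the quadratic inequality `main`.
  rcases le_total S Y with hSY | hSY
  · have : 0 ≤ (4 * (X + (4 + 16 * A) * Y) + 32 * Y) / ξ := by positivity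
    linarith
  · have : S ≤ (4 * (X + (4 + 16 * A) * Y) + 32 * Y) / ξ := by
      rw [le_div_iff₀ hξ]
      by_cases hS00 : S = 0
      · rw [hS00, zero_mul]; positivity
      · have Spos : 0 < S := lt_of_le_of_ne S0 (Ne.symm hS00)
        refine le_of_mul_le_mul_right ?_ Spos
        nlinarith [mul_le_mul_of_nonneg_left hSY Y0]
    linarith

/-- With `F` in `H¹` the energy estimate is linear in `‖h‖`, so the difference quotients of `∇²v`
stay bounded. The factor `9` is `4 * 2 + 1`: four components of `F`, each with differences at most
`2 * M * t`, and the term `M * t`. -/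
theorem H_three_of_sys {A ξ M : ℝ} {P : Pair → Pair → L2 →L[ℝ] L2} (hP : IsCoef A ξ P)
    (hA : 0 ≤ A) (hξ : 0 < ξ) {v : L2} {F : Pair → L2} {b : Fin 2 → L2} {c : L2} (hv : H 2 M v)
    (hF : ∀ p, H 1 M (F p)) (hb : ∀ i, ‖b i‖ ≤ M) (hc : ‖c‖ ≤ M) (hs : Sys P v F b c) :
    H 3 (9 * stepConst A ξ * M) v := by
  have M0 := hv.nonneg
  have K1 := one_le_stepConst hA hξ
  have hM : M ≤ 9 * stepConst A ξ * M := le_mul_of_one_le_left M0 (by linarith)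
  have key : ∀ p a, ∃ w, WD a (DD p v) w ∧ ‖w‖ ≤ 9 * stepConst A ξ * M := by
    intro p a
    refine exists_WD_of_norm_sub_le fun t t0 _ => ?_
    refine (norm_T_DD_sub_le hP hA hξ hv hb hc hs _ p).trans ?_
    have nt : ‖t • vec a‖ = t := by rw [norm_smul, Real.norm_of_nonneg t0.le]; simp
    have : ∑ p, ‖T (t • vec a) (F p) - F p‖ ≤ ∑ _p : Pair, 2 * M * t :=
      Finset.sum_le_sum fun p _ => by
        have := norm_T_sub_le (hF p).wd (fun a => ((hF p).D a).norm_le) (t • vec a)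
        rwa [nt] at this
    rw [nt]
    simp only [Finset.sum_const, Finset.card_univ, Fintype.card_prod, Fintype.card_fin,
      nsmul_eq_mul] at this
    norm_num at this
    calc stepConst A ξ * (∑ p, ‖T (t • vec a) (F p) - F p‖ + M * t)
        ≤ stepConst A ξ * (4 * (2 * M * t) + M * t) := by gcongr
      _ = 9 * stepConst A ξ * M * t := by ring
  refine ⟨hv.norm_le.trans hM, fun i => ⟨hv.wd i, (hv.D i).norm_le.trans hM, fun j =>
    ⟨(hv.D i).wd j, ?_⟩⟩⟩
  choose w hw1 hw2 using key (i, j)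
  exact HG.succ ((hv.DD (i, j)).norm_le.trans hM) hw1 fun a => ⟨hw2 a, trivial⟩

/-- The same energy estimate integrated against the fractional weight. Since `M ‖k‖` is not
integrable for large `k`, the trivial bound `2 * M` is used when `‖k‖ ≥ 1`. -/
theorem HS_two_of_sys {s : ℝ} (hs' : s ∈ Set.Ioo (0 : ℝ) 1) {A ξ M : ℝ}
    {P : Pair → Pair → L2 →L[ℝ] L2} (hP : IsCoef A ξ P)
    (hA : 0 ≤ A) (hξ : 0 < ξ) {v : L2} {F : Pair → L2} {b : Fin 2 → L2} {c : L2} (hv : H 2 M v)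
    (hF : ∀ p, HS s 0 M (F p)) (hb : ∀ i, ‖b i‖ ≤ M) (hc : ‖c‖ ≤ M) (hs : Sys P v F b c) :
    HS s 2 (4 * stepConst A ξ * ks s * M) v := by
  have M0 := hv.nonneg
  have K1 := one_le_stepConst hA hξ
  have k1 := one_le_ks s
  have c0 := cs_nonneg s
  have hM : M ≤ 4 * stepConst A ξ * ks s * M := by
    refine le_mul_of_one_le_left M0 ?_
    nlinarith
  refine ⟨hv.norm_le.trans hM, fun i => ⟨hv.wd i, (hv.D i).norm_le.trans hM, fun j =>
    ⟨(hv.D i).wd j, ((hv.D i).D j).norm_le.trans hM, ?_⟩⟩⟩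
  change FB s _ (DD (i, j) v)
  have := FB.of_le hs' (u := DD (i, j) v) (Finset.univ : Finset Pair) (w := F) (B := fun _ => M)
    (c := fun _ => stepConst A ξ) (d := 2 * stepConst A ξ * M) (by positivity)
    (fun _ _ => by positivity) (fun _ _ => M0) (fun p _ => (hF p).2) (fun k => by
      rw [← Finset.mul_sum]
      rcases le_total ‖k‖ 1 with hk | hk
      · rw [min_eq_right hk]
        refine (norm_T_DD_sub_le hP hA hξ hv hb hc hs k (i, j)).trans ?_
        rw [mul_add]
        have : 0 ≤ stepConst A ξ * M * ‖k‖ := by positivity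
        linarith
      · rw [min_eq_left hk]
        have h1 : ‖T k (DD (i, j) v) - DD (i, j) v‖ ≤ 2 * M := by
          refine (norm_sub_le _ _).trans ?_
          rw [norm_T]
          linarith [(hv.DD (i, j)).norm_le]
        have h2 : 0 ≤ stepConst A ξ * ∑ p, ‖T k (F p) - F p‖ :=
          mul_nonneg (by linarith) (Finset.sum_nonneg fun _ _ => norm_nonneg _)
        nlinarith)
  refine this.mono ?_
  simp only [Finset.sum_const, Finset.card_univ, Fintype.card_prod, Fintype.card_fin,
      nsmul_eq_mul]
  push_cast
  have : 0 ≤ stepConst A ξ * M := by positivity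
  have : 0 ≤ stepConst A ξ * M * cs s := by positivity
  unfold ks
  nlinarith

/-! ### Differentiating the equation -/

/-- Test with `∂_a f` and integrate by parts. The data move up one slot: `b` joins `F`, and `c`
takes the place of `b`. After two differentiations `c` therefore enters only through `F`. -/
theorem Sys.deriv {P : Pair → Pair → L2 →L[ℝ] L2} {P' : Fin 2 → Pair → Pair → L2 →L[ℝ] L2}
    {a : Fin 2} (hP : ∀ p q u w, WD a u w → WD a (P p q u) (P p q w + P' a p q u)) {M M' : ℝ}
    {v : L2} {F : Pair → L2} {b : Fin 2 → L2} {c : L2} (hv : H 3 M v) (hF : ∀ p, H 1 M' (F p))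
    (hs : Sys P v F b c) :
    Sys P (D a v) (fun p => D a (F p) - ∑ q, P' a p q (DD q v) - if p.2 = a then b p.1 else 0)
      (fun i => if i = a then -c else 0) 0 := by
  intro f
  have e := hs (f.d a)
  have hdd : ∀ p, (f.d a).dd p = (f.dd p).d a := fun p => by
    rw [TF.dd, TF.dd, TF.d, TF.d, TF.d, TF.D_comm (vec a), TF.D_comm (vec a)]
  have e1 : ∀ p, inner ℝ (∑ q, P p q (DD q v)) ((f.d a).dd p).toL2 =
      -(∑ q, inner ℝ (P p q (DD q (D a v))) (f.dd p).toL2 +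
        ∑ q, inner ℝ (P' a p q (DD q v)) (f.dd p).toL2) := by
    intro p
    rw [hdd, WD.sum Finset.univ (fun q _ => hP p q _ _ ((hv.DD q).wd a)) (f.dd p), sum_inner,
      ← Finset.sum_add_distrib]
    congr 1
    refine Finset.sum_congr rfl fun q _ => ?_
    rw [inner_add_left, hv.DD_D]
  have e2 : ∀ p, inner ℝ (F p) ((f.d a).dd p).toL2 = - inner ℝ (D a (F p)) (f.dd p).toL2 := by
    intro p
    rw [hdd, (hF p).wd a (f.dd p)]
  have e3 : ∑ i, inner ℝ (b i) ((f.d a).d i).toL2 =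
      ∑ p : Pair, inner ℝ (if p.2 = a then b p.1 else 0) (f.dd p).toL2 := by
    rw [Fintype.sum_prod_type]
    refine Finset.sum_congr rfl fun i _ => ?_
    rw [Finset.sum_eq_single a (fun j _ hj => by simp [hj]) (by simp), if_pos rfl, TF.dd, TF.d,
      TF.d, TF.D_comm]
  have e4 : ∑ i, inner ℝ (if i = a then -c else 0) (f.d i).toL2 = - inner ℝ c (f.d a).toL2 := by
    rw [Finset.sum_eq_single a (fun j _ hj => by simp [hj]) (by simp), if_pos rfl, inner_neg_left]
  rw [Finset.sum_congr rfl fun p _ => e1 p, Finset.sum_congr rfl fun p _ => e2 p, e3] at e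
  rw [e4]
  simp only [Finset.sum_neg_distrib, Finset.sum_add_distrib] at e
  simp only [inner_sub_left, sum_inner, Finset.sum_sub_distrib, inner_zero_left]
  linarith

/-! ### Localization of the equation -/

theorem DD_mul_TF {M : ℝ} {u : L2} (hu : H 2 M u) (ζ : TF) (q : Pair) :
    DD q (mul ζ.toL2 u) = mul ζ.toL2 (DD q u) + (mul (ζ.d q.2).toL2 (D q.1 u) +
      mul (ζ.d q.1).toL2 (D q.2 u) + mul (ζ.dd q).toL2 u) := by
  have h1 := (hu.wd q.1).mul_TF ζ
  have h2 := (((hu.D q.1).wd q.2).mul_TF ζ).add ((hu.wd q.2).mul_TF (ζ.d q.1))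
  rw [DD, h1.D_eq, h2.D_eq, DD, TF.dd]
  abel

theorem toL2_dd_mul (ζ f : TF) (p : Pair) : ((ζ.mul f).dd p).toL2 =
    mul ζ.toL2 (f.dd p).toL2 + (mul (ζ.d p.2).toL2 (f.d p.1).toL2 +
      mul (ζ.d p.1).toL2 (f.d p.2).toL2 + mul (ζ.dd p).toL2 f.toL2) := by
  have h1 := (WD.toL2 p.1 f).mul_TF ζ
  rw [mul_toL2] at h1
  have h2 := (WD.toL2 p.1 (ζ.mul f)).unique h1
  have h3 := ((WD.toL2 p.2 (f.d p.1)).mul_TF ζ).add ((WD.toL2 p.2 f).mul_TF (ζ.d p.1))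
  rw [← h2] at h3
  have h4 := (WD.toL2 p.2 ((ζ.mul f).d p.1)).unique h3
  rw [TF.dd, h4]
  simp only [TF.dd]
  abel

/-- The equation for `ζ u`. -/
theorem Sys.localize {P : Pair → Pair → L2 →L[ℝ] L2} {M : ℝ} {u g : L2} (hu : H 2 M u) (ζ : TF)
    (hP : ∀ p q w, P p q (mul ζ.toL2 w) = mul ζ.toL2 (P p q w))
    (h : ∀ f : TF, ∑ p, inner ℝ (∑ q, P p q (DD q u)) ((ζ.mul f).dd p).toL2 =
      inner ℝ g (ζ.mul f).toL2) :
    Sys P (mul ζ.toL2 u)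
      (fun p => ∑ q, P p q (mul (ζ.d q.2).toL2 (D q.1 u) + mul (ζ.d q.1).toL2 (D q.2 u) +
        mul (ζ.dd q).toL2 u))
      (fun i => -∑ j, (mul (ζ.d j).toL2 (∑ q, P (i, j) q (DD q u)) +
        mul (ζ.d j).toL2 (∑ q, P (j, i) q (DD q u))))
      (mul ζ.toL2 g - ∑ p, mul (ζ.dd p).toL2 (∑ q, P p q (DD q u))) := by
  intro f
  have e := h f
  have sym : ∀ (η : TF) (x y : L2), inner ℝ x (mul η.toL2 y) = inner ℝ (mul η.toL2 x) y := by
    intro η x y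
    obtain ⟨A, hA⟩ := exists_CB η
    rw [inner_mul_left hA]
  set X : Pair → L2 := fun p => ∑ q, P p q (DD q u) with hX
  -- Since `P` commutes with `ζ`, the Hessian of `ζ u` splits into `ζ ∇²u` and a commutator, which
  -- becomes `F`. The derivatives of `ζ` coming from the test function `ζ f` give `b` and `c`.
  have e1 : ∀ p, ∑ q, P p q (DD q (mul ζ.toL2 u)) = mul ζ.toL2 (X p) +
      ∑ q, P p q (mul (ζ.d q.2).toL2 (D q.1 u) + mul (ζ.d q.1).toL2 (D q.2 u) +
        mul (ζ.dd q).toL2 u) := by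
    intro p
    rw [hX]
    simp only
    rw [map_sum, ← Finset.sum_add_distrib]
    refine Finset.sum_congr rfl fun q _ => ?_
    rw [DD_mul_TF hu, map_add, hP]
  simp only [toL2_dd_mul, inner_add_right, sym, Finset.sum_add_distrib, ← mul_toL2] at e
  simp only [e1, inner_add_left, Finset.sum_add_distrib, inner_sub_left, inner_neg_left, sum_inner]
  have e2 : ∑ x : Pair, inner ℝ (mul (ζ.d x.2).toL2 (X x)) (f.d x.1).toL2 =
      ∑ i, ∑ j, inner ℝ (mul (ζ.d j).toL2 (X (i, j))) (f.d i).toL2 := Fintype.sum_prod_type _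
  have e3 : ∑ x : Pair, inner ℝ (mul (ζ.d x.1).toL2 (X x)) (f.d x.2).toL2 =
      ∑ i, ∑ j, inner ℝ (mul (ζ.d j).toL2 (X (j, i))) (f.d i).toL2 :=
    Fintype.sum_prod_type_right _
  rw [e2, e3] at e
  simp only [Finset.sum_neg_distrib, Finset.sum_add_distrib]
  simp only [hX] at e ⊢
  linarith


/-! ### Families with uniform bounds -/

section Families

variable {Θ : Type*} {N : Θ → ℝ} {B : ℝ → L2 → Prop} {k : ℕ}

/-- A family bounded in `HG B k` by a constant multiple of `N`. -/
def UH (B : ℝ → L2 → Prop) (N : Θ → ℝ) (k : ℕ) (u : Θ → L2) : Prop :=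
  ∃ K, 0 ≤ K ∧ ∀ θ, HG B k (K * N θ) (u θ)

/-- A family of uniformly bounded coefficients. -/
def UW (B : ℝ → L2 → Prop) (k : ℕ) (q : Θ → L2) : Prop := ∃ A, ∀ θ, WG B k A (q θ)

/-- No additional condition on the derivatives of highest order. -/
abbrev NoCond : ℝ → L2 → Prop := fun _ _ => True

theorem UH.add (hB : IsBase B) {u v : Θ → L2} (hu : UH B N k u) (hv : UH B N k v) :
    UH B N k fun θ => u θ + v θ := by
  obtain ⟨K, K0, hK⟩ := hu
  obtain ⟨L, L0, hL⟩ := hv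
  exact ⟨K + L, by positivity, fun θ => by rw [add_mul]; exact (hK θ).add hB (hL θ)⟩

theorem UH.smul (hB : IsBase B) (c : ℝ) {u : Θ → L2} (hu : UH B N k u) :
    UH B N k fun θ => c • u θ := by
  obtain ⟨K, K0, hK⟩ := hu
  exact ⟨|c| * K, by positivity, fun θ => by rw [mul_assoc]; exact (hK θ).smul hB c⟩

theorem UH.neg (hB : IsBase B) {u : Θ → L2} (hu : UH B N k u) : UH B N k fun θ => -u θ := by
  simpa using hu.smul hB (-1)

theorem UH.sub (hB : IsBase B) {u v : Θ → L2} (hu : UH B N k u) (hv : UH B N k v) :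
    UH B N k fun θ => u θ - v θ := by
  simpa only [sub_eq_add_neg] using hu.add hB (hv.neg hB)

theorem UH.zero (hB : IsBase B) {u : Θ → L2} (hu : UH B N k u) : UH B N k fun _ => 0 := by
  simpa using hu.smul hB 0

theorem UH.ite (hB : IsBase B) {u : Θ → L2} (hu : UH B N k u) (p : Prop) [Decidable p] :
    UH B N k fun θ => if p then u θ else 0 := by
  by_cases h : p
  · simpa [h] using hu
  · simpa [h] using hu.zero hB

theorem UH.sum (hB : IsBase B) {ι : Type*} [Fintype ι] [Nonempty ι] {u : ι → Θ → L2}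
    (hu : ∀ i, UH B N k (u i)) : UH B N k fun θ => ∑ i, u i θ := by
  choose K K0 hK using hu
  refine ⟨∑ i, K i, Finset.sum_nonneg fun i _ => K0 i, fun θ => ?_⟩
  rw [Finset.sum_mul]
  exact HG.sum hB Finset.univ_nonempty fun i _ => hK i θ

theorem UH.weaken {u : Θ → L2} (hu : UH B N k u) : UH NoCond N k u := by
  obtain ⟨K, K0, hK⟩ := hu
  exact ⟨K, K0, fun θ => (hK θ).weaken⟩

theorem UH.pred {u : Θ → L2} (hu : UH B N (k + 1) u) : UH NoCond N k u := by
  obtain ⟨K, K0, hK⟩ := hu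
  exact ⟨K, K0, fun θ => (hK θ).pred⟩

theorem UH.deriv {u : Θ → L2} (hu : UH B N (k + 1) u) (a : Fin 2) : UH B N k fun θ => D a (u θ) := by
  obtain ⟨K, K0, hK⟩ := hu
  exact ⟨K, K0, fun θ => (hK θ).D a⟩

theorem UH.deriv2 {u : Θ → L2} (hu : UH B N (k + 2) u) (p : Pair) : UH B N k fun θ => DD p (u θ) :=
  (hu.deriv p.1).deriv p.2

theorem UH.hs {s : ℝ} (hs : s ∈ Set.Ioo (0 : ℝ) 1) {u : Θ → L2} (hu : UH NoCond N (k + 1) u) :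
    UH (FB s) N k u := by
  obtain ⟨K, K0, hK⟩ := hu
  exact ⟨ks s * K, mul_nonneg (zero_le_one.trans (one_le_ks s)) K0, fun θ => by
    rw [mul_assoc]; exact H.hs hs (hK θ)⟩

/-- The first hypothesis serves only for the norm and for the existence of first derivatives; the
order of regularity comes from `hd`. -/
theorem UH.succ (hB : IsBase B) (hN : ∀ θ, 0 ≤ N θ) {u : Θ → L2} {m : ℕ}
    (hu : UH NoCond N (m + 1) u) (hd : ∀ a, UH B N k fun θ => D a (u θ)) : UH B N (k + 1) u := by
  obtain ⟨K, K0, hK⟩ := hu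
  choose L L0 hL using hd
  have hle : ∀ a, L a ≤ ∑ a, L a := fun a =>
    Finset.single_le_sum (fun a _ => L0 a) (Finset.mem_univ a)
  have hs0 : 0 ≤ ∑ a, L a := Finset.sum_nonneg fun a _ => L0 a
  refine ⟨K + ∑ a, L a, by positivity, fun θ => ?_⟩
  refine ⟨(hK θ).norm_le.trans (mul_le_mul_of_nonneg_right (by linarith) (hN θ)),
    fun a => ⟨(hK θ).wd a, (hL a θ).mono hB (mul_le_mul_of_nonneg_right ?_ (hN θ))⟩⟩
  linarith [hle a]

theorem UW.deriv {q : Θ → L2} (hq : UW B (k + 1) q) (a : Fin 2) : UW B k fun θ => D a (q θ) := by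
  obtain ⟨A, hA⟩ := hq
  exact ⟨A, fun θ => (hA θ).D a⟩

theorem UW.weaken {q : Θ → L2} (hq : UW B k q) : UW NoCond k q := by
  obtain ⟨A, hA⟩ := hq
  exact ⟨A, fun θ => (hA θ).weaken⟩

theorem UW.pred {q : Θ → L2} (hq : UW B (k + 1) q) : UW NoCond k q := by
  obtain ⟨A, hA⟩ := hq
  exact ⟨A, fun θ => (hA θ).pred⟩

theorem UH.mulL {q u : Θ → L2} (hq : UW NoCond k q) (hu : UH NoCond N k u) :
    UH NoCond N k fun θ => mul (q θ) (u θ) := by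
  obtain ⟨A, hA⟩ := hq
  obtain ⟨K, K0, hK⟩ := hu
  refine ⟨2 ^ k * |A| * K, by positivity, fun θ => ?_⟩
  have := HG.mulL (hA θ) (hK θ)
  rw [abs_of_nonneg (hA θ).nonneg]
  rwa [← mul_assoc] at this

theorem UH.mulS {s : ℝ} (hs : s ∈ Set.Ioo (0 : ℝ) 1) (hN : ∀ θ, 0 ≤ N θ) {q u : Θ → L2}
    (hq : UW (FB s) k q) (hu : UH NoCond N (k + 1) u) (hu2 : UH NoCond N 2 u) :
    UH (FB s) N k fun θ => mul (q θ) (u θ) := by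
  obtain ⟨A, hA⟩ := hq
  obtain ⟨K, K0, hK⟩ := hu
  obtain ⟨L, L0, hL⟩ := hu2
  have k0 := zero_le_one.trans (one_le_ks s)
  refine ⟨ks s * 2 ^ (k + 1) * |A| * (K + L), by positivity, fun θ => ?_⟩
  have h1 : H (k + 1) ((K + L) * N θ) (u θ) :=
    (hK θ).mono isBase_true (mul_le_mul_of_nonneg_right (by linarith) (hN θ))
  have h2 : H 2 ((K + L) * N θ) (u θ) :=
    (hL θ).mono isBase_true (mul_le_mul_of_nonneg_right (by linarith) (hN θ))
  have := HS.mulL hs (hA θ) h1 h2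
  rw [abs_of_nonneg (hA θ).nonneg]
  rwa [← mul_assoc] at this

/-! ### Coefficient operators -/

/-- The coefficient operators `κ δ_{pq} + Q_{pq}`. -/
noncomputable def op (κ : ℝ) (Q : Pair → Pair → L2) (p q : Pair) : L2 →L[ℝ] L2 :=
  (if p = q then κ else 0) • ContinuousLinearMap.id ℝ L2 + mul (Q p q)

theorem op_apply (κ : ℝ) (Q : Pair → Pair → L2) (p q : Pair) (u : L2) :
    op κ Q p q u = (if p = q then κ else 0) • u + mul (Q p q) u := rfl

/-- The constant part `κ` commutes with translations, so the commutator only sees the Lipschitz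
differences of `Q`. Keeping `κ` apart lets `Q` lie in `L²` of the plane. -/
theorem isCoef_op {κ A ξ : ℝ} {Q : Pair → Pair → L2} (hκ : 0 ≤ κ)
    (hQ : ∀ p q, WG NoCond 1 A (Q p q))
    (hc : ∀ f : TF, ξ * ∑ p, ‖(f.dd p).toL2‖ ^ 2 ≤
      ∑ p, inner ℝ (∑ q, op κ Q p q (f.dd q).toL2) (f.dd p).toL2) :
    IsCoef (κ + 2 * A) ξ (op κ Q) where
  norm_le p q u := by
    have A0 := (hQ p q).nonneg
    rw [op_apply]
    refine (norm_add_le _ _).trans ?_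
    have h1 : ‖(if p = q then κ else 0) • u‖ ≤ κ * ‖u‖ := by
      rw [norm_smul]
      refine mul_le_mul_of_nonneg_right ?_ (norm_nonneg _)
      split_ifs
      · rw [Real.norm_of_nonneg hκ]
      · simpa using hκ
    have h2 := norm_mul_le (hQ p q).cb u
    have : 0 ≤ A * ‖u‖ := by positivity
    linarith
  comm_le p q h u := by
    have A0 := (hQ p q).nonneg
    have e : T h (op κ Q p q u) - op κ Q p q (T h u) = mul (T h (Q p q) - Q p q) (T h u) := by
      rw [op_apply, op_apply, map_add, map_smul, T_mul (hQ p q).cb,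
        mul_sub_left ((hQ p q).cb.translate h) (hQ p q).cb]
      abel
    rw [e]
    refine (norm_mul_le (CB.translate_sub (hQ p q).wd (fun a => ((hQ p q).D a).cb) h) _).trans ?_
    rw [norm_T]
    have : 0 ≤ κ * ‖h‖ * ‖u‖ := by positivity
    linarith
  coercive := hc

theorem op_deriv {κ A : ℝ} {Q : Pair → Pair → L2} (hQ : ∀ p q, WG NoCond 1 A (Q p q)) {a : Fin 2}
    (p q : Pair) (u w : L2) (h : WD a u w) :
    WD a (op κ Q p q u) (op κ Q p q w + mul (D a (Q p q)) u) := by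
  rw [op_apply, op_apply, add_assoc]
  exact (h.smul _).add (((hQ p q).wd a).mulL h (hQ p q).cb ((hQ p q).D a).cb)

theorem op_mul_comm {κ A : ℝ} {Q : Pair → Pair → L2} (hQ : ∀ p q, CB A (Q p q)) (ζ : TF)
    (p q : Pair) (w : L2) : op κ Q p q (mul ζ.toL2 w) = mul ζ.toL2 (op κ Q p q w) := by
  obtain ⟨Z, hZ⟩ := exists_CB ζ
  rw [op_apply, op_apply, map_add, map_smul, ← mul_mul (hQ p q) hZ, ← mul_mul hZ (hQ p q),
    mul_comm' (hQ p q) hZ]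

theorem UH.opL (κ : ℝ) {Q : Θ → Pair → Pair → L2} {p q : Pair} {u : Θ → L2}
    (hQ : UW NoCond k fun θ => Q θ p q) (hu : UH NoCond N k u) :
    UH NoCond N k fun θ => op κ (Q θ) p q (u θ) := by
  simp only [op_apply]
  exact (hu.smul isBase_true _).add isBase_true (hu.mulL hQ)

theorem UH.opS (κ : ℝ) {s : ℝ} (hs : s ∈ Set.Ioo (0 : ℝ) 1) (hN : ∀ θ, 0 ≤ N θ)
    {Q : Θ → Pair → Pair → L2} {p q : Pair} {u : Θ → L2} (hQ : UW (FB s) k fun θ => Q θ p q)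
    (hu : UH NoCond N (k + 1) u) (hu2 : UH NoCond N 2 u) :
    UH (FB s) N k fun θ => op κ (Q θ) p q (u θ) := by
  simp only [op_apply]
  exact ((hu.hs hs).smul (isBase_FB hs) _).add (isBase_FB hs) (UH.mulS hs hN hQ hu hu2)

end Families

/-! ### The bootstrap from `H²` to `H^{4+s}` -/

/-- A family of coefficients, together with the constants controlling it. -/
structure IsCoefFamily {Θ : Type*} (s κ ξ : ℝ) (Q : Θ → Pair → Pair → L2) : Prop where
  hs : s ∈ Set.Ioo (0 : ℝ) 1
  κ_nonneg : 0 ≤ κ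
  ξ_pos : 0 < ξ
  uw : ∀ p q, UW (FB s) 2 fun θ => Q θ p q
  coercive : ∀ θ (f : TF), ξ * ∑ p, ‖(f.dd p).toL2‖ ^ 2 ≤
    ∑ p, inner ℝ (∑ q, op κ (Q θ) p q (f.dd q).toL2) (f.dd p).toL2

section Global

variable {Θ : Type*} {N : Θ → ℝ} {s κ ξ : ℝ} {Q : Θ → Pair → Pair → L2}

theorem IsCoefFamily.exists_bound (hQ : IsCoefFamily s κ ξ Q) :
    ∃ A, 0 ≤ A ∧ ∀ θ, IsCoef A ξ (op κ (Q θ)) ∧ ∀ p q, WG NoCond 1 A (Q θ p q) := by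
  choose A hA using fun pq : Pair × Pair => (hQ.uw pq.1 pq.2).pred
  have hmono : ∀ {B C : ℝ} {q : L2}, WG NoCond 1 B q → B ≤ C → WG NoCond 1 C q :=
    fun h hBC => ⟨h.cb.mono hBC, h.2.1.trans hBC, fun a => ⟨h.wd a, (h.D a).cb.mono hBC,
      (h.D a).2.1.trans hBC, trivial⟩⟩
  have hle : ∀ pq, A pq ≤ ∑ pq, |A pq| := fun pq => (le_abs_self _).trans
    (Finset.single_le_sum (f := fun pq => |A pq|) (fun _ _ => abs_nonneg _) (Finset.mem_univ pq))
  have hS : 0 ≤ ∑ pq, |A pq| := Finset.sum_nonneg fun _ _ => abs_nonneg _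
  have hκ := hQ.κ_nonneg
  refine ⟨κ + 2 * ∑ pq, |A pq|, by positivity, fun θ => ⟨isCoef_op hκ
    (fun p q => hmono (hA (p, q) θ) (hle _)) (hQ.coercive θ), fun p q =>
    hmono (hA (p, q) θ) ((hle _).trans (by linarith))⟩⟩

/-- `H_three_of_sys` for each member, with the sum of all constants as common bound; only
coefficient bounds uniform over the family enter. -/
theorem UH.gain (hQ : IsCoefFamily s κ ξ Q) (hN : ∀ θ, 0 ≤ N θ) {v : Θ → L2} {F : Pair → Θ → L2}
    {b : Fin 2 → Θ → L2} {c : Θ → L2} (hv : UH NoCond N 2 v) (hF : ∀ p, UH NoCond N 1 (F p))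
    (hb : ∀ i, UH NoCond N 0 (b i)) (hc : UH NoCond N 0 c)
    (hs : ∀ θ, Sys (op κ (Q θ)) (v θ) (fun p => F p θ) (fun i => b i θ) (c θ)) :
    UH NoCond N 3 v := by
  obtain ⟨A, A0, hA⟩ := hQ.exists_bound
  obtain ⟨K, K0, hK⟩ := hv
  choose L L0 hL using hF
  choose I I0 hI using hb
  obtain ⟨J, J0, hJ⟩ := hc
  have L1 : 0 ≤ ∑ p, L p := Finset.sum_nonneg fun p _ => L0 p
  have I1 : 0 ≤ ∑ p, I p := Finset.sum_nonneg fun p _ => I0 p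
  have Lle : ∀ p, L p ≤ ∑ p, L p := fun p => Finset.single_le_sum (fun p _ => L0 p) (Finset.mem_univ p)
  have Ile : ∀ p, I p ≤ ∑ p, I p := fun p => Finset.single_le_sum (fun p _ => I0 p) (Finset.mem_univ p)
  set M := K + ∑ p, L p + ∑ i, I i + J with hM
  have K1 := one_le_stepConst A0 hQ.ξ_pos
  have hle : ∀ {x : ℝ} θ, x ≤ M → x * N θ ≤ M * N θ := fun θ h =>
    mul_le_mul_of_nonneg_right h (hN θ)
  refine ⟨9 * stepConst A ξ * M, by positivity, fun θ => ?_⟩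
  rw [mul_assoc]
  exact H_three_of_sys (hA θ).1 A0 hQ.ξ_pos ((hK θ).mono isBase_true (hle θ (by linarith)))
    (fun p => (hL p θ).mono isBase_true (hle θ (by linarith [Lle p])))
    (fun i => (hI i θ).norm_le.trans (hle θ (by linarith [Ile i])))
    ((hJ θ).norm_le.trans (hle θ (by linarith))) (hs θ)

theorem UH.gainS (hQ : IsCoefFamily s κ ξ Q) (hN : ∀ θ, 0 ≤ N θ) {v : Θ → L2} {F : Pair → Θ → L2}
    {b : Fin 2 → Θ → L2} {c : Θ → L2} (hv : UH NoCond N 2 v) (hF : ∀ p, UH (FB s) N 0 (F p))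
    (hb : ∀ i, UH NoCond N 0 (b i)) (hc : UH NoCond N 0 c)
    (hs : ∀ θ, Sys (op κ (Q θ)) (v θ) (fun p => F p θ) (fun i => b i θ) (c θ)) :
    UH (FB s) N 2 v := by
  obtain ⟨A, A0, hA⟩ := hQ.exists_bound
  obtain ⟨K, K0, hK⟩ := hv
  choose L L0 hL using hF
  choose I I0 hI using hb
  obtain ⟨J, J0, hJ⟩ := hc
  have L1 : 0 ≤ ∑ p, L p := Finset.sum_nonneg fun p _ => L0 p
  have I1 : 0 ≤ ∑ p, I p := Finset.sum_nonneg fun p _ => I0 p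
  have Lle : ∀ p, L p ≤ ∑ p, L p := fun p => Finset.single_le_sum (fun p _ => L0 p) (Finset.mem_univ p)
  have Ile : ∀ p, I p ≤ ∑ p, I p := fun p => Finset.single_le_sum (fun p _ => I0 p) (Finset.mem_univ p)
  set M := K + ∑ p, L p + ∑ i, I i + J with hM
  have K1 := one_le_stepConst A0 hQ.ξ_pos
  have k1 := one_le_ks s
  have hle : ∀ {x : ℝ} θ, x ≤ M → x * N θ ≤ M * N θ := fun θ h =>
    mul_le_mul_of_nonneg_right h (hN θ)
  refine ⟨4 * stepConst A ξ * ks s * M, by positivity, fun θ => ?_⟩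
  rw [mul_assoc]
  exact HS_two_of_sys hQ.hs (hA θ).1 A0 hQ.ξ_pos ((hK θ).mono isBase_true (hle θ (by linarith)))
    (fun p => (hL p θ).mono (isBase_FB hQ.hs) (hle θ (by linarith [Lle p])))
    (fun i => (hI i θ).norm_le.trans (hle θ (by linarith [Ile i])))
    ((hJ θ).norm_le.trans (hle θ (by linarith))) (hs θ)

/-- `u` solves the equation with right hand side `g` against test functions `ζ f`. -/
def LocalEq (κ : ℝ) (Q : Θ → Pair → Pair → L2) (ζ : Θ → TF) (u g : Θ → L2) : Prop :=
  ∀ θ (f : TF), ∑ p, inner ℝ (∑ q, op κ (Q θ) p q (DD q (u θ))) (((ζ θ).mul f).dd p).toL2 =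
    inner ℝ (g θ) ((ζ θ).mul f).toL2

/-- The commutator of the Hessian with multiplication by `ζ`. -/
noncomputable def commR (ζ : Θ → TF) (u : Θ → L2) (q : Pair) (θ : Θ) : L2 :=
  mul ((ζ θ).d q.2).toL2 (D q.1 (u θ)) + mul ((ζ θ).d q.1).toL2 (D q.2 (u θ)) +
    mul ((ζ θ).dd q).toL2 (u θ)

theorem UW.d {k : ℕ} {ζ : Θ → TF} (h : UW NoCond (k + 1) fun θ => (ζ θ).toL2) (a : Fin 2) :
    UW NoCond k fun θ => ((ζ θ).d a).toL2 := by
  simpa only [D_toL2] using h.deriv a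

theorem UW.dd {k : ℕ} {ζ : Θ → TF} (h : UW NoCond (k + 2) fun θ => (ζ θ).toL2) (p : Pair) :
    UW NoCond k fun θ => ((ζ θ).dd p).toL2 := (h.d p.1).d p.2

theorem UH.of_commR {k : ℕ} {ζ : Θ → TF} (h : UW NoCond (k + 2) fun θ => (ζ θ).toL2) {u : Θ → L2}
    (hu : UH NoCond N (k + 1) u) (q : Pair) : UH NoCond N k (commR ζ u q) :=
  (((hu.deriv q.1).mulL (h.d q.2).pred).add isBase_true ((hu.deriv q.2).mulL (h.d q.1).pred)).add
    isBase_true (hu.pred.mulL (h.dd q))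

/-- The lower order terms in the equation for `ζ u`. -/
noncomputable def locF (κ : ℝ) (Q : Θ → Pair → Pair → L2) (ζ : Θ → TF) (u : Θ → L2) (p : Pair)
    (θ : Θ) : L2 := ∑ q, op κ (Q θ) p q (commR ζ u q θ)

/-- The contribution of the first derivatives of `ζ` to the equation for `ζ u`. -/
noncomputable def locB (κ : ℝ) (Q : Θ → Pair → Pair → L2) (ζ : Θ → TF) (u : Θ → L2) (i : Fin 2)
    (θ : Θ) : L2 := -∑ j, (mul ((ζ θ).d j).toL2 (∑ q, op κ (Q θ) (i, j) q (DD q (u θ))) +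
        mul ((ζ θ).d j).toL2 (∑ q, op κ (Q θ) (j, i) q (DD q (u θ))))

/-- The contribution of the right-hand side and the second derivatives of `ζ`. -/
noncomputable def locC (κ : ℝ) (Q : Θ → Pair → Pair → L2) (ζ : Θ → TF) (u g : Θ → L2)
    (θ : Θ) : L2 := mul (ζ θ).toL2 (g θ) -
      ∑ p, mul ((ζ θ).dd p).toL2 (∑ q, op κ (Q θ) p q (DD q (u θ)))

theorem LocalEq.sys (hQ : IsCoefFamily s κ ξ Q) {ζ : Θ → TF} {u g : Θ → L2}
    (hu : UH NoCond N 2 u) (h : LocalEq κ Q ζ u g) (θ : Θ) :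
    Sys (op κ (Q θ)) (mul (ζ θ).toL2 (u θ)) (fun p => locF κ Q ζ u p θ)
      (fun i => locB κ Q ζ u i θ) (locC κ Q ζ u g θ) := by
  obtain ⟨A, A0, hA⟩ := hQ.exists_bound
  obtain ⟨K, K0, hK⟩ := hu
  exact Sys.localize (hK θ) (ζ θ) (op_mul_comm (fun p q => ((hA θ).2 p q).cb) (ζ θ)) (h θ)

theorem UH.sumOp {k : ℕ} {u : Θ → L2} (hQ : ∀ p q, UW NoCond k fun θ => Q θ p q)
    (hu : UH NoCond N (k + 2) u) (p : Pair) :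
    UH NoCond N k fun θ => ∑ q, op κ (Q θ) p q (DD q (u θ)) :=
  UH.sum isBase_true fun q => UH.opL κ (hQ p q) (hu.deriv2 q)

theorem UH.of_locB {k : ℕ} {ζ : Θ → TF} {u : Θ → L2} (hQ : ∀ p q, UW NoCond k fun θ => Q θ p q)
    (hζ : UW NoCond (k + 1) fun θ => (ζ θ).toL2) (hu : UH NoCond N (k + 2) u) (i : Fin 2) :
    UH NoCond N k (locB κ Q ζ u i) :=
  (UH.sum isBase_true fun j => ((UH.sumOp hQ hu (i, j)).mulL (hζ.d j)).add isBase_true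
    ((UH.sumOp hQ hu (j, i)).mulL (hζ.d j))).neg isBase_true

theorem UH.of_locF {k : ℕ} {ζ : Θ → TF} {u : Θ → L2} (hQ : ∀ p q, UW NoCond k fun θ => Q θ p q)
    (hζ : UW NoCond (k + 2) fun θ => (ζ θ).toL2) (hu : UH NoCond N (k + 1) u) (p : Pair) :
    UH NoCond N k (locF κ Q ζ u p) :=
  UH.sum isBase_true fun q => UH.opL κ (hQ p q) (UH.of_commR hζ hu q)

theorem UH.of_locC {ζ : Θ → TF} {u g : Θ → L2} (hQ : ∀ p q, UW NoCond 0 fun θ => Q θ p q)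
    (hζ : UW NoCond 2 fun θ => (ζ θ).toL2) (hu : UH NoCond N 2 u)
    (hg : UH NoCond N 0 fun θ => mul (ζ θ).toL2 (g θ)) : UH NoCond N 0 (locC κ Q ζ u g) :=
  hg.sub isBase_true (UH.sum isBase_true fun p => (UH.sumOp hQ hu p).mulL (hζ.dd p))

/-- From `H²` to `H³`. -/
theorem UH.stage_one (hQ : IsCoefFamily s κ ξ Q) (hN : ∀ θ, 0 ≤ N θ) {ζ : Θ → TF}
    (hζ : UW NoCond 5 fun θ => (ζ θ).toL2) {u g : Θ → L2} (hu : UH NoCond N 2 u)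
    (hg : UH NoCond N 0 fun θ => mul (ζ θ).toL2 (g θ)) (h : LocalEq κ Q ζ u g) :
    UH NoCond N 3 fun θ => mul (ζ θ).toL2 (u θ) := by
  have hQ1 := fun p q => (hQ.uw p q).pred
  have hQ0 := fun p q => (hQ1 p q).pred
  exact UH.gain hQ hN (hu.mulL hζ.pred.pred.pred) (UH.of_locF hQ1 hζ.pred.pred hu)
    (UH.of_locB hQ0 hζ.pred.pred.pred.pred hu) (UH.of_locC hQ0 hζ.pred.pred.pred hu hg) (h.sys hQ hu)

theorem Sys.derivFamily (hQ : IsCoefFamily s κ ξ Q) (a : Fin 2) {v : Θ → L2} {F : Pair → Θ → L2}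
    {b : Fin 2 → Θ → L2} {c : Θ → L2} (hv : UH NoCond N 3 v) (hF : ∀ p, UH NoCond N 1 (F p))
    (hs : ∀ θ, Sys (op κ (Q θ)) (v θ) (fun p => F p θ) (fun i => b i θ) (c θ)) (θ : Θ) :
    Sys (op κ (Q θ)) (D a (v θ))
      (fun p => D a (F p θ) - ∑ q, mul (D a (Q θ p q)) (DD q (v θ)) -
        if p.2 = a then b p.1 θ else 0)
      (fun i => if i = a then -c θ else 0) 0 := by
  obtain ⟨A, A0, hA⟩ := hQ.exists_bound
  obtain ⟨K, K0, hK⟩ := hv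
  choose L L0 hL using hF
  have hle : ∀ p, L p * N θ ≤ ∑ p, |L p * N θ| := fun p => (le_abs_self _).trans
    (Finset.single_le_sum (f := fun p => |L p * N θ|) (fun _ _ => abs_nonneg _) (Finset.mem_univ p))
  have hF' : ∀ p, H 1 (∑ p, |L p * N θ|) (F p θ) := fun p =>
    (hL p θ).mono isBase_true (hle p)
  exact Sys.deriv (P := op κ (Q θ)) (P' := fun a p q => mul (D a (Q θ p q))) (a := a)
    (F := fun p => F p θ) (b := fun i => b i θ) (c := c θ) (v := v θ)
    (fun p q u w => op_deriv (hA θ).2 p q u w) (hK θ) hF' (hs θ)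

/-- The right hand side of the differentiated equation. -/
theorem UH.derivF (hQ : IsCoefFamily s κ ξ Q) (a : Fin 2) {v : Θ → L2} {F : Θ → L2}
    {b : Θ → L2} (hv : UH NoCond N 3 v) (hF : UH NoCond N 2 F) (hb : UH NoCond N 1 b) (p : Pair) :
    UH NoCond N 1 fun θ => D a (F θ) -
      ∑ q, mul (D a (Q θ p q)) (DD q (v θ)) -
      if p.2 = a then b θ else 0 :=
  ((hF.deriv a).sub isBase_true (UH.sum isBase_true fun q => (hv.deriv2 q).mulL
    ((hQ.uw p q).deriv a).weaken)).sub isBase_true (hb.ite isBase_true _)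

/-- From `H³` to `H⁴`. -/
theorem UH.stage_two (hQ : IsCoefFamily s κ ξ Q) (hN : ∀ θ, 0 ≤ N θ) {ζ : Θ → TF}
    (hζ : UW NoCond 5 fun θ => (ζ θ).toL2) {u g : Θ → L2} (hu : UH NoCond N 3 u)
    (hg : UH NoCond N 0 fun θ => mul (ζ θ).toL2 (g θ)) (h : LocalEq κ Q ζ u g) :
    UH NoCond N 4 fun θ => mul (ζ θ).toL2 (u θ) := by
  have hQ2 := fun p q => (hQ.uw p q).weaken
  have hQ1 := fun p q => (hQ.uw p q).pred
  have hQ0 := fun p q => (hQ1 p q).pred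
  have hv : UH NoCond N 3 fun θ => mul (ζ θ).toL2 (u θ) := hu.mulL hζ.pred.pred
  have hF := UH.of_locF (κ := κ) hQ2 hζ.pred hu
  have hb := UH.of_locB (κ := κ) hQ1 hζ.pred.pred.pred hu
  have hc := UH.of_locC (κ := κ) hQ0 hζ.pred.pred.pred hu.pred hg
  refine UH.succ isBase_true hN hv fun a => ?_
  -- Each first derivative of `ζ u` solves the differentiated system. Its new `F` is in `H¹` because
  -- the old `F` is in `H²` and `b` in `H¹`.
  refine UH.gain hQ hN (hv.deriv a) (F := fun p θ => _) (b := fun i θ => _) (c := fun θ => 0)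
    (fun p => UH.derivF hQ a hv (hF p) (hb p.1) p)
    (fun i => (hc.neg isBase_true).ite isBase_true (i = a)) (hc.zero isBase_true)
    (Sys.derivFamily hQ a hv (fun p => (hF p).pred) (h.sys hQ hu.pred))

/-- From `H⁴` to `H^{4+s}`. -/
theorem UH.stage_three (hQ : IsCoefFamily s κ ξ Q) (hN : ∀ θ, 0 ≤ N θ) {ζ : Θ → TF}
    (hζ : UW NoCond 5 fun θ => (ζ θ).toL2) {u g : Θ → L2} (hu : UH NoCond N 4 u)
    (hg : UH (FB s) N 0 fun θ => mul (ζ θ).toL2 (g θ)) (h : LocalEq κ Q ζ u g) :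
    UH (FB s) N 4 fun θ => mul (ζ θ).toL2 (u θ) := by
  have hs := hQ.hs
  have hB := isBase_FB hs
  have hQ2 := fun p q => (hQ.uw p q).weaken
  have hQ1 := fun p q => (hQ.uw p q).pred
  have hQ0 := fun p q => (hQ1 p q).pred
  have hv : UH NoCond N 4 fun θ => mul (ζ θ).toL2 (u θ) := hu.mulL hζ.pred
  have hR := UH.of_commR hζ hu
  -- Here the full regularity of the coefficients enters: they are in `W^{2,∞} ∩ H^{2+s}`, the
  -- commutator is in `H³`, and the product lies in `H^{2+s}`.
  have hF : ∀ p, UH (FB s) N 2 (locF κ Q ζ u p) := fun p =>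
    UH.sum hB fun q => UH.opS κ hs hN (hQ.uw p q) (hR q) (hR q).pred
  have hb := UH.of_locB (κ := κ) hQ2 hζ.pred.pred hu
  have hc : UH (FB s) N 0 (locC κ Q ζ u g) :=
    hg.sub hB (UH.sum hB fun p => ((UH.sumOp hQ1 hu.pred p).mulL (hζ.dd p).pred.pred).hs hs)
  obtain ⟨F1, hF1, sys1⟩ : ∃ F1 : Fin 2 → Pair → Θ → L2, (∀ a p, UH (FB s) N 1 (F1 a p)) ∧
      ∀ a θ, Sys (op κ (Q θ)) (D a (mul (ζ θ).toL2 (u θ))) (fun p => F1 a p θ)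
        (fun i => if i = a then -locC κ Q ζ u g θ else 0) 0 :=
    ⟨fun a p θ => D a (locF κ Q ζ u p θ) -
        ∑ q, mul (D a (Q θ p q)) (DD q (mul (ζ θ).toL2 (u θ))) -
        if p.2 = a then locB κ Q ζ u p.1 θ else 0,
      fun a p => (((hF p).deriv a).sub hB (UH.sum hB fun q =>
        UH.mulS hs hN ((hQ.uw p q).deriv a) (hv.deriv2 q) (hv.deriv2 q))).sub hB
          (((hb p.1).hs hs).ite hB _),
      fun a => Sys.derivFamily hQ a hv.pred (fun p => (hF p).weaken.pred) (h.sys hQ hu.pred.pred)⟩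
  generalize locC κ Q ζ u g = c at hc sys1
  -- It remains to put each second derivative of `ζ u` in `H^{2+s}`. It solves a twice
  -- differentiated system, whose `F` is needed only in `H^s`.
  refine UH.succ hB hN hv fun a => UH.succ hB hN (hv.deriv a) fun a' => ?_
  obtain ⟨F2, hF2, sys2⟩ : ∃ F2 : Pair → Θ → L2, (∀ p, UH (FB s) N 0 (F2 p)) ∧
      ∀ θ, Sys (op κ (Q θ)) (D a' (D a (mul (ζ θ).toL2 (u θ)))) (fun p => F2 p θ)
        (fun i => if i = a' then -0 else 0) 0 :=
    ⟨fun p θ => D a' (F1 a p θ) - ∑ q, mul (D a' (Q θ p q)) (DD q (D a (mul (ζ θ).toL2 (u θ)))) -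
        if p.2 = a' then (if p.1 = a then -c θ else 0) else 0,
      fun p => (((hF1 a p).deriv a').sub hB (UH.sum hB fun q =>
        (((hv.deriv a).deriv2 q).mulL ((hQ.uw p q).deriv a').weaken).hs hs)).sub hB
          (((hc.neg hB).ite hB (p.1 = a)).ite hB (p.2 = a')),
      Sys.derivFamily hQ a' (b := fun i θ => if i = a then -c θ else 0) (c := fun _ => 0)
        (hv.deriv a) (fun p => (hF1 a p).weaken) (sys1 a)⟩
  -- The entry `-0` is what is left in the place of `b` when a system with `c = 0` is
  -- differentiated.
  exact UH.gainS hQ hN (F := F2) (b := fun i _ => if i = a' then -0 else 0) (c := fun _ => 0)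
    ((hv.deriv a).deriv a') hF2
    (fun i => ((hc.weaken.zero isBase_true).neg isBase_true).ite isBase_true (i = a'))
    (hc.weaken.zero isBase_true) sys2

end Global


/-! ### Functions on open sets -/

theorem TF.isTestFunction (f : TF) {V : Set Plane} (h : tsupport f ⊆ V) : IsTestFunction V f :=
  ⟨f.smooth, f.supp, h⟩

theorem TF.tsupport_D_subset (h : Plane) (f : TF) : tsupport (f.D h) ⊆ tsupport f :=
  tsupport_fderiv_apply_subset ℝ h

theorem TF.tsupport_mul_subset (f g : TF) : tsupport (f.mul g) ⊆ tsupport f :=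
  closure_mono fun _ hx => left_ne_zero_of_mul hx

theorem TF.tsupport_dd_subset (p : Pair) (f : TF) : tsupport (f.dd p) ⊆ tsupport f :=
  (TF.tsupport_D_subset _ _).trans (TF.tsupport_D_subset _ _)

/-- Iterated partial derivatives. -/
noncomputable def TF.pd : ∀ {n : ℕ}, (Fin n → Fin 2) → TF → TF
  | 0, _, f => f
  | _ + 1, α, f => (TF.pd (fun i => α i.succ) f).d (α 0)

theorem TF.partialDeriv_eq : ∀ {n : ℕ} (α : Fin n → Fin 2) (f : TF) (x : Plane),
    partialDeriv α f x = f.pd α x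
  | 0, α, f, x => by simp [partialDeriv, TF.pd]
  | n + 1, α, f, x => by
    have hd : DifferentiableAt ℝ (iteratedFDeriv ℝ n f) x :=
      (f.smooth.differentiable_iteratedFDeriv (m := n) (by exact_mod_cast WithTop.coe_lt_top _)) x
    have e : (TF.pd (fun i => α i.succ) f : Plane → ℝ) =
        fun y => iteratedFDeriv ℝ n f y fun i => vec (α i.succ) :=
      funext fun y => (TF.partialDeriv_eq _ f y).symm
    rw [partialDeriv, iteratedFDeriv_succ_apply_left, TF.pd, TF.D_apply, e,
      fderiv_continuousMultilinear_apply_const_apply hd]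
    rfl

/-- `partialDeriv ![i, j]` differentiates in direction `j` first and `TF.dd (i, j)` in direction `i`
first; smoothness makes the order irrelevant. -/
theorem hessian_eq (f : TF) (x : Plane) (i j : Fin 2) : hessian f x i j = f.dd (i, j) x := by
  rw [TF.dd, TF.d, TF.D_comm]
  exact TF.partialDeriv_eq ![i, j] f x

/-- Iterated weak derivatives. -/
noncomputable def Dn : ∀ {n : ℕ}, (Fin n → Fin 2) → L2 → L2
  | 0, _, u => u
  | _ + 1, α, u => Dn (fun i => α i.succ) (D (α 0) u)

theorem HG.Dn {B : ℝ → L2 → Prop} {k : ℕ} {M : ℝ} :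
    ∀ {n : ℕ} (α : Fin n → Fin 2) {u : L2}, HG B (k + n) M u → HG B k M (Dn α u)
  | 0, _, _, h => h
  | _ + 1, α, _, h => HG.Dn (fun i => α i.succ) (HG.D h (α 0))

theorem HG.of_le {k n : ℕ} (hn : n ≤ k) {M : ℝ} {u : L2} :
    ∀ {B : ℝ → L2 → Prop}, HG B k M u → H n M u := by
  induction k with
  | zero => obtain rfl : n = 0 := by omega
            exact fun h => h.weaken
  | succ k ih =>
    rcases hn.lt_or_eq with hn | rfl
    · exact fun h => ih (Nat.le_of_lt_succ hn) h.pred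
    · exact fun h => h.weaken

/-- Integration by parts removes the outermost derivative `α 0` of `f` and applies it to `u` first.
`Dn` is built in that order, so no derivatives have to be commuted. -/
theorem HG.inner_pd {B : ℝ → L2 → Prop} {M : ℝ} (f : TF) : ∀ {n : ℕ} (α : Fin n → Fin 2) {u : L2},
    HG B n M u → inner ℝ u (f.pd α).toL2 = (-1) ^ n * inner ℝ (KirchhoffPlate.Dn α u) f.toL2
  | 0, _, _, _ => by simp [TF.pd, KirchhoffPlate.Dn]
  | n + 1, α, u, h => by
    rw [TF.pd, h.wd (α 0), HG.inner_pd f _ (h.D (α 0)), KirchhoffPlate.Dn, pow_succ]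
    ring

/-! ### Extension by zero and local weak derivatives -/

open Classical in
/-- Extension by zero of a function in `L²(V)` (and `0` by convention for other functions). -/
noncomputable def zext (V : Set Plane) (f : Plane → ℝ) : L2 :=
  if h : MemLp (V.indicator f) 2 volume then h.toLp else 0

section Extension

variable {V : Set Plane} {f : Plane → ℝ}

theorem coeFn_zext (hV : MeasurableSet V) (hf : MemLp f 2 (volume.restrict V)) :
    (zext V f : Plane → ℝ) =ᵐ[volume] V.indicator f := by
  have h : MemLp (V.indicator f) 2 volume := (memLp_indicator_iff_restrict hV).2 hf
  rw [zext, dif_pos h]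
  exact h.coeFn_toLp

theorem zext_eq_on (hV : MeasurableSet V) (hf : MemLp f 2 (volume.restrict V)) :
    ∀ᵐ x, x ∈ V → zext V f x = f x := by
  filter_upwards [coeFn_zext hV hf] with x hx hxV
  rw [hx, Set.indicator_of_mem hxV]

theorem inner_zext_toL2 (hV : MeasurableSet V) (hf : MemLp f 2 (volume.restrict V)) (φ : TF) :
    inner ℝ (zext V f) φ.toL2 = ∫ x in V, φ x * f x := by
  rw [inner_toL2, ← integral_indicator hV]
  apply integral_congr_ae
  filter_upwards [coeFn_zext hV hf] with x hx
  rw [hx]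
  by_cases h : x ∈ V <;> simp [h, mul_comm]

theorem memLp_of_lintegral_le {M : ℝ} (hm : AEStronglyMeasurable f (volume.restrict V))
    (h : ∫⁻ x in V, ENNReal.ofReal (f x ^ 2) ≤ ENNReal.ofReal (M ^ 2)) :
    MemLp f 2 (volume.restrict V) := by
  rw [memLp_two_iff_integrable_sq hm]
  refine ⟨hm.pow 2, ?_⟩
  rw [hasFiniteIntegral_iff_ofReal (ae_of_all _ fun x => sq_nonneg _)]
  exact h.trans_lt ENNReal.ofReal_lt_top

theorem lintegral_sq_eq (u : L2) : ∫⁻ x, ENNReal.ofReal (u x ^ 2) = ENNReal.ofReal (‖u‖ ^ 2) := by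
  rw [← real_inner_self_eq_norm_sq, inner_eq_integral, ofReal_integral_eq_lintegral_ofReal]
  · simp only [pow_two]
  · simpa only [pow_two] using (Lp.memLp u).integrable_sq
  · exact ae_of_all _ fun x => mul_self_nonneg _

theorem norm_le_of_lintegral_le {u : L2} {M : ℝ} (hM : 0 ≤ M)
    (h : ∫⁻ x, ENNReal.ofReal (u x ^ 2) ≤ ENNReal.ofReal (M ^ 2)) : ‖u‖ ≤ M := by
  rw [lintegral_sq_eq, ENNReal.ofReal_le_ofReal_iff (by positivity)] at h
  exact (sq_le_sq₀ (norm_nonneg _) hM).1 h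

theorem lintegral_zext (hV : MeasurableSet V) (hf : MemLp f 2 (volume.restrict V)) :
    ∫⁻ x, ENNReal.ofReal (zext V f x ^ 2) = ∫⁻ x in V, ENNReal.ofReal (f x ^ 2) := by
  rw [← lintegral_indicator hV]
  apply lintegral_congr_ae
  filter_upwards [coeFn_zext hV hf] with x hx
  rw [hx]
  by_cases h : x ∈ V <;> simp [h]

theorem CB.zext {A : ℝ} (hA : 0 ≤ A) (hV : MeasurableSet V) (hf : MemLp f 2 (volume.restrict V))
    (h : ∀ᵐ x ∂volume.restrict V, |f x| ≤ A) : CB A (zext V f) := by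
  filter_upwards [coeFn_zext hV hf, (ae_restrict_iff' hV).1 h] with x hx h
  rw [hx]
  by_cases hxV : x ∈ V
  · simpa [hxV] using h hxV
  · simpa [hxV] using hA

end Extension

/-- Two functions agree on an open set if they have the same integrals against test functions. -/
theorem ae_eq_of_inner {W : Set Plane} (hW : IsOpen W) {u v : L2}
    (h : ∀ f : TF, tsupport f ⊆ W → inner ℝ u f.toL2 = inner ℝ v f.toL2) :
    ∀ᵐ x, x ∈ W → u x = v x := by
  have := hW.ae_eq_zero_of_integral_contDiff_smul_eq_zero (μ := volume) (f := ⇑(u - v))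
    ((locallyIntegrable (u - v)).locallyIntegrableOn W) fun φ h1 h2 h3 => by
      have e := inner_toL2 (u - v) ⟨φ, h1, h2⟩
      rw [inner_sub_left, h ⟨φ, h1, h2⟩ h3, sub_self] at e
      rw [e]
      simp only [smul_eq_mul, mul_comm]
  filter_upwards [this, Lp.coeFn_sub u v] with x h1 h2 hx
  have := h1 hx
  rw [h2, Pi.sub_apply] at this
  linarith

theorem inner_congr_on {W : Set Plane} {u v : L2} (h : ∀ᵐ x, x ∈ W → u x = v x) (f : TF)
    (hf : tsupport f ⊆ W) : inner ℝ u f.toL2 = inner ℝ v f.toL2 := by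
  rw [inner_toL2, inner_toL2]
  apply integral_congr_ae
  filter_upwards [h] with x hx
  by_cases hxf : x ∈ tsupport f
  · rw [hx (hf hxf)]
  · rw [image_eq_zero_of_notMem_tsupport hxf, mul_zero, mul_zero]

/-- `v` is the weak derivative `∂_a u` in `V`. -/
def LWD (V : Set Plane) (a : Fin 2) (u v : L2) : Prop :=
  ∀ f : TF, tsupport f ⊆ V → inner ℝ u (f.d a).toL2 = -inner ℝ v f.toL2

/-- For every test function `f` on the plane `ζ f` is supported in `V`, so the cutoff turns a local
weak derivative into a global one. -/
theorem LWD.mul_TF {V : Set Plane} {a : Fin 2} {u v : L2} (h : LWD V a u v) (ζ : TF)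
    (hζ : tsupport ζ ⊆ V) :
    WD a (mul ζ.toL2 u) (mul ζ.toL2 v + mul (ζ.d a).toL2 u) := by
  intro f
  obtain ⟨A, hA⟩ := exists_CB ζ
  obtain ⟨A', hA'⟩ := exists_CB (ζ.d a)
  have e : mul ζ.toL2 (f.d a).toL2 = ((ζ.mul f).d a).toL2 - mul (ζ.d a).toL2 f.toL2 := by
    rw [mul_toL2, mul_toL2, ← TF.toL2_sub]
    congr 1
    ext x
    rw [TF.sub_apply, TF.D_mul, TF.mul_apply, TF.mul_apply]
    ring
  rw [inner_mul_left hA, e, inner_sub_right, h _ ((TF.tsupport_mul_subset _ _).trans hζ),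
    ← mul_toL2, inner_add_left, inner_mul_left hA, inner_mul_left hA']
  ring

/-- On `W` a weak derivative is determined by pairings with test functions supported in `W`, and
these only see the function on `W`. -/
theorem LWD.ae_eq {V W : Set Plane} (hW : IsOpen W) (hWV : W ⊆ V) {a : Fin 2} {u v u' v' : L2}
    (h : LWD V a u v) (h' : WD a u' v') (hu : ∀ᵐ x, x ∈ W → u' x = u x) :
    ∀ᵐ x, x ∈ W → v' x = v x := by
  refine ae_eq_of_inner hW fun f hf => ?_
  have h1 := h f (hf.trans hWV)
  have h2 := h' f
  rw [inner_congr_on hu (f.d a) ((TF.tsupport_D_subset _ _).trans hf), h1] at h2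
  linarith

/-! ### Weak derivatives on open sets -/

section WeakDerivs

variable {F : Type*} [NormedAddCommGroup F] [NormedSpace ℝ F]

theorem IsTestFunction.mono {V W : Set Plane} (h : V ⊆ W) {φ : Plane → ℝ}
    (hφ : IsTestFunction V φ) : IsTestFunction W φ := ⟨hφ.1, hφ.2.1, hφ.2.2.trans h⟩

theorem IsTestFunction.integrableOn_smul {V : Set Plane} {φ : Plane → ℝ} (hφ : IsTestFunction V φ)
    {v : Plane → F} (hv : LocallyIntegrableOn v V) : IntegrableOn (fun x => φ x • v x) V := by
  have hK : IntegrableOn v (tsupport φ) := hv.integrableOn_compact_subset hφ.2.2 hφ.2.1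
  have h1 : IntegrableOn (fun x => φ x • v x) (tsupport φ) :=
    hK.continuousOn_smul hφ.1.continuous.continuousOn hφ.2.1
  refine ((integrableOn_iff_integrable_of_support_subset ?_).1 h1).integrableOn
  exact (Function.support_smul_subset_left φ v).trans (subset_tsupport φ)

theorem IsTestFunction.partialDeriv {V : Set Plane} {φ : Plane → ℝ} (hφ : IsTestFunction V φ)
    {n : ℕ} (α : Fin n → Fin 2) : IsTestFunction V (KirchhoffPlate.partialDeriv α φ) := by
  have e : KirchhoffPlate.partialDeriv α φ = TF.pd α ⟨φ, hφ.1, hφ.2.1⟩ :=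
    funext fun x => TF.partialDeriv_eq α ⟨φ, hφ.1, hφ.2.1⟩ x
  have h : ∀ {n : ℕ} (α : Fin n → Fin 2) (f : TF), tsupport (f.pd α) ⊆ tsupport f := by
    intro n
    induction n with
    | zero => exact fun α f => subset_rfl
    | succ n ih => exact fun α f => (TF.tsupport_D_subset _ _).trans (ih _ f)
  rw [e]
  exact TF.isTestFunction _ ((h α ⟨φ, hφ.1, hφ.2.1⟩).trans hφ.2.2)

theorem IsTestFunction.setIntegral_eq {V W : Set Plane} (h : V ⊆ W) {φ : Plane → ℝ}
    (hφ : IsTestFunction V φ) (u : Plane → F) : ∫ x in W, φ x • u x = ∫ x in V, φ x • u x := by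
  rw [setIntegral_eq_integral_of_forall_compl_eq_zero fun x hx => ?_,
    setIntegral_eq_integral_of_forall_compl_eq_zero fun x hx => ?_]
  · rw [image_eq_zero_of_notMem_tsupport fun hx' => hx (hφ.2.2 hx'), zero_smul]
  · rw [image_eq_zero_of_notMem_tsupport fun hx' => hx (h (hφ.2.2 hx')), zero_smul]

theorem IsWeakDeriv.mono {V W : Set Plane} (h : V ⊆ W) {n : ℕ} {α : Fin n → Fin 2}
    {u v : Plane → F} (hu : IsWeakDeriv W α u v) : IsWeakDeriv V α u v := by
  refine ⟨hu.1.mono_set h, hu.2.1.mono_set h, fun φ hφ => ?_⟩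
  have := hu.2.2 φ (hφ.mono h)
  rwa [hφ.setIntegral_eq h, (hφ.partialDeriv α).setIntegral_eq h] at this

theorem HasWeakDerivs.mono {V W : Set Plane} (h : V ⊆ W) {k : ℕ} {u : Plane → F}
    (hu : HasWeakDerivs W k u) : HasWeakDerivs V k u := fun n hn α =>
  (hu n hn α).imp fun _ => IsWeakDeriv.mono h

theorem HasWeakDerivs.isWeakDeriv {V : Set Plane} {k n : ℕ} {u : Plane → F}
    (hu : HasWeakDerivs V k u) (hn : n ≤ k) (α : Fin n → Fin 2) :
    IsWeakDeriv V α u (weakDeriv V α u) := by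
  rw [weakDeriv, dif_pos (hu n hn α)]
  exact (hu n hn α).choose_spec

theorem IsWeakDeriv.weakDeriv_ae_eq [CompleteSpace F] {V : Set Plane} (hV : IsOpen V) {n : ℕ}
    {α : Fin n → Fin 2} {u v : Plane → F} (h : IsWeakDeriv V α u v) :
    ∀ᵐ x ∂volume.restrict V, weakDeriv V α u x = v x := by
  have h' : ∃ v, IsWeakDeriv V α u v := ⟨v, h⟩
  rw [weakDeriv, dif_pos h']
  exact h'.choose_spec.ae_eq hV h

theorem IsWeakDeriv.refl {V : Set Plane} {u : Plane → F} (hu : LocallyIntegrableOn u V)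
    (α : Fin 0 → Fin 2) : IsWeakDeriv V α u u :=
  ⟨hu, hu, fun φ _ => by simp [KirchhoffPlate.partialDeriv]⟩

/-- This is how the components of the tensor field inherit its weak derivatives. -/
theorem IsWeakDeriv.clm {G : Type*} [NormedAddCommGroup G] [NormedSpace ℝ G] [CompleteSpace F]
    [CompleteSpace G] {V : Set Plane} (hV : IsOpen V) {n : ℕ} {α : Fin n → Fin 2}
    {u v : Plane → F} (h : IsWeakDeriv V α u v) (L : F →L[ℝ] G) :
    IsWeakDeriv V α (fun x => L (u x)) fun x => L (v x) := by
  have hL : ∀ {u : Plane → F}, LocallyIntegrableOn u V → LocallyIntegrableOn (fun x => L (u x)) V :=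
    fun hu => by
      rw [locallyIntegrableOn_iff (hV.isLocallyClosed)] at hu ⊢
      exact fun K hK hKc => L.integrable_comp (hu K hK hKc)
  have key : ∀ {u : Plane → F} {φ : Plane → ℝ}, LocallyIntegrableOn u V → IsTestFunction V φ →
      ∫ x in V, φ x • L (u x) = L (∫ x in V, φ x • u x) := fun {u φ} hu hφ => by
    rw [← L.integral_comp_comm (hφ.integrableOn_smul hu)]
    simp
  refine ⟨hL h.1, hL h.2.1, fun φ hφ => ?_⟩
  rw [key h.1 (hφ.partialDeriv α), key h.2.1 hφ, h.2.2 φ hφ, map_smul]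

end WeakDerivs

theorem IsWeakDeriv.inner_pd {V : Set Plane} (hV : IsOpen V) {n : ℕ} {α : Fin n → Fin 2}
    {u v : Plane → ℝ} (h : IsWeakDeriv V α u v) (hu : MemLp u 2 (volume.restrict V))
    (hv : MemLp v 2 (volume.restrict V)) (f : TF) (hf : tsupport f ⊆ V) :
    inner ℝ (zext V u) (f.pd α).toL2 = (-1) ^ n * inner ℝ (zext V v) f.toL2 := by
  rw [inner_zext_toL2 hV.measurableSet hu, inner_zext_toL2 hV.measurableSet hv]
  have := h.2.2 f (f.isTestFunction hf)
  simpa only [TF.partialDeriv_eq, smul_eq_mul] using this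

theorem IsWeakDeriv.lwd {V : Set Plane} (hV : IsOpen V) {α : Fin 1 → Fin 2} {u v : Plane → ℝ}
    (h : IsWeakDeriv V α u v) (hu : MemLp u 2 (volume.restrict V))
    (hv : MemLp v 2 (volume.restrict V)) : LWD V (α 0) (zext V u) (zext V v) := fun f hf => by
  have := h.inner_pd hV hu hv f hf
  simpa [TF.pd] using this

/-- Testing the first derivative with `∂_b f` exhibits the second derivative as a derivative of the
first. -/
theorem IsWeakDeriv.lwd_lwd {V : Set Plane} (hV : IsOpen V) {a b : Fin 2} {u v w : Plane → ℝ}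
    (h : IsWeakDeriv V ![a] u v) (h2 : IsWeakDeriv V ![a, b] u w)
    (hu : MemLp u 2 (volume.restrict V)) (hv : MemLp v 2 (volume.restrict V))
    (hw : MemLp w 2 (volume.restrict V)) : LWD V b (zext V v) (zext V w) := fun f hf => by
  have h1 := h.lwd hV hu hv (f.d b) ((TF.tsupport_D_subset _ _).trans hf)
  have h2 := h2.inner_pd hV hu hw f hf
  simp only [TF.pd, Matrix.cons_val_zero] at h1 h2
  rw [← neg_inj, ← h1, neg_neg]
  refine h2.trans ?_
  norm_num

/-- A function which agrees on `U` with an element of `H^k` of the plane. -/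
theorem HG.isWeakDeriv {B : ℝ → L2 → Prop} {n : ℕ} {M : ℝ} {u : L2} (h : HG B n M u) {U : Set Plane}
    (hU : IsOpen U) {w : Plane → ℝ} (hw : ∀ᵐ x, x ∈ U → u x = w x) (α : Fin n → Fin 2) :
    IsWeakDeriv U α w (KirchhoffPlate.Dn α u) := by
  have hw' : u =ᵐ[volume.restrict U] w := (ae_restrict_iff' hU.measurableSet).2 hw
  refine ⟨?_, (locallyIntegrable _).locallyIntegrableOn U, fun φ hφ => ?_⟩
  · have := (locallyIntegrable u).locallyIntegrableOn U
    rw [locallyIntegrableOn_iff hU.isLocallyClosed] at this ⊢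
    exact fun K hK hKc => (this K hK hKc).congr (ae_restrict_of_ae_restrict_of_subset hK hw')
  · have key : ∀ (v : L2) (f : TF), tsupport f ⊆ U → inner ℝ v f.toL2 = ∫ x in U, f x • v x := by
      intro v f hf
      rw [inner_toL2, setIntegral_eq_integral_of_forall_compl_eq_zero fun x hx => by
        rw [image_eq_zero_of_notMem_tsupport fun hx' => hx (hf hx'), zero_smul]]
      simp only [smul_eq_mul, mul_comm]
    have h1 := h.inner_pd ⟨φ, hφ.1, hφ.2.1⟩ α
    have e : partialDeriv α φ = TF.pd α ⟨φ, hφ.1, hφ.2.1⟩ :=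
      funext fun x => TF.partialDeriv_eq α ⟨φ, hφ.1, hφ.2.1⟩ x
    have hs : tsupport (TF.pd α ⟨φ, hφ.1, hφ.2.1⟩) ⊆ U := by
      rw [← e]; exact (hφ.partialDeriv α).2.2
    rw [key _ _ hs, key _ ⟨φ, hφ.1, hφ.2.1⟩ hφ.2.2, ← e] at h1
    rw [smul_eq_mul, ← h1]
    apply integral_congr_ae
    filter_upwards [hw'] with x hx
    rw [hx]


/-! ### Interior parts and cutoff functions -/

theorem innerPart_subset (U : Set Plane) (r : ℝ) : innerPart U r ⊆ U := fun _ h => h.1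

theorem isOpen_innerPart {U : Set Plane} (hU : IsOpen U) (r : ℝ) : IsOpen (innerPart U r) :=
  hU.inter (isOpen_lt continuous_const (Metric.continuous_infDist_pt _))

theorem innerPart_anti (U : Set Plane) {r r' : ℝ} (h : r' ≤ r) : innerPart U r ⊆ innerPart U r' :=
  fun _ hx => ⟨hx.1, h.trans_lt hx.2⟩

/-- The open ball about `x` whose radius is the distance to the frontier misses the frontier; being
connected, it cannot leave `U`. -/
theorem mem_innerPart_of_dist_le {U : Set Plane} {r r' : ℝ} (hr' : 0 ≤ r') {x y : Plane}
    (hx : x ∈ innerPart U r) (hy : dist x y ≤ r - r') : y ∈ innerPart U r' := by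
  have h1 := Metric.infDist_le_infDist_add_dist (s := frontier U) (x := x) (y := y)
  have h2 := hx.2
  refine ⟨?_, by linarith⟩
  by_contra hyU
  have hpos : 0 < Metric.infDist x (frontier U) := by linarith [dist_nonneg (x := x) (y := y)]
  have hd : ∀ z ∈ Metric.ball x (Metric.infDist x (frontier U)), z ∉ frontier U := by
    intro z hz1 hz2
    have := Metric.infDist_le_dist_of_mem (x := x) hz2
    rw [Metric.mem_ball, dist_comm] at hz1
    linarith
  have hcl : ∀ z ∈ Metric.ball x (Metric.infDist x (frontier U)), z ∉ U → z ∉ closure U :=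
    fun z hz hzU hzc => hd z hz ⟨hzc, fun h => hzU (interior_subset h)⟩
  have hin : ∀ z ∈ Metric.ball x (Metric.infDist x (frontier U)), z ∈ U → z ∈ interior U :=
    fun z hz hzU => by
      by_contra h
      exact hd z hz ⟨subset_closure hzU, h⟩
  have hy' : y ∈ Metric.ball x (Metric.infDist x (frontier U)) := by
    rw [Metric.mem_ball, dist_comm]; linarith
  have hx' := Metric.mem_ball_self (x := x) hpos
  obtain ⟨z, _, hz1, hz2⟩ := (convex_ball x (Metric.infDist x (frontier U))).isPreconnected
    (interior U) (closure U)ᶜ isOpen_interior isClosed_closure.isOpen_compl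
    (fun z hz => by
      by_cases h : z ∈ U
      · exact Or.inl (hin z hz h)
      · exact Or.inr (hcl z hz h))
    ⟨x, hx', hin x hx' hx.1⟩ ⟨y, hy', hcl y hy' hyU⟩
  exact hz2 (subset_closure (interior_subset hz1))

/-- The convolution of a test function with the indicator of a bounded set. -/
noncomputable def smear (S : Set Plane) (hS : MeasurableSet S) (hb : Bornology.IsBounded S)
    (η : TF) : TF where
  toFun := convolution (S.indicator fun _ => (1 : ℝ)) η (ContinuousLinearMap.mul ℝ ℝ) volume
  smooth := η.supp.contDiff_convolution_right _
    ((integrable_indicator_iff hS).2 (integrableOn_const hb.measure_lt_top.ne)).locallyIntegrable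
    η.smooth
  supp := HasCompactSupport.convolution _ (HasCompactSupport.of_support_subset_isCompact
    hb.isCompact_closure (Set.support_indicator_subset.trans subset_closure)) η.supp

section Smear

variable {S : Set Plane} (hS : MeasurableSet S) (hb : Bornology.IsBounded S)

theorem smear_apply (η : TF) (x : Plane) : smear S hS hb η x = ∫ y in S, η (x - y) := by
  change convolution (S.indicator fun _ => (1 : ℝ)) η (ContinuousLinearMap.mul ℝ ℝ) volume x = _
  rw [convolution_def, ← integral_indicator hS]
  congr 1
  ext y
  by_cases h : y ∈ S <;> simp [h]

/-- All derivatives fall on the kernel, so their bounds do not depend on the shape of `S`. -/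
theorem smear_D (h : Plane) (η : TF) : (smear S hS hb η).D h = smear S hS hb (η.D h) := by
  ext x
  have hi : LocallyIntegrable (S.indicator fun _ => (1 : ℝ)) (volume : Measure Plane) :=
    ((integrable_indicator_iff hS).2 (integrableOn_const hb.measure_lt_top.ne)).locallyIntegrable
  have := η.supp.hasFDerivAt_convolution_right (ContinuousLinearMap.mul ℝ ℝ) (μ := volume) hi
    (η.smooth.of_le (by simp)) x
  rw [TF.D_apply]
  change fderiv ℝ (convolution (S.indicator fun _ => (1 : ℝ)) η (ContinuousLinearMap.mul ℝ ℝ) volume) x h = _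
  rw [this.fderiv, convolution_precompR_apply _ hi (η.supp.fderiv (𝕜 := ℝ))
    (η.smooth.continuous_fderiv (by simp))]
  rfl

theorem integrable_sub_left (η : TF) (x : Plane) : Integrable fun y => η (x - y) :=
  (memLp_one_iff_integrable.1 (η.memLp 1)).comp_sub_left x

theorem abs_smear_le (η : TF) (x : Plane) : |smear S hS hb η x| ≤ ∫ y, |η y| := by
  rw [smear_apply, ← integral_sub_left_eq_self (fun y => |η y|) volume x]
  refine (abs_integral_le_integral_abs).trans ?_
  exact setIntegral_le_integral (integrable_sub_left η x).abs (ae_of_all _ fun _ => abs_nonneg _)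

theorem tsupport_smear_subset {η : TF} {δ : ℝ} (hη : tsupport η ⊆ Metric.closedBall 0 δ) :
    tsupport (smear S hS hb η) ⊆ Metric.cthickening δ S := by
  refine closure_minimal (fun x hx => ?_) Metric.isClosed_cthickening
  rw [Function.mem_support, smear_apply] at hx
  obtain ⟨y, hy, hxy⟩ : ∃ y ∈ S, η (x - y) ≠ 0 := by
    by_contra! hcon
    exact hx (setIntegral_eq_zero_of_forall_eq_zero hcon)
  refine Metric.mem_cthickening_of_dist_le x y δ S hy ?_
  have := hη (subset_tsupport _ hxy)
  rwa [mem_closedBall_zero_iff, ← dist_eq_norm] at this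

end Smear

theorem TF.norm_toL2_le (f : TF) {A M : ℝ} {V : Set Plane} (hM : 0 ≤ M) (hV : MeasurableSet V)
    (hf : ∀ x, |f x| ≤ A) (hs : tsupport f ⊆ V) (hv : volume V ≤ ENNReal.ofReal M) :
    ‖f.toL2‖ ≤ A * √M := by
  have A0 : 0 ≤ A := (abs_nonneg _).trans (hf 0)
  refine norm_le_of_lintegral_le (by positivity) ?_
  calc ∫⁻ x, ENNReal.ofReal (f.toL2 x ^ 2)
      ≤ ∫⁻ x, V.indicator (fun _ => ENNReal.ofReal (A ^ 2)) x := by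
        refine lintegral_mono_ae ?_
        filter_upwards [f.coeFn_toL2] with x hx
        rw [hx]
        by_cases h : x ∈ V
        · rw [Set.indicator_of_mem h, ← sq_abs]
          exact ENNReal.ofReal_le_ofReal (pow_le_pow_left₀ (abs_nonneg _) (hf x) 2)
        · rw [image_eq_zero_of_notMem_tsupport fun h' => h (hs h')]
          simp
    _ = ENNReal.ofReal (A ^ 2) * volume V := by rw [lintegral_indicator_const hV]
    _ ≤ ENNReal.ofReal (A ^ 2) * ENNReal.ofReal M := by gcongr
    _ = ENNReal.ofReal ((A * √M) ^ 2) := by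
        rw [← ENNReal.ofReal_mul (by positivity), mul_pow, Real.sq_sqrt hM]

theorem WG.mono {B : ℝ → L2 → Prop} (hB : IsBase B) : ∀ {k : ℕ} {A A' : ℝ} {q : L2},
    WG B k A q → A ≤ A' → WG B k A' q
  | 0, _, _, _, h, h' => ⟨h.1.mono h', h.2.1.trans h', hB.mono h.2.2 h'⟩
  | _ + 1, _, _, _, h, h' => ⟨h.1.mono h', h.2.1.trans h', fun a => ⟨h.wd a, (h.D a).mono hB h'⟩⟩

/-- The suprema are controlled by `L¹` norms of derivatives of `η`, and the `L²` norms by these and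
the area bound; hence one `A` for all sets. -/
theorem exists_WG_smear {M δ : ℝ} (hM : 0 ≤ M) (k : ℕ) : ∀ η : TF,
    tsupport η ⊆ Metric.closedBall 0 δ → ∃ A, ∀ (V S : Set Plane) (hS : MeasurableSet S)
      (hb : Bornology.IsBounded S), MeasurableSet V → volume V ≤ ENNReal.ofReal M →
      Metric.cthickening δ S ⊆ V → WG NoCond k A (smear S hS hb η).toL2 := by
  induction k with
  | zero =>
    intro η hη
    refine ⟨(∫ y, |η y|) * (1 + √M), fun V S hS hb hV hv hSV => ?_⟩
    have I0 : 0 ≤ ∫ y, |η y| := integral_nonneg fun _ => abs_nonneg _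
    have := Real.sqrt_nonneg M
    exact ⟨(CB.of_TF _ (abs_smear_le hS hb η)).mono (by nlinarith),
      ((smear S hS hb η).norm_toL2_le hM hV (abs_smear_le hS hb η)
        ((tsupport_smear_subset hS hb hη).trans hSV) hv).trans (by nlinarith), trivial⟩
  | succ k ih =>
    intro η hη
    obtain ⟨A0, h0⟩ := ih η hη
    choose A hA using fun a => ih (η.d a) ((TF.tsupport_D_subset _ _).trans hη)
    have hle : ∀ a, A a ≤ ∑ a, |A a| := fun a => (le_abs_self _).trans
      (Finset.single_le_sum (f := fun a => |A a|) (fun _ _ => abs_nonneg _) (Finset.mem_univ a))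
    have hs : 0 ≤ ∑ a, |A a| := Finset.sum_nonneg fun _ _ => abs_nonneg _
    refine ⟨|A0| + ∑ a, |A a|, fun V S hS hb hV hv hSV => ?_⟩
    have h1 := (h0 V S hS hb hV hv hSV).mono isBase_true
      ((le_abs_self A0).trans (le_add_of_nonneg_right hs))
    refine WG.succ h1.cb h1.hg.norm_le (fun a => WD.toL2 a _) fun a => ?_
    rw [TF.d, smear_D]
    exact (hA a V S hS hb hV hv hSV).mono isBase_true ((hle a).trans
      (le_add_of_nonneg_left (abs_nonneg _)))

/-- Cutoff functions between two interior parts, with uniform bounds. -/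
theorem exists_cutoff {M r r' : ℝ} (hM : 0 ≤ M) (hr' : 0 ≤ r') (hr : r' < r) (k : ℕ) :
    ∃ A, ∀ Ω : Set Plane, IsOpen Ω → Bornology.IsBounded Ω → volume Ω ≤ ENNReal.ofReal M →
      ∃ ζ : TF, tsupport ζ ⊆ innerPart Ω r' ∧ (∀ x ∈ innerPart Ω r, ζ x = 1) ∧
        (∀ x, 0 ≤ ζ x ∧ ζ x ≤ 1) ∧ WG NoCond k A ζ.toL2 := by
  set δ := (r - r') / 4 with hδ
  have δ0 : 0 < δ := by rw [hδ]; linarith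
  let b : ContDiffBump (0 : Plane) := ⟨δ / 2, δ, by positivity, by linarith⟩
  let η : TF := ⟨b.normed volume, b.contDiff_normed, b.hasCompactSupport_normed⟩
  have hη : tsupport η ⊆ Metric.closedBall 0 δ := b.tsupport_normed_eq.subset
  have η0 : ∀ x, 0 ≤ η x := fun x => b.nonneg_normed x
  have hη1 : ∫ y, η y = 1 := b.integral_normed
  obtain ⟨A, hA⟩ := exists_WG_smear hM k η hη
  refine ⟨A, fun Ω hΩ hbd hv => ?_⟩
  -- The set to be smeared lies midway between the two interior parts. The gap on either side is `2
  -- * δ`, which leaves room for a kernel of radius `δ`.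
  have hS := (isOpen_innerPart hΩ ((r + r') / 2)).measurableSet
  have hb := hbd.subset (innerPart_subset Ω ((r + r') / 2))
  have hsub : Metric.cthickening δ (innerPart Ω ((r + r') / 2)) ⊆ innerPart Ω r' := by
    intro x hx
    obtain ⟨y, hy, hxy⟩ := Metric.mem_thickening_iff.1
      (Metric.cthickening_subset_thickening' (δ₂ := 2 * δ) (by positivity) (by linarith) _ hx)
    exact mem_innerPart_of_dist_le hr' hy (by rw [dist_comm]; linarith)
  refine ⟨smear _ hS hb η, (tsupport_smear_subset hS hb hη).trans hsub, fun x hx => ?_,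
    fun x => ⟨?_, ?_⟩, hA Ω _ hS hb hΩ.measurableSet hv (hsub.trans (innerPart_subset _ _))⟩
  · rw [smear_apply, setIntegral_eq_integral_of_forall_compl_eq_zero,
      integral_sub_left_eq_self (fun y => η y) volume x, hη1]
    intro y hy
    by_contra hne
    have := hη (subset_tsupport _ hne)
    rw [mem_closedBall_zero_iff, ← dist_eq_norm] at this
    exact hy (mem_innerPart_of_dist_le (by linarith) hx (by linarith))
  · rw [smear_apply]
    exact integral_nonneg fun y => η0 _
  · refine (le_abs_self _).trans ((abs_smear_le hS hb η x).trans_eq ?_)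
    simp only [abs_of_nonneg (η0 _), hη1]

/-! ### Gagliardo seminorms -/

/-- The square of the Gagliardo seminorm on `V`. -/
noncomputable def gag (V : Set Plane) (s : ℝ) (f : Plane → ℝ) : ℝ≥0∞ :=
  ∫⁻ y in V, ∫⁻ x in V, ENNReal.ofReal ((f x - f y) ^ 2 / ‖x - y‖ ^ (2 + 2 * s))

theorem gag_congr {V : Set Plane} {s : ℝ} {f g : Plane → ℝ} (h : f =ᵐ[volume.restrict V] g) :
    gag V s f = gag V s g := by
  refine lintegral_congr_ae ?_
  filter_upwards [h] with y hy
  refine lintegral_congr_ae ?_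
  filter_upwards [h] with x hx
  rw [hx, hy]

theorem gag_mono {V W : Set Plane} (h : V ⊆ W) (s : ℝ) (f : Plane → ℝ) : gag V s f ≤ gag W s f :=
  lintegral_mono' (Measure.restrict_mono h le_rfl) fun _ =>
    lintegral_mono' (Measure.restrict_mono h le_rfl) le_rfl

theorem measurable_gag (s : ℝ) (u : L2) : Measurable fun p : Plane × Plane =>
    ENNReal.ofReal ((u p.1 - u p.2) ^ 2 / ‖p.1 - p.2‖ ^ (2 + 2 * s)) := by
  have := (Lp.stronglyMeasurable u).measurable
  fun_prop

theorem FN_sq_eq {s : ℝ} {f : Plane → ℝ} :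
    FN s f ^ 2 = ∫⁻ h, ENNReal.ofReal (f h ^ 2 / ‖h‖ ^ (2 + 2 * s)) := by
  have := eLpNorm_nnreal_pow_eq_lintegral (f := fun h => f h / ‖h‖ ^ (1 + s)) (p := 2)
    (μ := (volume : Measure Plane)) two_ne_zero
  norm_num at this
  rw [FN, this]
  congr 1
  ext h
  rw [← enorm_pow, Real.enorm_of_nonneg (sq_nonneg _), div_pow, ← Real.rpow_mul_natCast (norm_nonneg _)]
  congr 3
  push_cast
  ring

/-- Tonelli and the substitution `z = x + h`. This is the bridge between translation estimates and
the Gagliardo seminorm. -/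
theorem FN_sq_T (s : ℝ) (u : L2) : FN s (fun h => ‖T h u - u‖) ^ 2 = gag Set.univ s u := by
  have hm := (Lp.stronglyMeasurable u).measurable
  rw [FN_sq_eq]
  have e : ∀ h : Plane, ENNReal.ofReal (‖T h u - u‖ ^ 2 / ‖h‖ ^ (2 + 2 * s)) =
      ∫⁻ x, ENNReal.ofReal ((u (x + h) - u x) ^ 2 / ‖h‖ ^ (2 + 2 * s)) := by
    intro h
    have h0 : 0 ≤ (‖h‖ ^ (2 + 2 * s))⁻¹ := by positivity
    simp only [div_eq_mul_inv, ENNReal.ofReal_mul (sq_nonneg _)]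
    rw [lintegral_mul_const' _ _ ENNReal.ofReal_ne_top, ← lintegral_sq_eq]
    congr 1
    apply lintegral_congr_ae
    filter_upwards [Lp.coeFn_sub (T h u) u, coeFn_T h u] with x h1 h2
    rw [h1, Pi.sub_apply, h2]
  simp only [e]
  rw [lintegral_lintegral_swap (by fun_prop), gag, Measure.restrict_univ]
  refine lintegral_congr fun x => ?_
  rw [← lintegral_add_left_eq_self (fun z => ENNReal.ofReal ((u z - u x) ^ 2 / ‖z - x‖ ^ (2 + 2 * s))) x]
  simp only [add_sub_cancel_left]

theorem FB_iff {s M : ℝ} (hM : 0 ≤ M) {u : L2} :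
    FB s M u ↔ gag Set.univ s u ≤ ENNReal.ofReal (M ^ 2) := by
  rw [← FN_sq_T, ENNReal.ofReal_pow hM, FB]
  exact (ENNReal.pow_le_pow_left_iff two_ne_zero).symm

theorem CB.abs_le {f : TF} {A : ℝ} (h : CB A f.toL2) (x : Plane) : |f x| ≤ A := by
  have h1 : ∀ᵐ x, |f x| ≤ A := by
    filter_upwards [h, f.coeFn_toL2] with x h1 h2
    rwa [← h2]
  have hc : IsClosed {x | |f x| ≤ A} := isClosed_le f.continuous.abs continuous_const
  have := (Measure.dense_of_ae h1).closure_eq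
  rw [hc.closure_eq] at this
  exact this.ge (Set.mem_univ x)

theorem WG.abs_sub_le {B : ℝ → L2 → Prop} {f : TF} {A : ℝ} (h : WG B 1 A f.toL2) (x y : Plane) :
    |f x - f y| ≤ 2 * A * min 1 ‖x - y‖ := by
  have A0 := h.nonneg
  rw [mul_min_of_nonneg _ _ (by positivity)]
  refine le_min ?_ ?_
  · have h1 := h.cb.abs_le x
    have h2 := h.cb.abs_le y
    have := abs_sub (f x) (f y)
    linarith
  · have hd : ∀ a z, |f.d a z| ≤ A := fun a z => by
      have := (h.D a).cb
      rw [D_toL2] at this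
      exact this.abs_le z
    have hb : ∀ z, ‖fderiv ℝ f z‖ ≤ 2 * A := fun z => by
      refine ContinuousLinearMap.opNorm_le_bound _ (by positivity) fun v => ?_
      rw [← TF.D_apply, TF.D_eq_sum, Fin.sum_univ_two]
      refine (norm_add_le _ _).trans ?_
      have := fun a => mul_le_mul (PiLp.norm_apply_le v a) (hd a z) (abs_nonneg _) (norm_nonneg _)
      have h0 := this 0
      have h1 := this 1
      rw [norm_mul, norm_mul]
      simp only [Real.norm_eq_abs] at h0 h1 ⊢
      linarith
    exact Convex.norm_image_sub_le_of_norm_fderiv_le (fun z _ => f.differentiable z)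
      (fun z _ => hb z) convex_univ (Set.mem_univ y) (Set.mem_univ x)

theorem sq_mul_sub_le {z z' u u' A m : ℝ} (hz : |z| ≤ A) (hm : |z - z'| ≤ m) :
    (z * u - z' * u') ^ 2 ≤ 2 * A ^ 2 * (u - u') ^ 2 + 2 * m ^ 2 * u' ^ 2 := by
  have h1 : z ^ 2 ≤ A ^ 2 := sq_le_sq' (abs_le.1 hz).1 (abs_le.1 hz).2
  have h2 : (z - z') ^ 2 ≤ m ^ 2 := sq_le_sq' (abs_le.1 hm).1 (abs_le.1 hm).2
  have e : z * u - z' * u' = z * (u - u') + (z - z') * u' := by ring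
  rw [e]
  have h3 := mul_le_mul_of_nonneg_right h1 (sq_nonneg (u - u'))
  have h4 := mul_le_mul_of_nonneg_right h2 (sq_nonneg u')
  nlinarith [sq_nonneg (z * (u - u') - (z - z') * u')]

theorem lintegral_min_mul {s : ℝ} (hs : s ∈ Set.Ioo (0 : ℝ) 1) (u : L2) :
    ∫⁻ y, ∫⁻ x, ENNReal.ofReal (min 1 ‖x - y‖ ^ 2 / ‖x - y‖ ^ (2 + 2 * s)) *
      ENNReal.ofReal (u y ^ 2) = ENNReal.ofReal (cs s ^ 2 * ‖u‖ ^ 2) := by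
  have e : ∀ y : Plane, ∫⁻ x, ENNReal.ofReal (min 1 ‖x - y‖ ^ 2 / ‖x - y‖ ^ (2 + 2 * s)) *
      ENNReal.ofReal (u y ^ 2) = ENNReal.ofReal (cs s ^ 2) * ENNReal.ofReal (u y ^ 2) := by
    intro y
    rw [lintegral_mul_const' _ _ ENNReal.ofReal_ne_top, lintegral_sub_right_eq_self
      (fun x : Plane => ENNReal.ofReal (min 1 ‖x‖ ^ 2 / ‖x‖ ^ (2 + 2 * s))) y, ← FN_sq_eq,
      ENNReal.ofReal_pow (cs_nonneg s), cs, ENNReal.ofReal_toReal (FN_min_lt_top hs).ne]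
  simp only [e]
  rw [lintegral_const_mul' _ _ ENNReal.ofReal_ne_top, lintegral_sq_eq,
    ENNReal.ofReal_mul (sq_nonneg _)]

/-- If both points lie in `V`, split the difference of the product. If one lies outside, `ζ`
vanishes there and the difference is `ζ x - ζ y` times the value of `u` at the other point, so no
difference of `u` outside `V × V` occurs. -/
theorem sq_TF_mul_sub_le {A : ℝ} {B : ℝ → L2 → Prop} {ζ : TF} (hζ : WG B 1 A ζ.toL2)
    {V : Set Plane} (hζV : tsupport ζ ⊆ V) (u : Plane → ℝ) (x y : Plane) :
    (ζ x * u x - ζ y * u y) ^ 2 ≤ 2 * A ^ 2 *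
      V.indicator (fun y => V.indicator (fun x => (u x - u y) ^ 2) x) y +
        8 * A ^ 2 * (min 1 ‖x - y‖ ^ 2 * u x ^ 2 + min 1 ‖x - y‖ ^ 2 * u y ^ 2) := by
  have hζ0 : ∀ x, x ∉ V → ζ x = 0 := fun x hx =>
    image_eq_zero_of_notMem_tsupport fun h => hx (hζV h)
  have hd := hζ.abs_sub_le x y
  have hx0 : 0 ≤ (A * min 1 ‖x - y‖ * u x) ^ 2 := sq_nonneg _
  have hy0 : 0 ≤ (A * min 1 ‖x - y‖ * u y) ^ 2 := sq_nonneg _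
  have hd2 : (ζ x - ζ y) ^ 2 ≤ (2 * A * min 1 ‖x - y‖) ^ 2 :=
    sq_le_sq' (abs_le.1 hd).1 (abs_le.1 hd).2
  by_cases hy : y ∈ V
  · by_cases hx : x ∈ V
    · have h1 := sq_mul_sub_le (u := u x) (u' := u y) (hζ.cb.abs_le x) hd
      rw [Set.indicator_of_mem hy, Set.indicator_of_mem hx]
      linarith
    · rw [Set.indicator_of_mem hy, Set.indicator_of_notMem hx]
      rw [hζ0 x hx] at hd2 ⊢
      nlinarith [mul_le_mul_of_nonneg_right hd2 (sq_nonneg (u y))]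
  · rw [Set.indicator_of_notMem hy]
    rw [hζ0 y hy] at hd2 ⊢
    nlinarith [mul_le_mul_of_nonneg_right hd2 (sq_nonneg (u x))]

theorem lintegral_lintegral_add_le {F1 F2 F3 : Plane → Plane → ℝ≥0∞} {I1 I2 I3 : ℝ≥0∞}
    (m1 : Measurable fun p : Plane × Plane => F1 p.1 p.2)
    (m2 : Measurable fun p : Plane × Plane => F2 p.1 p.2) (h1 : ∫⁻ y, ∫⁻ x, F1 y x ≤ I1)
    (h2 : ∫⁻ y, ∫⁻ x, F2 y x ≤ I2) (h3 : ∫⁻ y, ∫⁻ x, F3 y x ≤ I3) {c d : ℝ≥0∞} (hd : d ≠ ⊤) :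
    ∫⁻ y, ∫⁻ x, (c * F1 y x + d * (F2 y x + F3 y x)) ≤ c * I1 + d * (I2 + I3) := by
  have p1 : ∀ y, Measurable (F1 y) := fun y => m1.comp measurable_prodMk_left
  have p2 : ∀ y, Measurable (F2 y) := fun y => m2.comp measurable_prodMk_left
  have n1 : Measurable fun y => ∫⁻ x, F1 y x := m1.lintegral_prod_right'
  have n2 : Measurable fun y => ∫⁻ x, F2 y x := m2.lintegral_prod_right'
  have : ∀ y, ∫⁻ x, (c * F1 y x + d * (F2 y x + F3 y x)) =
      c * (∫⁻ x, F1 y x) + d * ((∫⁻ x, F2 y x) + (∫⁻ x, F3 y x)) := fun y => by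
    rw [lintegral_add_left ((p1 y).const_mul _), lintegral_const_mul _ (p1 y),
      lintegral_const_mul' _ _ hd, lintegral_add_left (p2 y)]
  simp only [this]
  rw [lintegral_add_left (n1.const_mul _), lintegral_const_mul _ n1,
    lintegral_const_mul' _ _ hd, lintegral_add_left n2]
  gcongr

/-- Multiplication by a cutoff function turns local into global Gagliardo bounds. -/
theorem FB_mul_TF {s A M : ℝ} (hs : s ∈ Set.Ioo (0 : ℝ) 1) {B : ℝ → L2 → Prop} {ζ : TF}
    (hζ : WG B 1 A ζ.toL2) {V : Set Plane} (hV : MeasurableSet V) (hζV : tsupport ζ ⊆ V) {u : L2}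
    (hu : ‖u‖ ≤ M) (hg : gag V s u ≤ ENNReal.ofReal (M ^ 2)) :
    FB s (2 * (1 + 2 * cs s) * A * M) (mul ζ.toL2 u) := by
  have A0 := hζ.nonneg
  have M0 := (norm_nonneg u).trans hu
  have c0 := cs_nonneg s
  have hm := (Lp.stronglyMeasurable u).measurable
  rw [FB_iff (by positivity), gag_congr (g := fun x => ζ x * u x) (by
    rw [Measure.restrict_univ]
    filter_upwards [coeFn_mul hζ.cb u, ζ.coeFn_toL2] with x h1 h2
    rw [h1, h2]), gag, Measure.restrict_univ]
  have hpt : ∀ y x, ENNReal.ofReal ((ζ x * u x - ζ y * u y) ^ 2 / ‖x - y‖ ^ (2 + 2 * s)) ≤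
      ENNReal.ofReal (2 * A ^ 2) * (V.indicator (fun y => V.indicator (fun x =>
        ENNReal.ofReal ((u x - u y) ^ 2 / ‖x - y‖ ^ (2 + 2 * s))) x) y) +
      ENNReal.ofReal (8 * A ^ 2) * (ENNReal.ofReal (min 1 ‖y - x‖ ^ 2 / ‖y - x‖ ^ (2 + 2 * s)) *
        ENNReal.ofReal (u x ^ 2) + ENNReal.ofReal (min 1 ‖x - y‖ ^ 2 / ‖x - y‖ ^ (2 + 2 * s)) *
          ENNReal.ofReal (u y ^ 2)) := by
    intro y x
    have d0 : 0 ≤ ‖x - y‖ ^ (2 + 2 * s) := by positivity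
    have h := div_le_div_of_nonneg_right (sq_TF_mul_sub_le hζ hζV u x y) d0
    have e : V.indicator (fun y => V.indicator (fun x =>
        ENNReal.ofReal ((u x - u y) ^ 2 / ‖x - y‖ ^ (2 + 2 * s))) x) y =
        ENNReal.ofReal ((V.indicator (fun y => V.indicator (fun x => (u x - u y) ^ 2) x) y) /
          ‖x - y‖ ^ (2 + 2 * s)) := by
      by_cases hy : y ∈ V <;> by_cases hx : x ∈ V <;> simp [hx, hy]
    have i0 : 0 ≤ V.indicator (fun y => V.indicator (fun x => (u x - u y) ^ 2) x) y :=
      Set.indicator_nonneg (fun _ _ => Set.indicator_nonneg (fun _ _ => sq_nonneg _) _) _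
    rw [e, norm_sub_rev y x, ← ENNReal.ofReal_mul (by positivity), ← ENNReal.ofReal_mul (by positivity),
      ← ENNReal.ofReal_mul (by positivity), ← ENNReal.ofReal_add (by positivity) (by positivity),
      ← ENNReal.ofReal_mul (by positivity), ← ENNReal.ofReal_add
        (mul_nonneg (by positivity) (div_nonneg i0 d0)) (by positivity)]
    refine ENNReal.ofReal_le_ofReal (h.trans_eq ?_)
    ring
  refine (lintegral_mono fun y => lintegral_mono fun x => hpt y x).trans ?_
  have hI2 := (lintegral_min_mul hs u).le
  have m2 : Measurable fun p : Plane × Plane => ENNReal.ofReal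
      (min 1 ‖p.1 - p.2‖ ^ 2 / ‖p.1 - p.2‖ ^ (2 + 2 * s)) * ENNReal.ofReal (u p.2 ^ 2) := by
    fun_prop
  refine (lintegral_lintegral_add_le (I1 := ENNReal.ofReal (M ^ 2))
      (I2 := ENNReal.ofReal (cs s ^ 2 * ‖u‖ ^ 2)) (F2 := fun y x =>
      ENNReal.ofReal (min 1 ‖y - x‖ ^ 2 / ‖y - x‖ ^ (2 + 2 * s)) * ENNReal.ofReal (u x ^ 2))
    ?_ m2 ?_ ?_ hI2 ENNReal.ofReal_ne_top).trans ?_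
  · exact ((((measurable_gag s u).comp measurable_swap).indicator
      (measurable_snd hV)).indicator (measurable_fst hV))
  · refine le_trans (le_of_eq ?_) hg
    rw [gag, ← lintegral_indicator hV]
    refine lintegral_congr fun y => ?_
    by_cases hy : y ∈ V
    · simp only [Set.indicator_of_mem hy]
      rw [lintegral_indicator hV]
    · simp [Set.indicator_of_notMem hy]
  · rw [lintegral_lintegral_swap m2.aemeasurable]
    exact hI2
  · rw [← ENNReal.ofReal_mul (by positivity), ← ENNReal.ofReal_add (by positivity) (by positivity),
      ← ENNReal.ofReal_mul (by positivity), ← ENNReal.ofReal_add (by positivity) (by positivity)]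
    refine ENNReal.ofReal_le_ofReal ?_
    have h1 : ‖u‖ ^ 2 ≤ M ^ 2 := by gcongr
    have h2 : A ^ 2 * cs s ^ 2 * ‖u‖ ^ 2 ≤ A ^ 2 * cs s ^ 2 * M ^ 2 := by gcongr
    have h3 : 0 ≤ A ^ 2 * M ^ 2 * (2 + 16 * cs s) := by positivity
    nlinarith


/-! ### Norms on open sets -/

theorem rpow_half_le_iff {X : ℝ≥0∞} {N : ℝ} (hN : 0 ≤ N) :
    X ^ (1 / 2 : ℝ) ≤ ENNReal.ofReal N ↔ X ≤ ENNReal.ofReal (N ^ 2) := by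
  rw [← ENNReal.rpow_le_rpow_iff (z := 2) (by norm_num), ← ENNReal.rpow_mul]
  norm_num
  rw [ENNReal.ofReal_pow hN]

section Norms

variable {F : Type*} [NormedAddCommGroup F] [NormedSpace ℝ F] {U : Set Plane} {u : Plane → F}

theorem sobolevNorm_one (U : Set Plane) (k : ℕ) (u : Plane → F) : sobolevNorm 1 U k u =
    (∑ i ∈ Finset.range (k + 1), ∫⁻ x in U, ENNReal.ofReal (gradSq U i u x)) ^ (1 / 2 : ℝ) := by
  simp [sobolevNorm]

theorem lintegral_gradSq_le {k i : ℕ} (hi : i ≤ k) {N : ℝ} (hN : 0 ≤ N)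
    (h : sobolevNorm 1 U k u ≤ ENNReal.ofReal N) :
    ∫⁻ x in U, ENNReal.ofReal (gradSq U i u x) ≤ ENNReal.ofReal (N ^ 2) := by
  rw [sobolevNorm_one, rpow_half_le_iff hN] at h
  exact (Finset.single_le_sum (f := fun i => ∫⁻ x in U, ENNReal.ofReal (gradSq U i u x))
    (fun _ _ => zero_le) (Finset.mem_range.2 (Nat.lt_succ_of_le hi))).trans h

theorem norm_weakDeriv_sq_le {n : ℕ} (α : Fin n → Fin 2) (x : Plane) :
    ‖weakDeriv U α u x‖ ^ 2 ≤ gradSq U n u x :=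
  Finset.single_le_sum (f := fun α => ‖weakDeriv U α u x‖ ^ 2) (fun _ _ => sq_nonneg _)
    (Finset.mem_univ α)

theorem norm_weakDeriv_le {k n : ℕ} (hn : n ≤ k) {M : ℝ} (hM : 0 ≤ M)
    (h : supSobolevNorm 1 U k u ≤ ENNReal.ofReal M) (α : Fin n → Fin 2) :
    ∀ᵐ x ∂volume.restrict U, ‖weakDeriv U α u x‖ ≤ M := by
  have h1 : essSup (fun x => ENNReal.ofReal (Real.sqrt (gradSq U n u x))) (volume.restrict U) ≤
      ENNReal.ofReal M := by
    refine le_trans ?_ h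
    simp only [supSobolevNorm, one_pow, ENNReal.ofReal_one, one_mul]
    exact Finset.single_le_sum (f := fun n => essSup (fun x => ENNReal.ofReal
      (Real.sqrt (gradSq U n u x))) (volume.restrict U)) (fun _ _ => zero_le)
      (Finset.mem_range.2 (Nat.lt_succ_of_le hn))
  filter_upwards [ENNReal.ae_le_essSup fun x => ENNReal.ofReal (Real.sqrt (gradSq U n u x))] with x hx
  have h2 := (ENNReal.ofReal_le_ofReal_iff hM).1 (hx.trans h1)
  exact (Real.le_sqrt_of_sq_le (norm_weakDeriv_sq_le α x)).trans h2

/-- Only one multi-index is kept, and through `f` possibly only one component of that derivative;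
both decrease the integrand. -/
theorem gag_le_of_gagliardoSeminorm_le {k : ℕ} {s M : ℝ} (hM : 0 ≤ M)
    (h : gagliardoSeminorm U k s u ≤ ENNReal.ofReal M) {f : Plane → ℝ} (α : Fin k → Fin 2)
    (hf : ∀ x y, |f x - f y| ≤ ‖weakDeriv U α u x - weakDeriv U α u y‖) :
    gag U s f ≤ ENNReal.ofReal (M ^ 2) := by
  rw [gagliardoSeminorm, rpow_half_le_iff hM] at h
  refine (lintegral_mono fun y => lintegral_mono fun x => ENNReal.ofReal_le_ofReal ?_).trans h
  refine div_le_div_of_nonneg_right ?_ (by positivity)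
  rw [← sq_abs]
  exact (pow_le_pow_left₀ (abs_nonneg _) (hf x y) 2).trans (Finset.single_le_sum
    (f := fun α => ‖weakDeriv U α u x - weakDeriv U α u y‖ ^ 2) (fun _ _ => sq_nonneg _)
    (Finset.mem_univ α))

theorem weakDeriv_mono_ae [CompleteSpace F] {V : Set Plane} (hV : IsOpen V) (h : V ⊆ U) {n k : ℕ}
    (hu : HasWeakDerivs U k u) (hn : n ≤ k) (α : Fin n → Fin 2) :
    ∀ᵐ x ∂volume.restrict V, weakDeriv V α u x = weakDeriv U α u x :=
  ((hu.isWeakDeriv hn α).mono h).weakDeriv_ae_eq hV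

theorem sobolevNorm_mono [CompleteSpace F] {V : Set Plane} (hV : IsOpen V) (h : V ⊆ U) {k : ℕ}
    (hu : HasWeakDerivs U k u) : sobolevNorm 1 V k u ≤ sobolevNorm 1 U k u := by
  rw [sobolevNorm_one, sobolevNorm_one]
  refine ENNReal.rpow_le_rpow (Finset.sum_le_sum fun i hi => ?_) (by norm_num)
  refine le_trans (le_of_eq (lintegral_congr_ae ?_))
    (lintegral_mono' (Measure.restrict_mono h le_rfl) le_rfl)
  have : ∀ᵐ x ∂volume.restrict V, ∀ α : Fin i → Fin 2, weakDeriv V α u x = weakDeriv U α u x :=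
    ae_all_iff.2 fun α => weakDeriv_mono_ae hV h hu (Nat.lt_succ_iff.1 (Finset.mem_range.1 hi)) α
  filter_upwards [this] with x hx
  simp only [gradSq, hx]

theorem HasWeakDerivs.weakDeriv_zero_ae_eq [CompleteSpace F] (hU : IsOpen U) {k : ℕ}
    (hu : HasWeakDerivs U k u) (α : Fin 0 → Fin 2) :
    ∀ᵐ x ∂volume.restrict U, weakDeriv U α u x = u x :=
  (IsWeakDeriv.refl (hu.isWeakDeriv (Nat.zero_le k) α).1 α).weakDeriv_ae_eq hU

end Norms

/-! ### Functions with two weak derivatives on an open set -/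

/-- `u1` and `u2` are the weak derivatives of `u` on `V`, all bounded by `N` in `L²`. -/
structure Jet (V : Set Plane) (N : ℝ) (u : L2) (u1 : Fin 2 → L2) (u2 : Fin 2 → Fin 2 → L2) :
    Prop where
  norm0 : ‖u‖ ≤ N
  norm1 : ∀ a, ‖u1 a‖ ≤ N
  norm2 : ∀ a b, ‖u2 a b‖ ≤ N
  lwd1 : ∀ a, LWD V a u (u1 a)
  lwd2 : ∀ a b, LWD V b (u1 a) (u2 a b)

theorem Jet.of_isWeakDeriv {V : Set Plane} (hV : IsOpen V) {f : Plane → ℝ} {f1 : Fin 2 → Plane → ℝ}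
    {f2 : Fin 2 → Fin 2 → Plane → ℝ} (h1 : ∀ a, IsWeakDeriv V ![a] f (f1 a))
    (h2 : ∀ a b, IsWeakDeriv V ![a, b] f (f2 a b)) {N : ℝ} (hN : 0 ≤ N)
    (n0 : ∫⁻ x in V, ENNReal.ofReal (f x ^ 2) ≤ ENNReal.ofReal (N ^ 2))
    (n1 : ∀ a, ∫⁻ x in V, ENNReal.ofReal (f1 a x ^ 2) ≤ ENNReal.ofReal (N ^ 2))
    (n2 : ∀ a b, ∫⁻ x in V, ENNReal.ofReal (f2 a b x ^ 2) ≤ ENNReal.ofReal (N ^ 2)) :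
    MemLp f 2 (volume.restrict V) ∧ (∀ a, MemLp (f1 a) 2 (volume.restrict V)) ∧
      (∀ a b, MemLp (f2 a b) 2 (volume.restrict V)) ∧
      Jet V N (zext V f) (fun a => zext V (f1 a)) fun a b => zext V (f2 a b) := by
  have m0 := memLp_of_lintegral_le (h1 0).1.aestronglyMeasurable n0
  have m1 := fun a => memLp_of_lintegral_le (h1 a).2.1.aestronglyMeasurable (n1 a)
  have m2 := fun a b => memLp_of_lintegral_le (h2 a b).2.1.aestronglyMeasurable (n2 a b)
  have hV' := hV.measurableSet
  exact ⟨m0, m1, m2, norm_le_of_lintegral_le hN ((lintegral_zext hV' m0).trans_le n0),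
    fun a => norm_le_of_lintegral_le hN ((lintegral_zext hV' (m1 a)).trans_le (n1 a)),
    fun a b => norm_le_of_lintegral_le hN ((lintegral_zext hV' (m2 a b)).trans_le (n2 a b)),
    fun a => (h1 a).lwd hV m0 (m1 a), fun a b => (h1 a).lwd_lwd hV (h2 a b) m0 (m1 a) (m2 a b)⟩

theorem HG.mul_TF_one {V : Set Plane} {A N : ℝ} {v : L2} {v1 : Fin 2 → L2}
    (h : ∀ a, LWD V a v (v1 a)) (h0 : ‖v‖ ≤ N) (h1 : ∀ a, ‖v1 a‖ ≤ N) {ζ : TF}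
    (hζ : WG NoCond 1 A ζ.toL2) (hs : tsupport ζ ⊆ V) : H 1 (2 * A * N) (mul ζ.toL2 v) := by
  have A0 := hζ.nonneg
  have N0 := (norm_nonneg v).trans h0
  have hd : ∀ a, CB A (ζ.d a).toL2 := fun a => by
    have := (hζ.D a).cb
    rwa [D_toL2] at this
  have b : ∀ {q v : L2}, CB A q → ‖v‖ ≤ N → ‖mul q v‖ ≤ A * N := fun hq hv =>
    (norm_mul_le hq _).trans (mul_le_mul_of_nonneg_left hv A0)
  have AN : 0 ≤ A * N := by positivity
  refine HG.succ ((b hζ.cb h0).trans (by linarith)) (fun a => (h a).mul_TF ζ hs) fun a =>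
    ⟨(norm_add_le _ _).trans ?_, trivial⟩
  linarith [b hζ.cb (h1 a), b (hd a) h0]

theorem WG.d {B : ℝ → L2 → Prop} {k : ℕ} {A : ℝ} {ζ : TF} (h : WG B (k + 1) A ζ.toL2) (a : Fin 2) :
    WG B k A (ζ.d a).toL2 := by
  have := h.D a
  rwa [D_toL2] at this

theorem Jet.hg {V : Set Plane} {A N : ℝ} {u : L2} {u1 : Fin 2 → L2} {u2 : Fin 2 → Fin 2 → L2}
    (h : Jet V N u u1 u2) {ζ : TF} (hζ : WG NoCond 2 A ζ.toL2) (hs : tsupport ζ ⊆ V) :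
    H 2 (2 * A * N + 2 * A * N) (mul ζ.toL2 u) := by
  have A0 := hζ.nonneg
  have N0 := (norm_nonneg u).trans h.norm0
  have h1 := HG.mul_TF_one h.lwd1 h.norm0 h.norm1 hζ.pred hs
  have AN : 0 ≤ 2 * A * N := by positivity
  exact HG.succ (h1.norm_le.trans (by linarith)) (fun a => (h.lwd1 a).mul_TF ζ hs) fun a =>
    (HG.mul_TF_one (h.lwd2 a) (h.norm1 a) (h.norm2 a) hζ.pred hs).add isBase_true
      (HG.mul_TF_one h.lwd1 h.norm0 h.norm1 (hζ.d a) ((TF.tsupport_D_subset _ _).trans hs))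

theorem WG.add {B : ℝ → L2 → Prop} (hB : IsBase B) : ∀ {k : ℕ} {M N : ℝ} {u v : L2}, WG B k M u →
    WG B k N v → WG B k (M + N) (u + v)
  | 0, _, _, _, _, h, h' => ⟨h.1.add h'.1, (norm_add_le _ _).trans (add_le_add h.2.1 h'.2.1),
      hB.add h.nonneg h'.nonneg h.2.2 h'.2.2⟩
  | _ + 1, _, _, _, _, h, h' => WG.succ (h.1.add h'.1)
      ((norm_add_le _ _).trans (add_le_add h.2.1 h'.2.1))
      (fun a => (h.wd a).add (h'.wd a)) fun a => (h.D a).add hB (h'.D a)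

theorem CB.smul {A : ℝ} {q : L2} (hq : CB A q) (c : ℝ) : CB (|c| * A) (c • q) := by
  filter_upwards [Lp.coeFn_smul c q, hq] with x h1 h2
  rw [h1, Pi.smul_apply, smul_eq_mul, abs_mul]
  exact mul_le_mul_of_nonneg_left h2 (abs_nonneg c)

theorem WG.smul {B : ℝ → L2 → Prop} (hB : IsBase B) (c : ℝ) : ∀ {k : ℕ} {M : ℝ} {u : L2},
    WG B k M u → WG B k (|c| * M) (c • u)
  | 0, _, _, h => ⟨h.1.smul c, (norm_smul_le _ _).trans
      (mul_le_mul_of_nonneg_left h.2.1 (abs_nonneg c)), hB.smul c h.nonneg h.2.2⟩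
  | _ + 1, _, _, h => WG.succ (h.1.smul c) ((norm_smul_le _ _).trans
      (mul_le_mul_of_nonneg_left h.2.1 (abs_nonneg c)))
      (fun a => (h.wd a).smul c) fun a => (h.D a).smul hB c

theorem WG.hs {s : ℝ} (hs : s ∈ Set.Ioo (0 : ℝ) 1) : ∀ {k : ℕ} {A : ℝ} {q : L2},
    WG NoCond (k + 1) A q → WG (FB s) k (ks s * A) q
  | 0, _, _, h => ⟨h.cb.mono (le_mul_of_one_le_left h.nonneg (one_le_ks s)),
      h.2.1.trans (le_mul_of_one_le_left h.nonneg (one_le_ks s)), H.fb hs h.hg⟩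
  | _ + 1, _, _, h => ⟨h.cb.mono (le_mul_of_one_le_left h.nonneg (one_le_ks s)),
      h.2.1.trans (le_mul_of_one_le_left h.nonneg (one_le_ks s)), fun a => ⟨h.wd a, (h.D a).hs hs⟩⟩

/-- Localized coefficients. -/
theorem Jet.wg {s : ℝ} (hs : s ∈ Set.Ioo (0 : ℝ) 1) {V : Set Plane} (hV : MeasurableSet V)
    {A N : ℝ} {u : L2} {u1 : Fin 2 → L2} {u2 : Fin 2 → Fin 2 → L2} (h : Jet V N u u1 u2)
    (c0 : CB N u) (c1 : ∀ a, CB N (u1 a)) (c2 : ∀ a b, CB N (u2 a b))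
    (hg : ∀ a b, gag V s (u2 a b) ≤ ENNReal.ofReal (N ^ 2)) {ζ : TF}
    (hζ : WG NoCond 3 A ζ.toL2) (hsupp : tsupport ζ ⊆ V) :
    WG (FB s) 2 (16 * (1 + cs s + ks s) * A * N) (mul ζ.toL2 u) := by
  have A0 := hζ.nonneg
  have N0 := c0.nonneg
  have AN : 0 ≤ A * N := by positivity
  have k1 := one_le_ks s
  have k0 := cs_nonneg s
  -- A bound for each of the four Leibniz terms of a second derivative of `ζ u`.
  set m := 4 * (1 + cs s + ks s) * A * N with hm
  have m1 : A * N ≤ m := by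
    rw [hm, mul_assoc]
    exact le_mul_of_one_le_left AN (by linarith)
  have m0 : 0 ≤ m := AN.trans m1
  have hsd : ∀ {η : TF} (a), tsupport η ⊆ V → tsupport (η.d a) ⊆ V := fun a h =>
    (TF.tsupport_D_subset _ _).trans h
  have hB := isBase_FB hs
  have base : ∀ {η : TF} {q : L2}, CB A η.toL2 → CB N q → ‖q‖ ≤ N →
      FB s m (mul η.toL2 q) → WG (FB s) 0 m (mul η.toL2 q) :=
    fun hη hq hq' hf => ⟨(hη.mulL hq).mono m1, ((norm_mul_le hη _).trans
      (mul_le_mul_of_nonneg_left hq' A0)).trans m1, hf⟩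
  have f1 : ∀ {η : TF} {v : L2} {v1 : Fin 2 → L2}, (∀ a, LWD V a v (v1 a)) → CB N v → ‖v‖ ≤ N →
      (∀ a, ‖v1 a‖ ≤ N) → WG NoCond 1 A η.toL2 → tsupport η ⊆ V →
      WG (FB s) 0 m (mul η.toL2 v) :=
    fun e1 e2 e3 e4 e5 e6 => base e5.cb e2 e3
      ((H.fb hs (HG.mul_TF_one e1 e3 e4 e5 e6)).mono (by nlinarith))
  -- This is the one term without a further derivative: its `H^s` bound comes from the local
  -- Gagliardo seminorm. The others, treated by `f1`, are in `H¹`.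
  have f2 : ∀ a b, WG (FB s) 0 m (mul ζ.toL2 (u2 a b)) := fun a b =>
    base hζ.cb (c2 a b) (h.norm2 a b)
      ((FB_mul_TF hs hζ.pred.pred hV hsupp (h.norm2 a b) (hg a b)).mono (by nlinarith))
  have s1 : ∀ {η : TF} {v : L2} {v1 : Fin 2 → L2}, (∀ a, LWD V a v (v1 a)) → CB N v → ‖v‖ ≤ N →
      WG NoCond 1 A η.toL2 → tsupport η ⊆ V → (∀ a, WG (FB s) 0 m (mul η.toL2 (v1 a))) →
      (∀ a, WG (FB s) 0 m (mul (η.d a).toL2 v)) → WG (FB s) 1 (m + m) (mul η.toL2 v) :=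
    fun e1 e2 e3 e4 e5 e6 e7 => WG.succ ((e4.cb.mulL e2).mono (by linarith))
      (((norm_mul_le e4.cb _).trans (mul_le_mul_of_nonneg_left e3 A0)).trans (by linarith))
      (fun a => (e1 a).mul_TF _ e5) fun a => (e6 a).add hB (e7 a)
  have e : 16 * (1 + cs s + ks s) * A * N = m + m + (m + m) := by rw [hm]; ring
  rw [e]
  refine WG.succ ((hζ.cb.mulL c0).mono (by linarith))
    (((norm_mul_le hζ.cb _).trans (mul_le_mul_of_nonneg_left h.norm0 A0)).trans (by linarith))
    (fun a => (h.lwd1 a).mul_TF _ hsupp) fun a => WG.add hB ?_ ?_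
  · exact s1 (h.lwd2 a) (c1 a) (h.norm1 a) hζ.pred.pred hsupp (f2 a) fun b =>
      f1 (h.lwd2 a) (c1 a) (h.norm1 a) (h.norm2 a) (hζ.d b).pred (hsd b hsupp)
  · exact s1 h.lwd1 c0 h.norm0 (hζ.d a).pred (hsd a hsupp) (fun b => f1 (h.lwd2 b) (c1 b)
      (h.norm1 b) (h.norm2 b) (hζ.d a).pred (hsd a hsupp)) fun b => f1 h.lwd1 c0 h.norm0 h.norm1
        ((hζ.d a).d b) (hsd b (hsd a hsupp))


/-! ### The plate equation at unit length scale -/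

/-- A solution of the plate equation with admissible coefficients, for `ρ₀ = 1`. The right hand side
is `c g`. -/
structure PlateData (h M₁ M₂ M₃ ξ₀ s : ℝ) where
  /-- the domain -/
  Ω : Set Plane
  /-- the elasticity tensor -/
  C : Plane → Tensor4
  /-- the right hand side, up to the factor `c` -/
  g : Plane → ℝ
  /-- the solution -/
  w : Plane → ℝ
  /-- the factor on the right hand side -/
  c : ℝ
  c_nonneg : 0 ≤ c
  isOpen : IsOpen Ω
  isBounded : Bornology.IsBounded Ω
  volume_le : volume Ω ≤ ENNReal.ofReal M₁
  convex : ∀ᵐ x ∂volume.restrict Ω, ∀ A : Matrix (Fin 2) (Fin 2) ℝ, A.IsSymm →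
    ξ₀ * matDot A A ≤ matDot ((C x).app A) A
  hasC : HasWeakDerivs Ω 2 C
  supC : supSobolevNorm 1 Ω 2 C ≤ ENNReal.ofReal M₂
  gagC : gagliardoSeminorm Ω 2 s C ≤ ENNReal.ofReal M₃
  memG : MemFracSobolev Ω 0 s g
  memW : MemSobolev Ω 2 w
  eqn : ∀ φ, IsTestFunction Ω φ → ∫ x in Ω, matDot ((plateTensor h C x).app (weakHessian Ω w x))
    (hessian φ x) = c * ∫ x in Ω, g x * φ x

/-- The index of a component of a fourth order tensor. -/
abbrev idx (p q : Pair) : Fin 2 × Fin 2 × Fin 2 × Fin 2 := (p.1, p.2, q.1, q.2)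

theorem lintegral_sq_le_of_bound {V : Set Plane} {f : Plane → ℝ} {M M₁ : ℝ} (hM : 0 ≤ M₁)
    (hf : ∀ᵐ x ∂volume.restrict V, |f x| ≤ M) (hv : volume V ≤ ENNReal.ofReal M₁) :
    ∫⁻ x in V, ENNReal.ofReal (f x ^ 2) ≤ ENNReal.ofReal ((M * √M₁) ^ 2) :=
  calc ∫⁻ x in V, ENNReal.ofReal (f x ^ 2) ≤ ∫⁻ _ in V, ENNReal.ofReal (M ^ 2) := by
        refine lintegral_mono_ae ?_
        filter_upwards [hf] with x hx
        rw [← sq_abs]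
        exact ENNReal.ofReal_le_ofReal (pow_le_pow_left₀ (abs_nonneg _) hx 2)
    _ = ENNReal.ofReal (M ^ 2) * volume V := setLIntegral_const _ _
    _ ≤ ENNReal.ofReal (M ^ 2) * ENNReal.ofReal M₁ := by gcongr
    _ = ENNReal.ofReal ((M * √M₁) ^ 2) := by
        rw [← ENNReal.ofReal_mul (by positivity), mul_pow, Real.sq_sqrt hM]

theorem sum_inner_toL2_eq {ι : Type*} [Fintype ι] (R : ι → L2) (f : ι → TF) :
    ∑ i, inner ℝ (R i) (f i).toL2 = ∫ x, ∑ i, R i x * f i x := by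
  rw [integral_finsetSum]
  · exact Finset.sum_congr rfl fun i _ => inner_toL2 _ _
  · exact fun i _ => (Lp.memLp (R i)).integrable_mul ((f i).memLp 2)

namespace PlateData

variable {h M₁ M₂ M₃ ξ₀ s : ℝ} (θ : PlateData h M₁ M₂ M₃ ξ₀ s)

/-- The components of the elasticity tensor. -/
noncomputable def coef (p q : Pair) : L2 := zext θ.Ω fun x => θ.C x (idx p q)

theorem coef_spec (hM₁ : 0 ≤ M₁) (hM₂ : 0 ≤ M₂) (hM₃ : 0 ≤ M₃) (hs : s ∈ Set.Ioo (0 : ℝ) 1)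
    (p q : Pair) :
    MemLp (fun x => θ.C x (idx p q)) 2 (volume.restrict θ.Ω) ∧
    ∀ (A : ℝ) (ζ : TF), WG NoCond 3 A ζ.toL2 → tsupport ζ ⊆ θ.Ω →
      WG (FB s) 2 (16 * (1 + cs s + ks s) * A * (M₂ * √M₁ + M₂ + M₃)) (mul ζ.toL2 (θ.coef p q)) := by
  -- One bound for the `L²` norms (supremum times root of the area), the suprema and the top order
  -- seminorm.
  set N := M₂ * √M₁ + M₂ + M₃ with hN
  have N0 : 0 ≤ N := by positivity
  have q0 : 0 ≤ M₂ * √M₁ := by positivity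
  have hsq : ∀ {M : ℝ}, 0 ≤ M → M ≤ N → ENNReal.ofReal (M ^ 2) ≤ ENNReal.ofReal (N ^ 2) :=
    fun hM h => ENNReal.ofReal_le_ofReal (pow_le_pow_left₀ hM h 2)
  have hm := θ.isOpen.measurableSet
  have comp : ∀ T : Tensor4, |T (idx p q)| ≤ ‖T‖ := fun T => PiLp.norm_apply_le T (idx p q)
  have bd : ∀ {n : ℕ} (_ : n ≤ 2) (α : Fin n → Fin 2),
      ∀ᵐ x ∂volume.restrict θ.Ω, |weakDeriv θ.Ω α θ.C x (idx p q)| ≤ M₂ := fun hn α => by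
    filter_upwards [norm_weakDeriv_le hn hM₂ θ.supC α] with x hx using (comp _).trans hx
  have b0 : ∀ᵐ x ∂volume.restrict θ.Ω, |θ.C x (idx p q)| ≤ M₂ := by
    filter_upwards [bd (Nat.zero_le 2) ![], θ.hasC.weakDeriv_zero_ae_eq θ.isOpen ![]] with x h1 h2
    rwa [← h2]
  have wd : ∀ {n : ℕ} (_ : n ≤ 2) (α : Fin n → Fin 2), IsWeakDeriv θ.Ω α
      (fun x => θ.C x (idx p q)) fun x => weakDeriv θ.Ω α θ.C x (idx p q) := fun hn α =>
    (θ.hasC.isWeakDeriv hn α).clm θ.isOpen (EuclideanSpace.proj (idx p q))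
  have ib : ∀ {f : Plane → ℝ}, (∀ᵐ x ∂volume.restrict θ.Ω, |f x| ≤ M₂) →
      ∫⁻ x in θ.Ω, ENNReal.ofReal (f x ^ 2) ≤ ENNReal.ofReal (N ^ 2) := fun hf =>
    (lintegral_sq_le_of_bound hM₁ hf θ.volume_le).trans (hsq q0 (by linarith))
  obtain ⟨m0, m1, m2, hj⟩ := Jet.of_isWeakDeriv θ.isOpen (fun a => wd (by norm_num) ![a])
    (fun a b => wd le_rfl ![a, b]) N0 (ib b0) (fun a => ib (bd (by norm_num) ![a]))
    fun a b => ib (bd le_rfl ![a, b])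
  refine ⟨m0, fun A ζ hζ hsupp => ?_⟩
  have hM₂N : M₂ ≤ N := by linarith
  refine hj.wg hs hm ((CB.zext hM₂ hm m0 b0).mono hM₂N)
    (fun a => (CB.zext hM₂ hm (m1 a) (bd (by norm_num) ![a])).mono hM₂N)
    (fun a b => (CB.zext hM₂ hm (m2 a b) (bd le_rfl ![a, b])).mono hM₂N) (fun a b => ?_) hζ hsupp
  rw [gag_congr ((ae_restrict_iff' hm).2 (zext_eq_on hm (m2 a b)))]
  refine (gag_le_of_gagliardoSeminorm_le hM₃ θ.gagC ![a, b] fun x y => ?_).trans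
    (hsq hM₃ (by linarith))
  exact comp (weakDeriv θ.Ω ![a, b] θ.C x - weakDeriv θ.Ω ![a, b] θ.C y)

/-- The size of the data. -/
noncomputable def size (σ : ℝ) : ℝ := (sobolevNorm 1 (innerPart θ.Ω (σ / 2)) 2 θ.w).toReal +
  θ.c * (fracSobolevNorm 1 θ.Ω 0 s θ.g).toReal

theorem size_nonneg (σ : ℝ) : 0 ≤ θ.size σ :=
  add_nonneg ENNReal.toReal_nonneg (mul_nonneg θ.c_nonneg ENNReal.toReal_nonneg)

/-- `w` is restricted to the interior part at depth `σ / 2`, since only its norm there may occur in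
the estimate; finiteness is inherited from `Ω`. -/
theorem sol_spec (σ : ℝ) :
    MemLp θ.w 2 (volume.restrict (innerPart θ.Ω (σ / 2))) ∧
    (∀ a b, MemLp (weakDeriv (innerPart θ.Ω (σ / 2)) ![a, b] θ.w) 2
      (volume.restrict (innerPart θ.Ω (σ / 2)))) ∧
    Jet (innerPart θ.Ω (σ / 2)) (θ.size σ) (zext (innerPart θ.Ω (σ / 2)) θ.w)
      (fun a => zext (innerPart θ.Ω (σ / 2)) (weakDeriv (innerPart θ.Ω (σ / 2)) ![a] θ.w))
      fun a b => zext (innerPart θ.Ω (σ / 2)) (weakDeriv (innerPart θ.Ω (σ / 2)) ![a, b] θ.w) := by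
  set V := innerPart θ.Ω (σ / 2) with hV
  have hVo : IsOpen V := isOpen_innerPart θ.isOpen _
  have hsub : V ⊆ θ.Ω := innerPart_subset _ _
  have hw := θ.memW.1.mono hsub
  have hfin : sobolevNorm 1 V 2 θ.w ≤ ENNReal.ofReal (θ.size σ) := by
    rw [← ENNReal.ofReal_toReal ((sobolevNorm_mono hVo hsub θ.memW.1).trans_lt θ.memW.2).ne]
    exact ENNReal.ofReal_le_ofReal
      (le_add_of_nonneg_right (mul_nonneg θ.c_nonneg ENNReal.toReal_nonneg))
  have ib : ∀ {n : ℕ} (_ : n ≤ 2) (α : Fin n → Fin 2),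
      ∫⁻ x in V, ENNReal.ofReal (weakDeriv V α θ.w x ^ 2) ≤ ENNReal.ofReal (θ.size σ ^ 2) :=
    fun hn α => (lintegral_mono fun x => ENNReal.ofReal_le_ofReal (by
      rw [← sq_abs]; exact norm_weakDeriv_sq_le (u := θ.w) α x)).trans
        (lintegral_gradSq_le hn (θ.size_nonneg σ) hfin)
  have i0 : ∫⁻ x in V, ENNReal.ofReal (θ.w x ^ 2) ≤ ENNReal.ofReal (θ.size σ ^ 2) := by
    refine le_trans (le_of_eq (lintegral_congr_ae ?_)) (ib (Nat.zero_le 2) ![])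
    filter_upwards [hw.weakDeriv_zero_ae_eq hVo ![]] with x hx
    rw [hx]
  obtain ⟨m0, -, m2, hj⟩ := Jet.of_isWeakDeriv hVo (fun a => hw.isWeakDeriv (by norm_num) ![a])
    (fun a b => hw.isWeakDeriv le_rfl ![a, b]) (θ.size_nonneg σ) i0 (fun a => ib (by norm_num) ![a])
    fun a b => ib le_rfl ![a, b]
  exact ⟨m0, m2, hj⟩

theorem rhs_spec (hs : s ∈ Set.Ioo (0 : ℝ) 1) (σ : ℝ) :
    MemLp θ.g 2 (volume.restrict θ.Ω) ∧ ∀ (A : ℝ) (ζ : TF), WG NoCond 1 A ζ.toL2 →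
      tsupport ζ ⊆ θ.Ω → HG (FB s) 0 (2 * (1 + 2 * cs s) * A * θ.size σ)
        (mul ζ.toL2 (θ.c • zext θ.Ω θ.g)) := by
  set N := (fracSobolevNorm 1 θ.Ω 0 s θ.g).toReal with hN
  have N0 : 0 ≤ N := ENNReal.toReal_nonneg
  have hm := θ.isOpen.measurableSet
  have hfr : fracSobolevNorm 1 θ.Ω 0 s θ.g = ENNReal.ofReal N := by
    rw [hN, ENNReal.ofReal_toReal θ.memG.2.ne]
  have h1 : sobolevNorm 1 θ.Ω 0 θ.g ≤ ENNReal.ofReal N := by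
    rw [← hfr, fracSobolevNorm]; exact le_self_add
  have h2 : gagliardoSeminorm θ.Ω 0 s θ.g ≤ ENNReal.ofReal N := by
    rw [← hfr, fracSobolevNorm]; simp
  have h0 := θ.memG.1.weakDeriv_zero_ae_eq θ.isOpen ![]
  have i0 : ∫⁻ x in θ.Ω, ENNReal.ofReal (θ.g x ^ 2) ≤ ENNReal.ofReal (N ^ 2) := by
    refine le_trans (lintegral_mono_ae ?_) (lintegral_gradSq_le le_rfl N0 h1)
    filter_upwards [h0] with x hx
    rw [← hx, ← sq_abs]
    exact ENNReal.ofReal_le_ofReal (norm_weakDeriv_sq_le (u := θ.g) ![] x)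
  have hg := memLp_of_lintegral_le (θ.memG.1.isWeakDeriv le_rfl ![]).1.aestronglyMeasurable i0
  refine ⟨hg, fun A ζ hζ hsupp => ?_⟩
  have hn : ‖zext θ.Ω θ.g‖ ≤ N := norm_le_of_lintegral_le N0 ((lintegral_zext hm hg).trans_le i0)
  have hgag : gag θ.Ω s (zext θ.Ω θ.g) ≤ ENNReal.ofReal (N ^ 2) := by
    rw [gag_congr ((ae_restrict_iff' hm).2 (zext_eq_on hm hg)), ← gag_congr h0]
    exact gag_le_of_gagliardoSeminorm_le N0 h2 ![] fun x y => le_rfl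
  have A0 := hζ.nonneg
  have c0 := cs_nonneg s
  have e : HG (FB s) 0 (2 * (1 + 2 * cs s) * A * N) (mul ζ.toL2 (zext θ.Ω θ.g)) := by
    refine ⟨(norm_mul_le hζ.cb _).trans ?_, FB_mul_TF hs hζ hm hsupp hn hgag⟩
    refine (mul_le_mul_of_nonneg_left hn A0).trans ?_
    rw [mul_assoc]
    exact le_mul_of_one_le_left (by positivity) (by linarith)
  rw [map_smul]
  refine (e.smul (isBase_FB hs) θ.c).mono (isBase_FB hs) ?_
  rw [abs_of_nonneg θ.c_nonneg, mul_left_comm]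
  refine mul_le_mul_of_nonneg_left ?_ (by positivity)
  exact le_add_of_nonneg_left ENNReal.toReal_nonneg

/-- The localized coefficients `χ (h³ / 12 C - κ I)`. -/
noncomputable def coefQ (κ : ℝ) (χ : TF) (p q : Pair) : L2 :=
  (h ^ 3 / 12) • mul χ.toL2 (θ.coef p q) + (if p = q then -κ else 0) • χ.toL2

theorem coeFn_coefQ {κ : ℝ} {χ : TF} (p q : Pair)
    (hC : MemLp (fun x => θ.C x (idx p q)) 2 (volume.restrict θ.Ω)) :
    ∀ᵐ x, θ.coefQ κ χ p q x = (h ^ 3 / 12) * (χ x * θ.Ω.indicator (fun x => θ.C x (idx p q)) x) +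
      (if p = q then -κ else 0) * χ x := by
  obtain ⟨A, hA⟩ := exists_CB χ
  filter_upwards [coeFn_zext θ.isOpen.measurableSet hC, coeFn_mul hA (θ.coef p q), χ.coeFn_toL2,
    Lp.coeFn_smul (h ^ 3 / 12) (mul χ.toL2 (θ.coef p q)),
    Lp.coeFn_smul (if p = q then -κ else 0) χ.toL2,
    Lp.coeFn_add ((h ^ 3 / 12) • mul χ.toL2 (θ.coef p q)) ((if p = q then -κ else 0) • χ.toL2)]
    with x h1 h2 h3 h4 h5 h6
  rw [coefQ, h6, Pi.add_apply, h4, h5, Pi.smul_apply, Pi.smul_apply, h2, h3, coef, h1]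
  simp only [smul_eq_mul]

theorem wg_coefQ (hs : s ∈ Set.Ioo (0 : ℝ) 1) {κ A B : ℝ} (hκ : 0 ≤ κ) {χ : TF}
    (hχ : WG NoCond 3 A χ.toL2) {p q : Pair} (hC : WG (FB s) 2 B (mul χ.toL2 (θ.coef p q))) :
    WG (FB s) 2 (|h ^ 3 / 12| * B + κ * (ks s * A)) (θ.coefQ κ χ p q) := by
  have hB := isBase_FB hs
  have k0 := zero_le_one.trans (one_le_ks s)
  have A0 := hχ.nonneg
  refine (hC.smul hB _).add hB (((hχ.hs hs).smul hB _).mono hB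
    (mul_le_mul_of_nonneg_right ?_ (by positivity)))
  split_ifs
  · rw [abs_neg, abs_of_nonneg hκ]
  · simpa using hκ

/-- The constant part supplies exactly `κ`. The remainder is nonnegative pointwise: `χ ≥ 0`, `h³/12
C ≥ κ` on symmetric matrices, and Hessians of test functions are symmetric. -/
theorem coercive_coefQ {κ A : ℝ} (hκ : κ = h ^ 3 / 12 * ξ₀) (hh : 0 ≤ h) {χ : TF}
    (hχ : ∀ x, 0 ≤ χ x) (hA : ∀ p q, CB A (θ.coefQ κ χ p q))
    (hC : ∀ p q, MemLp (fun x => θ.C x (idx p q)) 2 (volume.restrict θ.Ω))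
    (hsupp : tsupport χ ⊆ θ.Ω) (f : TF) : κ * ∑ p, ‖(f.dd p).toL2‖ ^ 2 ≤
      ∑ p, inner ℝ (∑ q, op κ (θ.coefQ κ χ) p q (f.dd q).toL2) (f.dd p).toL2 := by
  have e : ∑ p, inner ℝ (∑ q, op κ (θ.coefQ κ χ) p q (f.dd q).toL2) (f.dd p).toL2 =
      κ * ∑ p, ‖(f.dd p).toL2‖ ^ 2 + ∑ i : Pair × Pair,
        inner ℝ (mul (θ.coefQ κ χ i.1 i.2) (f.dd i.2).toL2) (f.dd i.1).toL2 := by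
    rw [Fintype.sum_prod_type (f := fun i : Pair × Pair =>
      inner ℝ (mul (θ.coefQ κ χ i.1 i.2) (f.dd i.2).toL2) (f.dd i.1).toL2), Finset.mul_sum,
      ← Finset.sum_add_distrib]
    refine Finset.sum_congr rfl fun p _ => ?_
    simp only [op_apply, Finset.sum_add_distrib, ite_smul, zero_smul, Finset.sum_ite_eq,
      Finset.mem_univ, if_true, inner_add_left, real_inner_smul_left, real_inner_self_eq_norm_sq,
      sum_inner]
  rw [e, le_add_iff_nonneg_right, sum_inner_toL2_eq (fun i : Pair × Pair =>
    mul (θ.coefQ κ χ i.1 i.2) (f.dd i.2).toL2) fun i => f.dd i.1]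
  refine integral_nonneg_of_ae ?_
  have h1 : ∀ᵐ x, ∀ i : Pair × Pair, mul (θ.coefQ κ χ i.1 i.2) (f.dd i.2).toL2 x =
      ((h ^ 3 / 12) * (χ x * θ.Ω.indicator (fun x => θ.C x (idx i.1 i.2)) x) +
        (if i.1 = i.2 then -κ else 0) * χ x) * f.dd i.2 x := ae_all_iff.2 fun i => by
    filter_upwards [coeFn_mul (hA i.1 i.2) (f.dd i.2).toL2, (f.dd i.2).coeFn_toL2,
      θ.coeFn_coefQ (κ := κ) (χ := χ) i.1 i.2 (hC i.1 i.2)] with x h1 h2 h3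
    rw [h1, h2, h3]
  filter_upwards [h1, (ae_restrict_iff' θ.isOpen.measurableSet).1 θ.convex] with x h1 h2
  simp only [h1, Pi.zero_apply]
  by_cases hx : x ∈ θ.Ω
  · have hsymm : (hessian f x).IsSymm := by
      ext i j
      rw [Matrix.transpose_apply, hessian_eq, hessian_eq, TF.dd, TF.d, TF.D_comm]
      rfl
    have h3 := mul_nonneg (mul_nonneg (hχ x) (by positivity : 0 ≤ h ^ 3 / 12))
      (sub_nonneg.2 (h2 hx _ hsymm))
    refine h3.trans_eq ?_
    simp only [Set.indicator_of_mem hx, Fintype.sum_prod_type, Fin.sum_univ_two, matDot,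
      Tensor4.app, Matrix.of_apply, hessian_eq, hκ, idx, Prod.mk.injEq]
    norm_num
    ring
  · have : χ x = 0 := image_eq_zero_of_notMem_tsupport fun h => hx (hsupp h)
    simp [this]

/-- Where `χ = 1` the two `κ` terms cancel and the operator is multiplication by `h³/12 C`; outside
`V` the test function vanishes. -/
theorem local_eq {V : Set Plane} (hV : IsOpen V) (hVΩ : V ⊆ θ.Ω) {κ A : ℝ} {χ : TF}
    (hχ : ∀ x ∈ V, χ x = 1) (hA : ∀ p q, CB A (θ.coefQ κ χ p q))
    (hC : ∀ p q, MemLp (fun x => θ.C x (idx p q)) 2 (volume.restrict θ.Ω))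
    (hw : ∀ a b, MemLp (weakDeriv V ![a, b] θ.w) 2 (volume.restrict V))
    (hg : MemLp θ.g 2 (volume.restrict θ.Ω)) (φ : TF) (hφ : tsupport φ ⊆ V) :
    ∑ p, inner ℝ (∑ q, op κ (θ.coefQ κ χ) p q (zext V (weakDeriv V ![q.1, q.2] θ.w)))
      (φ.dd p).toL2 = inner ℝ (θ.c • zext θ.Ω θ.g) φ.toL2 := by
  have hm := θ.isOpen.measurableSet
  have hφΩ := hφ.trans hVΩ
  have e : ∀ p, inner ℝ (∑ q, op κ (θ.coefQ κ χ) p q (zext V (weakDeriv V ![q.1, q.2] θ.w)))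
      (φ.dd p).toL2 = ∑ q, inner ℝ (op κ (θ.coefQ κ χ) p q (zext V (weakDeriv V ![q.1, q.2] θ.w)))
      (φ.dd p).toL2 := fun p => sum_inner _ _ _
  simp only [e]
  rw [← Fintype.sum_prod_type' (f := fun p q => inner ℝ (op κ (θ.coefQ κ χ) p q
      (zext V (weakDeriv V ![q.1, q.2] θ.w))) (φ.dd p).toL2), sum_inner_toL2_eq (fun i : Pair × Pair =>
    op κ (θ.coefQ κ χ) i.1 i.2 (zext V (weakDeriv V ![i.2.1, i.2.2] θ.w))) fun i => φ.dd i.1,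
    real_inner_smul_left, inner_zext_toL2 hm hg]
  have e2 : ∫ x in θ.Ω, φ x * θ.g x = ∫ x in θ.Ω, θ.g x * φ x := by simp only [mul_comm]
  rw [e2, ← θ.eqn φ (φ.isTestFunction hφΩ), ← integral_indicator hm]
  apply integral_congr_ae
  have h1 : ∀ᵐ x, ∀ i : Pair × Pair, x ∈ V →
      op κ (θ.coefQ κ χ) i.1 i.2 (zext V (weakDeriv V ![i.2.1, i.2.2] θ.w)) x =
        (h ^ 3 / 12) * θ.C x (idx i.1 i.2) * weakDeriv θ.Ω ![i.2.1, i.2.2] θ.w x :=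
      ae_all_iff.2 fun i => by
    filter_upwards [coeFn_mul (hA i.1 i.2) (zext V (weakDeriv V ![i.2.1, i.2.2] θ.w)),
      zext_eq_on hV.measurableSet (hw i.2.1 i.2.2), θ.coeFn_coefQ (κ := κ) (χ := χ) i.1 i.2 (hC i.1 i.2),
      (ae_restrict_iff' hV.measurableSet).1
        (weakDeriv_mono_ae hV hVΩ θ.memW.1 le_rfl ![i.2.1, i.2.2]),
      Lp.coeFn_smul (if i.1 = i.2 then κ else 0) (zext V (weakDeriv V ![i.2.1, i.2.2] θ.w)),
      Lp.coeFn_add ((if i.1 = i.2 then κ else 0) • (zext V (weakDeriv V ![i.2.1, i.2.2] θ.w)))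
        (mul (θ.coefQ κ χ i.1 i.2) (zext V (weakDeriv V ![i.2.1, i.2.2] θ.w)))]
      with x h1 h2 h3 h4 h5 h6 hx
    rw [op_apply, h6, Pi.add_apply, h5, Pi.smul_apply, h1, h3, h2 hx, h4 hx, hχ x hx,
      Set.indicator_of_mem (hVΩ hx), smul_eq_mul]
    split_ifs <;> ring
  filter_upwards [h1] with x h1
  by_cases hx : x ∈ V
  · rw [Set.indicator_of_mem (hVΩ hx)]
    simp only [h1 _ hx, Fintype.sum_prod_type, Fin.sum_univ_two, matDot, plateTensor, weakHessian,
      Tensor4.app, Matrix.of_apply, hessian_eq, idx, PiLp.smul_apply, smul_eq_mul]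
    ring
  · have h0 : ∀ p, φ.dd p x = 0 := fun p => image_eq_zero_of_notMem_tsupport fun h' =>
      hx (hφ (TF.tsupport_dd_subset p φ h'))
    have : ∀ A : Matrix (Fin 2) (Fin 2) ℝ, matDot A (hessian φ x) = 0 := fun A => by
      simp [matDot, hessian_eq, h0]
    simp [h0, this, Set.indicator]

end PlateData


/-! ### Interior regularity at unit length scale -/

theorem Jet.DD_ae_eq {V W : Set Plane} (hW : IsOpen W) (hWV : W ⊆ V) {N : ℝ} {u : L2}
    {u1 : Fin 2 → L2} {u2 : Fin 2 → Fin 2 → L2} (hj : Jet V N u u1 u2) {B : ℝ → L2 → Prop} {M : ℝ}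
    {v : L2} (hv : HG B 2 M v) (h : ∀ᵐ x, x ∈ W → v x = u x) (p : Pair) :
    ∀ᵐ x, x ∈ W → DD p v x = u2 p.1 p.2 x :=
  (hj.lwd2 p.1 p.2).ae_eq hW hWV ((hv.D p.1).wd p.2) ((hj.lwd1 p.1).ae_eq hW hWV (hv.wd p.1) h)

theorem op_ae_congr {κ A : ℝ} {Q : Pair → Pair → L2} {p q : Pair} (hQ : CB A (Q p q)) {W : Set Plane}
    {u v : L2} (h : ∀ᵐ x, x ∈ W → u x = v x) :
    ∀ᵐ x, x ∈ W → op κ Q p q u x = op κ Q p q v x := by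
  have e : ∀ u : L2, ∀ᵐ x, op κ Q p q u x = (if p = q then κ else 0) * u x + Q p q x * u x :=
    fun u => by
      filter_upwards [coeFn_mul hQ u, Lp.coeFn_smul (if p = q then κ else 0) u,
        Lp.coeFn_add ((if p = q then κ else 0) • u) (mul (Q p q) u)] with x h1 h2 h3
      rw [op_apply, h3, Pi.add_apply, h1, h2, Pi.smul_apply, smul_eq_mul]
  filter_upwards [e u, e v, h] with x h1 h2 h hx
  rw [h1, h2, h hx]

theorem mul_ae_eq {ζ : TF} {W : Set Plane} (hζ : ∀ x ∈ W, ζ x = 1) {u v : L2}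
    (h : ∀ᵐ x, x ∈ W → u x = v x) : ∀ᵐ x, x ∈ W → mul ζ.toL2 u x = v x := by
  obtain ⟨A, hA⟩ := exists_CB ζ
  filter_upwards [coeFn_mul hA u, ζ.coeFn_toL2, h] with x h1 h2 h hx
  rw [h1, h2, hζ x hx, one_mul, h hx]

theorem PlateData.exists_regular {h M₁ M₂ M₃ ξ₀ s σ : ℝ} (hh : 0 < h) (hM₁ : 0 < M₁) (hM₂ : 0 < M₂)
    (hM₃ : 0 < M₃) (hξ₀ : 0 < ξ₀) (hs : s ∈ Set.Ioo (0 : ℝ) 1) (hσ : 0 < σ) :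
    ∃ K : ℝ, 0 ≤ K ∧ ∀ θ : PlateData h M₁ M₂ M₃ ξ₀ s, ∃ v : L2, HG (FB s) 4 (K * θ.size σ) v ∧
      ∀ᵐ x, x ∈ innerPart θ.Ω σ → v x = θ.w x := by
  -- The family consists of all admissible data, which makes every `UH` constant depend on the
  -- parameters alone.
  let Θ := PlateData h M₁ M₂ M₃ ξ₀ s
  have cut : ∀ {r' r : ℝ}, 0 ≤ r' → r' < r → ∃ A, ∃ ζ : Θ → TF, ∀ θ,
      tsupport (ζ θ) ⊆ innerPart θ.Ω r' ∧ (∀ x ∈ innerPart θ.Ω r, ζ θ x = 1) ∧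
        (∀ x, 0 ≤ ζ θ x ∧ ζ θ x ≤ 1) ∧ WG NoCond 5 A (ζ θ).toL2 := fun hr' hr => by
    obtain ⟨A, hA⟩ := exists_cutoff hM₁.le hr' hr 5
    choose ζ hζ using fun θ : Θ => hA θ.Ω θ.isOpen θ.isBounded θ.volume_le
    exact ⟨A, ζ, hζ⟩
  -- `χ` globalizes the coefficients and `ζ0` the solution; `ζ1`, `ζ2`, `ζ3` serve the three gains
  -- of regularity. Each `ζ` uses up a depth of `σ / 8`.
  obtain ⟨Aχ, χ, hχ⟩ := cut (r' := σ / 4) (r := σ / 2) (by positivity) (by linarith)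
  obtain ⟨A0, ζ0, h0⟩ := cut (r' := σ / 2) (r := 5 * σ / 8) (by positivity) (by linarith)
  obtain ⟨A1, ζ1, h1⟩ := cut (r' := 5 * σ / 8) (r := 6 * σ / 8) (by positivity) (by linarith)
  obtain ⟨A2, ζ2, h2⟩ := cut (r' := 6 * σ / 8) (r := 7 * σ / 8) (by positivity) (by linarith)
  obtain ⟨A3, ζ3, h3⟩ := cut (r' := 7 * σ / 8) (r := σ) (by positivity) (by linarith)
  set κ := h ^ 3 / 12 * ξ₀ with hκ
  have κ0 : 0 < κ := by positivity
  set Q : Θ → Pair → Pair → L2 := fun θ => θ.coefQ κ (χ θ) with hQdef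
  have wgQ : ∀ θ p q, WG (FB s) 2 _ (Q θ p q) := fun θ p q =>
    θ.wg_coefQ hs κ0.le (hχ θ).2.2.2.pred.pred ((θ.coef_spec hM₁.le hM₂.le hM₃.le hs p q).2 Aχ (χ θ)
      (hχ θ).2.2.2.pred.pred ((hχ θ).1.trans (innerPart_subset _ _)))
  have memC : ∀ (θ : Θ) (p q : Pair), _ := fun θ p q => (θ.coef_spec hM₁.le hM₂.le hM₃.le hs p q).1
  have hQ : IsCoefFamily s κ κ Q := ⟨hs, κ0.le, κ0, fun p q => ⟨_, fun θ => wgQ θ p q⟩,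
    fun θ f => θ.coercive_coefQ hκ hh.le (fun x => ((hχ θ).2.2.1 x).1) (fun p q => (wgQ θ p q).cb)
      (memC θ) ((hχ θ).1.trans (innerPart_subset _ _)) f⟩
  set N : Θ → ℝ := fun θ => θ.size σ with hN
  have N0 : ∀ θ, 0 ≤ N θ := fun θ => θ.size_nonneg σ
  set w0 : Θ → L2 := fun θ => zext (innerPart θ.Ω (σ / 2)) θ.w with hw0
  set g0 : Θ → L2 := fun θ => θ.c • zext θ.Ω θ.g with hg0
  have hjet := fun θ : Θ => (θ.sol_spec σ).2.2
  -- The operators are local, so `u` only has to agree with `w` on an interior part containing the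
  -- support of `ζ`.
  have loc : ∀ {r : ℝ} {ζ : Θ → TF} {u : Θ → L2}, σ / 2 ≤ r → (∀ θ, tsupport (ζ θ) ⊆ innerPart θ.Ω r) →
      UH NoCond N 2 u → (∀ θ, ∀ᵐ x, x ∈ innerPart θ.Ω r → u θ x = w0 θ x) → LocalEq κ Q ζ u g0 := by
    intro r ζ u hr hζ ⟨K, _, hK⟩ hu θ f
    have hW := isOpen_innerPart θ.isOpen r
    have hWV : innerPart θ.Ω r ⊆ innerPart θ.Ω (σ / 2) := innerPart_anti _ hr
    have hφ := (TF.tsupport_mul_subset (ζ θ) f).trans (hζ θ)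
    rw [hg0, ← θ.local_eq (isOpen_innerPart θ.isOpen (σ / 2)) (innerPart_subset _ _) (hχ θ).2.1
      (fun p q => (wgQ θ p q).cb) (memC θ) (θ.sol_spec σ).2.1
      (θ.rhs_spec hs σ).1 _ (hφ.trans hWV)]
    refine Finset.sum_congr rfl fun p _ => ?_
    rw [sum_inner, sum_inner]
    refine Finset.sum_congr rfl fun q _ => ?_
    exact inner_congr_on (op_ae_congr (wgQ θ p q).cb ((hjet θ).DD_ae_eq hW hWV (hK θ) (hu θ) q)) _
      ((TF.tsupport_dd_subset p _).trans hφ)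
  have uw : ∀ {A : ℝ} {ζ : Θ → TF} {r r' : ℝ}, (∀ θ, tsupport (ζ θ) ⊆ innerPart θ.Ω r' ∧
      (∀ x ∈ innerPart θ.Ω r, ζ θ x = 1) ∧ (∀ x, 0 ≤ ζ θ x ∧ ζ θ x ≤ 1) ∧
      WG NoCond 5 A (ζ θ).toL2) → UW NoCond 5 fun θ => (ζ θ).toL2 := fun hζ =>
    ⟨_, fun θ => (hζ θ).2.2.2⟩
  have ug : ∀ {A : ℝ} {ζ : Θ → TF} {r r' : ℝ}, (∀ θ, tsupport (ζ θ) ⊆ innerPart θ.Ω r' ∧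
      (∀ x ∈ innerPart θ.Ω r, ζ θ x = 1) ∧ (∀ x, 0 ≤ ζ θ x ∧ ζ θ x ≤ 1) ∧
      WG NoCond 5 A (ζ θ).toL2) → UH (FB s) N 0 fun θ => mul (ζ θ).toL2 (g0 θ) := fun {A ζ r r'} hζ =>
    ⟨2 * (1 + 2 * cs s) * |A|, by have := cs_nonneg s; positivity, fun θ => by
      rw [abs_of_nonneg (hζ θ).2.2.2.nonneg]
      exact (θ.rhs_spec hs σ).2 A (ζ θ) (hζ θ).2.2.2.pred.pred.pred.pred
        ((hζ θ).1.trans (innerPart_subset _ _))⟩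
  set u0 : Θ → L2 := fun θ => mul (ζ0 θ).toL2 (w0 θ) with hu0
  have r0 : UH NoCond N 2 u0 := ⟨2 * |A0| + 2 * |A0|, by positivity, fun θ => by
    have := (hjet θ).hg (h0 θ).2.2.2.pred.pred.pred (h0 θ).1
    rw [abs_of_nonneg (h0 θ).2.2.2.nonneg, add_mul]
    exact this⟩
  have e0 : ∀ θ, ∀ᵐ x, x ∈ innerPart θ.Ω (5 * σ / 8) → u0 θ x = w0 θ x := fun θ =>
    mul_ae_eq (h0 θ).2.1 (ae_of_all _ fun _ _ => rfl)
  set u1 : Θ → L2 := fun θ => mul (ζ1 θ).toL2 (u0 θ) with hu1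
  have r1 : UH NoCond N 3 u1 := UH.stage_one hQ N0 (uw h1) r0 (ug h1).weaken
    (loc (by linarith) (fun θ => (h1 θ).1) r0 e0)
  have e1 : ∀ θ, ∀ᵐ x, x ∈ innerPart θ.Ω (6 * σ / 8) → u1 θ x = w0 θ x := fun θ =>
    mul_ae_eq (h1 θ).2.1 ((e0 θ).mono fun x hx hx' => hx (innerPart_anti _ (by linarith) hx'))
  set u2 : Θ → L2 := fun θ => mul (ζ2 θ).toL2 (u1 θ) with hu2
  have r2 : UH NoCond N 4 u2 := UH.stage_two hQ N0 (uw h2) r1 (ug h2).weaken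
    (loc (by linarith) (fun θ => (h2 θ).1) r1.pred e1)
  have e2 : ∀ θ, ∀ᵐ x, x ∈ innerPart θ.Ω (7 * σ / 8) → u2 θ x = w0 θ x := fun θ =>
    mul_ae_eq (h2 θ).2.1 ((e1 θ).mono fun x hx hx' => hx (innerPart_anti _ (by linarith) hx'))
  obtain ⟨K, K0, hK⟩ := UH.stage_three hQ N0 (uw h3) r2 (ug h3)
    (loc (by linarith) (fun θ => (h3 θ).1) r2.pred.pred e2)
  refine ⟨K, K0, fun θ => ⟨_, hK θ, ?_⟩⟩
  have e3 := mul_ae_eq (h3 θ).2.1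
    ((e2 θ).mono fun x hx hx' => hx (innerPart_anti _ (by linarith) hx'))
  filter_upwards [e3, zext_eq_on (isOpen_innerPart θ.isOpen (σ / 2)).measurableSet
    (θ.sol_spec σ).1] with x h1 h2 hx
  rw [h1 hx, hw0]
  exact h2 (innerPart_anti _ (by linarith) hx)

/-! ### From classes on the plane to Sobolev norms on open sets -/

section Extraction

variable {s M : ℝ} {v : L2} {U : Set Plane} {w : Plane → ℝ}

theorem weakDeriv_ae_eq_Dn {B : ℝ → L2 → Prop} {k n : ℕ} (h : HG B k M v) (hn : n ≤ k)
    (hU : IsOpen U) (hw : ∀ᵐ x, x ∈ U → v x = w x) (α : Fin n → Fin 2) :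
    ∀ᵐ x ∂volume.restrict U, weakDeriv U α w x = Dn α v x :=
  ((HG.of_le hn h).isWeakDeriv hU hw α).weakDeriv_ae_eq hU

theorem norm_Dn_le {B : ℝ → L2 → Prop} {k n : ℕ} (h : HG B k M v) (hn : n ≤ k)
    (α : Fin n → Fin 2) : ‖Dn α v‖ ≤ M :=
  (HG.Dn (k := 0) α (by rw [zero_add]; exact HG.of_le hn h)).norm_le

/-- There are `2 ^ i` derivatives of order `i`, each bounded by `M`; the sum `2 ^ (k + 1) - 1` is
crudely estimated by the square of `2 ^ (k + 1)`. -/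
theorem sobolevNorm_le_of_HG {B : ℝ → L2 → Prop} {k : ℕ} (h : HG B k M v) (hU : IsOpen U)
    (hw : ∀ᵐ x, x ∈ U → v x = w x) :
    sobolevNorm 1 U k w ≤ ENNReal.ofReal (2 ^ (k + 1) * M) := by
  have M0 := h.nonneg
  rw [sobolevNorm_one, rpow_half_le_iff (by positivity)]
  have h1 : ∀ i ∈ Finset.range (k + 1), ∫⁻ x in U, ENNReal.ofReal (gradSq U i w x) ≤
      ENNReal.ofReal (2 ^ i * M ^ 2) := fun i hi => by
    have hik := Nat.lt_succ_iff.1 (Finset.mem_range.1 hi)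
    have e : ∀ᵐ x ∂volume.restrict U, ∀ α : Fin i → Fin 2, weakDeriv U α w x = Dn α v x :=
      ae_all_iff.2 fun α => weakDeriv_ae_eq_Dn h hik hU hw α
    calc ∫⁻ x in U, ENNReal.ofReal (gradSq U i w x)
        = ∫⁻ x in U, ∑ α : Fin i → Fin 2, ENNReal.ofReal (Dn α v x ^ 2) := by
          refine lintegral_congr_ae ?_
          filter_upwards [e] with x hx
          rw [gradSq, ENNReal.ofReal_sum_of_nonneg fun _ _ => sq_nonneg _]
          simp only [hx, Real.norm_eq_abs, sq_abs]
      _ ≤ ∫⁻ x, ∑ α : Fin i → Fin 2, ENNReal.ofReal (Dn α v x ^ 2) := setLIntegral_le_lintegral _ _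
      _ = ∑ α : Fin i → Fin 2, ENNReal.ofReal (‖Dn α v‖ ^ 2) := by
          rw [lintegral_finsetSum]
          · exact Finset.sum_congr rfl fun α _ => lintegral_sq_eq _
          · exact fun α _ => ((Lp.stronglyMeasurable (Dn α v)).measurable.pow_const 2).ennreal_ofReal
      _ ≤ ∑ _α : Fin i → Fin 2, ENNReal.ofReal (M ^ 2) :=
          Finset.sum_le_sum fun α _ => ENNReal.ofReal_le_ofReal
            (pow_le_pow_left₀ (norm_nonneg _) (norm_Dn_le h hik α) 2)
      _ = ENNReal.ofReal (2 ^ i * M ^ 2) := by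
          rw [Finset.sum_const, Finset.card_univ, Fintype.card_fun, Fintype.card_fin,
            Fintype.card_fin, ← ENNReal.ofReal_nsmul, nsmul_eq_mul]
          norm_num
  refine (Finset.sum_le_sum h1).trans ?_
  rw [← ENNReal.ofReal_sum_of_nonneg fun _ _ => by positivity]
  refine ENNReal.ofReal_le_ofReal ?_
  rw [← Finset.sum_mul, mul_pow]
  refine mul_le_mul_of_nonneg_right ?_ (sq_nonneg M)
  have e : ∑ i ∈ Finset.range (k + 1), (2 : ℝ) ^ i = 2 ^ (k + 1) - 1 := by
    rw [geom_sum_eq (by norm_num)]; norm_num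
  rw [e]
  have : (1 : ℝ) ≤ 2 ^ (k + 1) := one_le_pow₀ (by norm_num)
  nlinarith

theorem lintegral_lintegral_sum {ι : Type*} [Fintype ι] (U : Set Plane)
    (F : ι → Plane → Plane → ℝ≥0∞) (hF : ∀ i, Measurable fun p : Plane × Plane => F i p.1 p.2) :
    ∫⁻ y in U, ∫⁻ x in U, ∑ i, F i x y = ∑ i, ∫⁻ y in U, ∫⁻ x in U, F i x y := by
  have h1 : ∀ y, ∫⁻ x in U, ∑ i, F i x y = ∑ i, ∫⁻ x in U, F i x y := fun y =>
    lintegral_finsetSum _ fun i _ => (hF i).comp measurable_prodMk_right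
  simp only [h1]
  exact lintegral_finsetSum _ fun i _ => (hF i).lintegral_prod_left'

theorem gagliardoSeminorm_le_of_HG {k : ℕ} (h : HG (FB s) k M v) (hU : IsOpen U)
    (hw : ∀ᵐ x, x ∈ U → v x = w x) :
    gagliardoSeminorm U k s w ≤ ENNReal.ofReal (2 ^ k * M) := by
  have M0 := h.nonneg
  rw [gagliardoSeminorm, rpow_half_le_iff (by positivity)]
  have e : ∀ᵐ x ∂volume.restrict U, ∀ α : Fin k → Fin 2, weakDeriv U α w x = Dn α v x :=
    ae_all_iff.2 fun α => weakDeriv_ae_eq_Dn h le_rfl hU hw α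
  have hFB : ∀ α : Fin k → Fin 2, gag U s (Dn α v) ≤ ENNReal.ofReal (M ^ 2) := fun α =>
    (gag_mono (Set.subset_univ U) s _).trans
      ((FB_iff M0).1 (HG.Dn (k := 0) α (by rw [zero_add]; exact h)).2)
  have e1 : ∫⁻ y in U, ∫⁻ x in U, ENNReal.ofReal
      ((∑ α : Fin k → Fin 2, ‖weakDeriv U α w x - weakDeriv U α w y‖ ^ 2) / ‖x - y‖ ^ (2 + 2 * s)) =
      ∫⁻ y in U, ∫⁻ x in U, ∑ α : Fin k → Fin 2,
        ENNReal.ofReal ((Dn α v x - Dn α v y) ^ 2 / ‖x - y‖ ^ (2 + 2 * s)) := by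
    refine lintegral_congr_ae ?_
    filter_upwards [e] with y hy
    refine lintegral_congr_ae ?_
    filter_upwards [e] with x hx
    have d0 : 0 ≤ ‖x - y‖ ^ (2 + 2 * s) := by positivity
    rw [Finset.sum_div, ENNReal.ofReal_sum_of_nonneg fun α _ => div_nonneg (sq_nonneg _) d0]
    simp only [hx, hy, Real.norm_eq_abs, sq_abs]
  rw [e1, lintegral_lintegral_sum U (fun (α : Fin k → Fin 2) x y => ENNReal.ofReal
    ((Dn α v x - Dn α v y) ^ 2 / ‖x - y‖ ^ (2 + 2 * s))) fun α => measurable_gag s (Dn α v)]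
  refine (Finset.sum_le_sum fun α _ => hFB α).trans ?_
  rw [Finset.sum_const, Finset.card_univ, Fintype.card_fun, Fintype.card_fin,
    Fintype.card_fin, ← ENNReal.ofReal_nsmul, nsmul_eq_mul]
  refine ENNReal.ofReal_le_ofReal ?_
  push_cast
  rw [mul_pow]
  refine mul_le_mul_of_nonneg_right ?_ (sq_nonneg M)
  have : (1 : ℝ) ≤ 2 ^ k := one_le_pow₀ (by norm_num)
  nlinarith

theorem hasWeakDerivs_of_HG {B : ℝ → L2 → Prop} {k : ℕ} (h : HG B k M v) (hU : IsOpen U)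
    (hw : ∀ᵐ x, x ∈ U → v x = w x) : HasWeakDerivs U k w := fun _ hn α =>
  ⟨_, (HG.of_le hn h).isWeakDeriv hU hw α⟩

end Extraction

/-- Interior regularity for `ρ₀ = 1`. -/
theorem PlateData.regularity {h M₁ M₂ M₃ ξ₀ s σ : ℝ} (hh : 0 < h) (hM₁ : 0 < M₁) (hM₂ : 0 < M₂)
    (hM₃ : 0 < M₃) (hξ₀ : 0 < ξ₀) (hs : s ∈ Set.Ioo (0 : ℝ) 1) (hσ : 0 < σ) :
    ∃ K : ℝ, 0 < K ∧ ∀ θ : PlateData h M₁ M₂ M₃ ξ₀ s, HasWeakDerivs (innerPart θ.Ω σ) 4 θ.w ∧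
      fracSobolevNorm 1 (innerPart θ.Ω σ) 4 s θ.w ≤ ENNReal.ofReal K *
        (sobolevNorm 1 (innerPart θ.Ω (σ / 2)) 2 θ.w +
          ENNReal.ofReal θ.c * fracSobolevNorm 1 θ.Ω 0 s θ.g) := by
  obtain ⟨K, K0, hK⟩ := PlateData.exists_regular hh hM₁ hM₂ hM₃ hξ₀ hs hσ
  -- `48` is `2 ^ 5 + 2 ^ 4`, from the Sobolev norm and the seminorm; the added `1` ensures
  -- positivity even if `K = 0`.
  refine ⟨48 * K + 1, by positivity, fun θ => ?_⟩
  obtain ⟨v, hv, hw⟩ := hK θ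
  have hU := isOpen_innerPart θ.isOpen σ
  refine ⟨hasWeakDerivs_of_HG hv hU hw, ?_⟩
  have h1 := sobolevNorm_le_of_HG hv hU hw
  have h2 := gagliardoSeminorm_le_of_HG hv hU hw
  have hsz : ENNReal.ofReal (θ.size σ) ≤ sobolevNorm 1 (innerPart θ.Ω (σ / 2)) 2 θ.w +
      ENNReal.ofReal θ.c * fracSobolevNorm 1 θ.Ω 0 s θ.g := by
    rw [PlateData.size, ENNReal.ofReal_add ENNReal.toReal_nonneg
      (mul_nonneg θ.c_nonneg ENNReal.toReal_nonneg), ENNReal.ofReal_mul θ.c_nonneg]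
    gcongr <;> exact ENNReal.ofReal_toReal_le
  have h0 := θ.size_nonneg σ
  calc fracSobolevNorm 1 (innerPart θ.Ω σ) 4 s θ.w
      = sobolevNorm 1 (innerPart θ.Ω σ) 4 θ.w + gagliardoSeminorm (innerPart θ.Ω σ) 4 s θ.w := by
        simp [fracSobolevNorm]
    _ ≤ ENNReal.ofReal (2 ^ (4 + 1) * (K * θ.size σ)) + ENNReal.ofReal (2 ^ 4 * (K * θ.size σ)) :=
        add_le_add h1 h2
    _ = ENNReal.ofReal (48 * K * θ.size σ) := by
        rw [← ENNReal.ofReal_add (by positivity) (by positivity)]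
        congr 1; ring
    _ ≤ ENNReal.ofReal ((48 * K + 1) * θ.size σ) :=
        ENNReal.ofReal_le_ofReal (mul_le_mul_of_nonneg_right (by linarith) h0)
    _ ≤ _ := by
        rw [ENNReal.ofReal_mul (by positivity)]
        gcongr


/-! ### Dilations -/

/-- The preimage of a set under `x ↦ ρ x`. -/
abbrev dil (ρ : ℝ) (U : Set Plane) : Set Plane := (fun x : Plane => ρ • x) ⁻¹' U

section Dilation

variable {ρ : ℝ}

theorem measurableEmbedding_smul (hρ : 0 < ρ) : MeasurableEmbedding fun x : Plane => ρ • x :=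
  (Homeomorph.smulOfNeZero ρ hρ.ne').measurableEmbedding

theorem map_restrict_dil (hρ : 0 < ρ) (U : Set Plane) :
    (volume.restrict (dil ρ U)).map (fun x : Plane => ρ • x) =
      ENNReal.ofReal (ρ ^ 2)⁻¹ • (volume : Measure Plane).restrict U := by
  rw [← (measurableEmbedding_smul hρ).restrict_map, Measure.map_addHaar_smul _ hρ.ne',
    Measure.restrict_smul, finrank_euclideanSpace_fin, abs_of_pos (by positivity)]

theorem lintegral_dil (hρ : 0 < ρ) (U : Set Plane) (f : Plane → ℝ≥0∞) :
    ∫⁻ x in dil ρ U, f (ρ • x) = ENNReal.ofReal (ρ ^ 2)⁻¹ * ∫⁻ x in U, f x := by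
  rw [← (measurableEmbedding_smul hρ).lintegral_map, map_restrict_dil hρ, lintegral_smul_measure,
    smul_eq_mul]

theorem integral_dil {F : Type*} [NormedAddCommGroup F] [NormedSpace ℝ F] (hρ : 0 < ρ)
    (U : Set Plane) (f : Plane → F) :
    ∫ x in dil ρ U, f (ρ • x) = (ρ ^ 2)⁻¹ • ∫ x in U, f x := by
  rw [← (measurableEmbedding_smul hρ).integral_map, map_restrict_dil hρ, integral_smul_measure,
    ENNReal.toReal_ofReal (by positivity)]

theorem ae_dil (hρ : 0 < ρ) {U : Set Plane} {p : Plane → Prop} (h : ∀ᵐ x ∂volume.restrict U, p x) :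
    ∀ᵐ x ∂volume.restrict (dil ρ U), p (ρ • x) := by
  rw [← (measurableEmbedding_smul hρ).ae_map_iff, map_restrict_dil hρ]
  exact Measure.ae_smul_measure h _

theorem essSup_dil (hρ : 0 < ρ) (U : Set Plane) (f : Plane → ℝ≥0∞) :
    essSup (fun x => f (ρ • x)) (volume.restrict (dil ρ U)) = essSup f (volume.restrict U) := by
  have := (measurableEmbedding_smul hρ).essSup_map_measure (g := f)
    (μ := volume.restrict (dil ρ U))
  rw [map_restrict_dil hρ, essSup_ennreal_smul_measure (ENNReal.ofReal_pos.2 (by positivity)).ne'] at this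
  exact this.symm

theorem volume_dil (hρ : 0 < ρ) (U : Set Plane) :
    volume (dil ρ U) = ENNReal.ofReal (ρ ^ 2)⁻¹ * volume U := by
  simpa using lintegral_dil hρ U fun _ => 1

theorem isOpen_dil (ρ : ℝ) {U : Set Plane} (hU : IsOpen U) : IsOpen (dil ρ U) :=
  hU.preimage (continuous_const_smul ρ)

theorem dil_dil_inv (hρ : ρ ≠ 0) (U : Set Plane) : dil ρ⁻¹ (dil ρ U) = U := by
  ext x
  simp [dil, smul_smul, mul_inv_cancel₀ hρ]

open scoped Pointwise in
theorem isBounded_dil (hρ : 0 < ρ) {U : Set Plane} (hU : Bornology.IsBounded U) :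
    Bornology.IsBounded (dil ρ U) := by
  rw [dil, Set.preimage_smul₀ hρ.ne']
  exact hU.smul₀ _

open scoped Pointwise in
theorem innerPart_dil (hρ : 0 < ρ) (U : Set Plane) (r : ℝ) :
    innerPart (dil ρ U) r = dil ρ (innerPart U (r * ρ)) := by
  ext x
  have e : frontier U = ρ • frontier (dil ρ U) := by
    have := (Homeomorph.smulOfNeZero (α := Plane) ρ hρ.ne').preimage_frontier U
    change dil ρ (frontier U) = frontier (dil ρ U) at this
    rw [← this, dil, Set.preimage_smul₀ hρ.ne', smul_inv_smul₀ hρ.ne']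
  have : Metric.infDist (ρ • x) (frontier U) = ρ * Metric.infDist x (frontier (dil ρ U)) := by
    rw [e, infDist_smul₀ hρ.ne', Real.norm_of_nonneg hρ.le]
  simp only [innerPart, Set.mem_ofPred_eq, Set.mem_preimage, this, mul_comm r ρ,
    mul_lt_mul_iff_right₀ hρ]

theorem locallyIntegrableOn_dil {F : Type*} [NormedAddCommGroup F] (hρ : 0 < ρ) {U : Set Plane} (hU : IsOpen U) {u : Plane → F}
    (hu : LocallyIntegrableOn u U) : LocallyIntegrableOn (fun x => u (ρ • x)) (dil ρ U) := by
  rw [locallyIntegrableOn_iff (isOpen_dil ρ hU).isLocallyClosed]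
  rw [locallyIntegrableOn_iff hU.isLocallyClosed] at hu
  intro K hK hKc
  have h1 := hu ((fun x : Plane => ρ • x) '' K) (Set.image_subset_iff.2 hK)
    (hKc.image (continuous_const_smul ρ))
  have h2 : dil ρ ((fun x : Plane => ρ • x) '' K) = K :=
    Set.preimage_image_eq _ (smul_right_injective Plane hρ.ne')
  have h3 : Integrable u ((volume.restrict (dil ρ ((fun x : Plane => ρ • x) '' K))).map
      fun x : Plane => ρ • x) := by
    rw [map_restrict_dil hρ]
    exact h1.smul_measure ENNReal.ofReal_ne_top
  rw [h2, (measurableEmbedding_smul hρ).integrable_map_iff] at h3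
  exact h3

variable {F : Type*} [NormedAddCommGroup F] [NormedSpace ℝ F]

theorem partialDeriv_comp_smul {n : ℕ} (α : Fin n → Fin 2) {φ : Plane → ℝ} (hφ : ContDiff ℝ ∞ φ)
    (x : Plane) : partialDeriv α (fun x => φ (ρ • x)) x = ρ ^ n * partialDeriv α φ (ρ • x) := by
  rw [partialDeriv, iteratedFDeriv_comp_const_smul ρ (hφ.of_le (by exact_mod_cast le_top))]
  rfl

theorem IsTestFunction.comp_smul (hρ : ρ ≠ 0) {U : Set Plane} {φ : Plane → ℝ}
    (h : IsTestFunction U φ) : IsTestFunction (dil ρ U) fun x => φ (ρ • x) := by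
  refine ⟨h.1.comp (contDiff_const_smul ρ),
    h.2.1.comp_homeomorph (Homeomorph.smulOfNeZero ρ hρ), ?_⟩
  refine (tsupport_comp_subset_preimage φ (continuous_const_smul ρ)).trans ?_
  exact Set.preimage_mono h.2.2

theorem IsTestFunction.exists_comp_smul (hρ : ρ ≠ 0) {U : Set Plane} {φ : Plane → ℝ}
    (h : IsTestFunction (dil ρ U) φ) : ∃ ψ, IsTestFunction U ψ ∧ φ = fun x => ψ (ρ • x) := by
  refine ⟨fun x => φ (ρ⁻¹ • x), ?_, ?_⟩
  · have := h.comp_smul (inv_ne_zero hρ)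
    rwa [dil_dil_inv hρ] at this
  · ext x
    change φ x = φ (ρ⁻¹ • ρ • x)
    rw [smul_smul, inv_mul_cancel₀ hρ, one_smul]

theorem IsWeakDeriv.dil (hρ : 0 < ρ) {U : Set Plane} (hU : IsOpen U) {n : ℕ} {α : Fin n → Fin 2}
    {u v : Plane → F} (h : IsWeakDeriv U α u v) :
    IsWeakDeriv (dil ρ U) α (fun x => u (ρ • x)) fun x => ρ ^ n • v (ρ • x) := by
  have hv := locallyIntegrableOn_dil hρ hU h.2.1
  refine ⟨locallyIntegrableOn_dil hρ hU h.1, hv.smul (ρ ^ n), fun φ hφ => ?_⟩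
  obtain ⟨ψ, hψ, rfl⟩ := hφ.exists_comp_smul hρ.ne'
  have e1 : ∀ x : Plane, partialDeriv α (fun x => ψ (ρ • x)) x • u (ρ • x) =
      ρ ^ n • (fun y => partialDeriv α ψ y • u y) (ρ • x) := fun x => by
    rw [partialDeriv_comp_smul α hψ.1, mul_smul]
  have e2 : ∀ x : Plane, ψ (ρ • x) • ρ ^ n • v (ρ • x) =
      ρ ^ n • (fun y => ψ y • v y) (ρ • x) := fun x => smul_comm _ _ _
  rw [integral_congr_ae (.of_forall e1), integral_congr_ae (.of_forall e2), integral_smul,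
    integral_smul, integral_dil hρ U fun y => partialDeriv α ψ y • u y,
    integral_dil hρ U fun y => ψ y • v y, h.2.2 ψ hψ]
  rw [smul_comm ((ρ ^ 2)⁻¹) ((-1 : ℝ) ^ n), smul_comm (ρ ^ n) ((-1 : ℝ) ^ n)]

theorem HasWeakDerivs.dil (hρ : 0 < ρ) {U : Set Plane} (hU : IsOpen U) {k : ℕ} {u : Plane → F}
    (h : HasWeakDerivs U k u) : HasWeakDerivs (dil ρ U) k fun x => u (ρ • x) := fun n hn α =>
  let ⟨_, hv⟩ := h n hn α
  ⟨_, hv.dil hρ hU⟩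

theorem HasWeakDerivs.of_dil (hρ : 0 < ρ) {U : Set Plane} (hU : IsOpen U) {k : ℕ} {u : Plane → F}
    (h : HasWeakDerivs (KirchhoffPlate.dil ρ U) k fun x => u (ρ • x)) : HasWeakDerivs U k u := by
  have := h.dil (inv_pos.2 hρ) (isOpen_dil ρ hU)
  simpa only [dil_dil_inv hρ.ne', smul_smul, mul_inv_cancel₀ hρ.ne', one_smul] using this

variable [CompleteSpace F]

theorem weakDeriv_dil (hρ : 0 < ρ) {U : Set Plane} (hU : IsOpen U) {k n : ℕ} {u : Plane → F}
    (h : HasWeakDerivs U k u) (hn : n ≤ k) (α : Fin n → Fin 2) :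
    ∀ᵐ x ∂volume.restrict (dil ρ U), weakDeriv (dil ρ U) α (fun x => u (ρ • x)) x =
      ρ ^ n • weakDeriv U α u (ρ • x) :=
  ((h.isWeakDeriv hn α).dil hρ hU).weakDeriv_ae_eq (isOpen_dil ρ hU)

theorem gradSq_dil (hρ : 0 < ρ) {U : Set Plane} (hU : IsOpen U) {k n : ℕ} {u : Plane → F}
    (h : HasWeakDerivs U k u) (hn : n ≤ k) :
    ∀ᵐ x ∂volume.restrict (dil ρ U), gradSq (dil ρ U) n (fun x => u (ρ • x)) x =
      ρ ^ (2 * n) * gradSq U n u (ρ • x) := by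
  have := ae_all_iff.2 fun α : Fin n → Fin 2 => weakDeriv_dil hρ hU h hn α
  filter_upwards [this] with x hx
  simp only [gradSq, hx, norm_smul, norm_pow, Real.norm_of_nonneg hρ.le, mul_pow, ← pow_mul,
    ← Finset.mul_sum, mul_comm n 2]

/-- Derivatives of order `i` gain `ρ ^ i`, and the Jacobian `ρ⁻²` becomes the prefactor `ρ⁻¹` under
the root. -/
theorem sobolevNorm_dil (hρ : 0 < ρ) {U : Set Plane} (hU : IsOpen U) {k : ℕ} {u : Plane → F}
    (h : HasWeakDerivs U k u) :
    sobolevNorm 1 (dil ρ U) k (fun x => u (ρ • x)) = sobolevNorm ρ U k u := by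
  rw [sobolevNorm_one, sobolevNorm]
  have e : ∀ i ∈ Finset.range (k + 1), ∫⁻ x in dil ρ U,
      ENNReal.ofReal (gradSq (dil ρ U) i (fun x => u (ρ • x)) x) =
      ENNReal.ofReal (ρ ^ 2)⁻¹ * (ENNReal.ofReal (ρ ^ (2 * i)) *
        ∫⁻ x in U, ENNReal.ofReal (gradSq U i u x)) := fun i hi => by
    rw [← lintegral_const_mul' _ _ ENNReal.ofReal_ne_top, ← lintegral_dil hρ]
    refine lintegral_congr_ae ?_
    filter_upwards [gradSq_dil hρ hU h (Nat.lt_succ_iff.1 (Finset.mem_range.1 hi))] with x hx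
    rw [hx, ENNReal.ofReal_mul (by positivity)]
  rw [Finset.sum_congr rfl e, ← Finset.mul_sum, ENNReal.mul_rpow_of_nonneg _ _ (by norm_num),
    ENNReal.ofReal_rpow_of_nonneg (by positivity) (by norm_num), ← Real.sqrt_eq_rpow, ← inv_pow,
    Real.sqrt_sq (by positivity)]

theorem supSobolevNorm_dil (hρ : 0 < ρ) {U : Set Plane} (hU : IsOpen U) {k : ℕ} {u : Plane → F}
    (h : HasWeakDerivs U k u) :
    supSobolevNorm 1 (dil ρ U) k (fun x => u (ρ • x)) = supSobolevNorm ρ U k u := by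
  refine Finset.sum_congr rfl fun i hi => ?_
  rw [one_pow, ENNReal.ofReal_one, one_mul, ← ENNReal.essSup_const_mul,
    ← essSup_dil hρ U fun x => ENNReal.ofReal (ρ ^ i) * ENNReal.ofReal √(gradSq U i u x)]
  refine essSup_congr_ae ?_
  filter_upwards [gradSq_dil hρ hU h (Nat.lt_succ_iff.1 (Finset.mem_range.1 hi))] with x hx
  rw [hx, mul_comm 2 i, pow_mul, Real.sqrt_mul (by positivity), Real.sqrt_sq (by positivity),
    ENNReal.ofReal_mul (by positivity)]

/-- Under the root the two Jacobians give `ρ ^ (-4)`, the derivatives `ρ ^ (2k)` and the kernel `ρ ^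
(2 + 2s)`, in all `ρ ^ (2 (k + s - 1))`. -/
theorem gagliardoSeminorm_dil (hρ : 0 < ρ) {U : Set Plane} (hU : IsOpen U) {k : ℕ} {s : ℝ}
    {u : Plane → F} (h : HasWeakDerivs U k u) :
    gagliardoSeminorm (dil ρ U) k s (fun x => u (ρ • x)) =
      ENNReal.ofReal (ρ ^ ((k : ℝ) + s - 1)) * gagliardoSeminorm U k s u := by
  have hae := ae_all_iff.2 fun α : Fin k → Fin 2 => weakDeriv_dil hρ hU h le_rfl α
  set m := ENNReal.ofReal (ρ ^ (2 * k) * ρ ^ (2 + 2 * s)) with hm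
  set c := ENNReal.ofReal (ρ ^ 2)⁻¹ with hc
  have e : ∫⁻ y in dil ρ U, ∫⁻ x in dil ρ U, ENNReal.ofReal
      ((∑ α : Fin k → Fin 2, ‖weakDeriv (dil ρ U) α (fun x => u (ρ • x)) x -
        weakDeriv (dil ρ U) α (fun x => u (ρ • x)) y‖ ^ 2) / ‖x - y‖ ^ (2 + 2 * s)) =
      c * (c * (m * ∫⁻ y in U, ∫⁻ x in U, ENNReal.ofReal
      ((∑ α : Fin k → Fin 2, ‖weakDeriv U α u x - weakDeriv U α u y‖ ^ 2) /
        ‖x - y‖ ^ (2 + 2 * s)))) := by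
    rw [← lintegral_const_mul' _ _ ENNReal.ofReal_ne_top, ← lintegral_const_mul' _ _
      ENNReal.ofReal_ne_top, ← lintegral_dil hρ]
    refine lintegral_congr_ae ?_
    filter_upwards [hae] with y hy
    rw [← lintegral_const_mul' _ _ ENNReal.ofReal_ne_top, ← lintegral_dil hρ]
    refine lintegral_congr_ae ?_
    filter_upwards [hae] with x hx
    rw [← ENNReal.ofReal_mul (by positivity)]
    congr 1
    simp only [hx, hy, ← smul_sub, norm_smul, norm_pow, Real.norm_of_nonneg hρ.le, mul_pow,
      ← pow_mul, ← Finset.mul_sum, mul_comm k 2]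
    rw [Real.mul_rpow hρ.le (norm_nonneg _)]
    have : ρ ^ (2 + 2 * s) ≠ 0 := (Real.rpow_pos_of_pos hρ _).ne'
    field_simp
  rw [gagliardoSeminorm, e, gagliardoSeminorm, ← mul_assoc, ← mul_assoc,
    ENNReal.mul_rpow_of_nonneg _ _ (by norm_num)]
  congr 1
  rw [hc, hm, ← ENNReal.ofReal_mul (by positivity), ← ENNReal.ofReal_mul (by positivity),
    ENNReal.ofReal_rpow_of_nonneg (by positivity) (by norm_num)]
  congr 1
  have e2 : (ρ ^ 2)⁻¹ * (ρ ^ 2)⁻¹ * (ρ ^ (2 * k) * ρ ^ (2 + 2 * s)) =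
      ρ ^ (2 * ((k : ℝ) + s - 1)) := by
    rw [← Real.rpow_natCast ρ (2 * k), ← Real.rpow_natCast ρ 2, ← Real.rpow_neg hρ.le,
      ← Real.rpow_add hρ, ← Real.rpow_add hρ, ← Real.rpow_add hρ]
    congr 1
    push_cast
    ring
  rw [e2, ← Real.rpow_mul hρ.le]
  congr 1
  ring

theorem fracSobolevNorm_dil (hρ : 0 < ρ) {U : Set Plane} (hU : IsOpen U) {k : ℕ} {s : ℝ}
    {u : Plane → F} (h : HasWeakDerivs U k u) :
    fracSobolevNorm 1 (dil ρ U) k s (fun x => u (ρ • x)) = fracSobolevNorm ρ U k s u := by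
  rw [fracSobolevNorm, sobolevNorm_dil hρ hU h, gagliardoSeminorm_dil hρ hU h, fracSobolevNorm]
  simp

end Dilation

/-! ### Finiteness of the norms does not depend on the length scale -/

section Finiteness

variable {F : Type*} [NormedAddCommGroup F] [NormedSpace ℝ F] {U : Set Plane} {k : ℕ} {s ρ ρ' : ℝ}
  {u : Plane → F}

theorem sobolevNorm_lt_top (hρ : 0 < ρ) (h : sobolevNorm ρ U k u < ⊤) : sobolevNorm ρ' U k u < ⊤ := by
  have h1 : ∑ i ∈ Finset.range (k + 1), ENNReal.ofReal (ρ ^ (2 * i)) *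
      ∫⁻ x in U, ENNReal.ofReal (gradSq U i u x) < ⊤ := by
    by_contra hcon
    rw [not_lt_top_iff] at hcon
    rw [sobolevNorm, hcon, ENNReal.top_rpow_of_pos (by norm_num), ENNReal.mul_top (by simpa using hρ)] at h
    exact lt_irrefl _ h
  refine ENNReal.mul_lt_top ENNReal.ofReal_lt_top (ENNReal.rpow_lt_top_of_nonneg (by norm_num) ?_)
  refine (ENNReal.sum_lt_top.2 fun i hi => ENNReal.mul_lt_top ENNReal.ofReal_lt_top ?_).ne
  have h2 := ENNReal.sum_lt_top.1 h1 i hi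
  by_contra hcon
  rw [not_lt_top_iff] at hcon
  rw [hcon, ENNReal.mul_top (by simp; positivity)] at h2
  exact lt_irrefl _ h2

theorem fracSobolevNorm_lt_top (hρ : 0 < ρ) (h : fracSobolevNorm ρ U k s u < ⊤) :
    fracSobolevNorm ρ' U k s u < ⊤ := by
  rw [fracSobolevNorm, ENNReal.add_lt_top] at h ⊢
  refine ⟨sobolevNorm_lt_top hρ h.1, ENNReal.mul_lt_top ENNReal.ofReal_lt_top ?_⟩
  have h2 := h.2
  by_contra hcon
  rw [not_lt_top_iff] at hcon
  have : 0 < ρ ^ ((k : ℝ) + s - 1) := Real.rpow_pos_of_pos hρ _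
  rw [hcon, ENNReal.mul_top (by simpa using this)] at h2
  exact lt_irrefl _ h2

end Finiteness

/-! ### The plate equation under dilations -/

theorem hessian_comp_smul {φ : Plane → ℝ} (hφ : ContDiff ℝ ∞ φ) (ρ : ℝ) (x : Plane) :
    hessian (fun x => φ (ρ • x)) x = ρ ^ 2 • hessian φ (ρ • x) := by
  ext i j
  exact partialDeriv_comp_smul ![i, j] hφ x

theorem matDot_smul_smul (L : Tensor4) (a b : ℝ) (A B : Matrix (Fin 2) (Fin 2) ℝ) :
    matDot (L.app (a • A)) (b • B) = a * b * matDot (L.app A) B := by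
  simp only [matDot, Tensor4.app, Matrix.of_apply, Matrix.smul_apply, smul_eq_mul, Fin.sum_univ_two]
  ring

/-- Each of the two Hessians contributes `ρ ^ 2`, while the Jacobian is the same on both sides. -/
theorem IsWeakPlateSolution.dil {h ρ : ℝ} (hρ : 0 < ρ) {U : Set Plane} (hU : IsOpen U)
    {C : Plane → Tensor4} {g w : Plane → ℝ} (hw : HasWeakDerivs U 2 w)
    (hs : IsWeakPlateSolution U (plateTensor h C) g w) {φ : Plane → ℝ}
    (hφ : IsTestFunction (dil ρ U) φ) :
    ∫ x in KirchhoffPlate.dil ρ U, matDot ((plateTensor h (fun x => C (ρ • x)) x).app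
      (weakHessian (KirchhoffPlate.dil ρ U) (fun x => w (ρ • x)) x)) (hessian φ x) =
      ρ ^ 4 * ∫ x in KirchhoffPlate.dil ρ U, g (ρ • x) * φ x := by
  obtain ⟨ψ, hψ, rfl⟩ := hφ.exists_comp_smul hρ.ne'
  have h1 : ∀ᵐ x ∂volume.restrict (KirchhoffPlate.dil ρ U), ∀ i j,
      weakDeriv (KirchhoffPlate.dil ρ U) ![i, j] (fun x => w (ρ • x)) x =
        ρ ^ 2 • weakDeriv U ![i, j] w (ρ • x) :=
    ae_all_iff.2 fun i => ae_all_iff.2 fun j => weakDeriv_dil hρ hU hw le_rfl ![i, j]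
  have h2 : ∫ x in KirchhoffPlate.dil ρ U, matDot ((plateTensor h (fun x => C (ρ • x)) x).app
      (weakHessian (KirchhoffPlate.dil ρ U) (fun x => w (ρ • x)) x))
        (hessian (fun x => ψ (ρ • x)) x) =
      ∫ x in KirchhoffPlate.dil ρ U, ρ ^ 4 * (fun y => matDot ((plateTensor h C y).app
        (weakHessian U w y)) (hessian ψ y)) (ρ • x) := by
    refine integral_congr_ae ?_
    filter_upwards [h1] with x hx
    have e : weakHessian (KirchhoffPlate.dil ρ U) (fun x => w (ρ • x)) x =
        ρ ^ 2 • weakHessian U w (ρ • x) := by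
      ext i j
      exact hx i j
    rw [e, hessian_comp_smul hψ.1, matDot_smul_smul, plateTensor, plateTensor]
    ring
  rw [h2, integral_const_mul, integral_dil hρ U fun y => matDot ((plateTensor h C y).app
    (weakHessian U w y)) (hessian ψ y), hs ψ hψ, integral_dil hρ U fun y => g y * ψ y]

end KirchhoffPlate


/-! ### The theorem at arbitrary length scale -/

/-- Interior `H^{4+s}` regularity for the plate equation `div (div (ℙ ∇²w)) = g`. -/
theorem mainTheorem3
    (h M₀ M₁ M₂ M₃ ξ₀ s σ : ℝ) (hh : 0 < h) (hM₀ : 0 < M₀) (hM₁ : 0 < M₁) (hM₂ : 0 < M₂)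
    (hM₃ : 0 < M₃) (hξ₀ : 0 < ξ₀) (hs : s ∈ Set.Ioo (0 : ℝ) 1) (hσ : 0 < σ) :
    ∃ K : ℝ, 0 < K ∧
      ∀ (ρ₀ ξ₁ : ℝ) (Ω : Set Plane) (C : Plane → Tensor4) (g w : Plane → ℝ),
        0 < ρ₀ → 0 < ξ₁ →
        IsOpen Ω → IsConnected Ω → Bornology.IsBounded Ω →
        IsLipschitzBoundary Ω ρ₀ M₀ →
        volume Ω ≤ ENNReal.ofReal (M₁ * ρ₀ ^ 2) →
        (∀ᵐ x ∂(volume.restrict Ω), (C x).IsSymm ∧ (C x).IsStronglyConvex ξ₀ ξ₁) →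
        MemSupSobolev Ω 2 C → supSobolevNorm ρ₀ Ω 2 C ≤ ENNReal.ofReal M₂ →
        MemFracSobolev Ω 2 s C → fracSobolevNorm ρ₀ Ω 2 s C ≤ ENNReal.ofReal M₃ →
        MemFracSobolev Ω 0 s g →
        MemSobolev Ω 2 w →
        IsWeakPlateSolution Ω (plateTensor h C) g w →
        MemFracSobolev (innerPart Ω (σ * ρ₀)) 4 s w ∧
        fracSobolevNorm ρ₀ (innerPart Ω (σ * ρ₀)) 4 s w ≤
          ENNReal.ofReal K * (sobolevNorm ρ₀ (innerPart Ω (σ / 2 * ρ₀)) 2 w +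
            ENNReal.ofReal (ρ₀ ^ 4) * fracSobolevNorm ρ₀ Ω 0 s g) := by
  obtain ⟨K, K0, hK⟩ := PlateData.regularity (M₁ := M₁) (M₂ := M₂) (M₃ := M₃) hh hM₁ hM₂ hM₃ hξ₀ hs hσ
  refine ⟨K, K0, fun ρ ξ₁ Ω C g w hρ _ hΩ _ hb _ hv hC hCs hCs' hCf hCf' hg hw heq => ?_⟩
  have hgd := hg.1.dil hρ hΩ
  have hwd := hw.1.dil hρ hΩ
  -- The dilated data satisfy the unit scale hypotheses with the same constants; the factor `ρ ^ 4`
  -- is kept apart from `g` so that the norm of `g` scales invariantly.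
  let θ : PlateData h M₁ M₂ M₃ ξ₀ s :=
    { Ω := dil ρ Ω
      C := fun x => C (ρ • x)
      g := fun x => g (ρ • x)
      w := fun x => w (ρ • x)
      c := ρ ^ 4
      c_nonneg := by positivity
      isOpen := isOpen_dil ρ hΩ
      isBounded := isBounded_dil hρ hb
      volume_le := by
        rw [volume_dil hρ]
        refine (mul_le_mul_right hv _).trans ?_
        rw [← ENNReal.ofReal_mul (by positivity)]
        refine ENNReal.ofReal_le_ofReal (le_of_eq ?_)
        field_simp
      convex := ae_dil hρ (hC.mono fun x hx A hA => (hx.2 A hA).1)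
      hasC := hCs.1.dil hρ hΩ
      supC := (supSobolevNorm_dil hρ hΩ hCs.1).trans_le hCs'
      gagC := by
        refine le_trans ?_ ((fracSobolevNorm_dil hρ hΩ hCf.1).trans_le hCf')
        simp [fracSobolevNorm]
      memG := ⟨hgd, (fracSobolevNorm_dil hρ hΩ hg.1).trans_lt (fracSobolevNorm_lt_top one_pos hg.2)⟩
      memW := ⟨hwd, (sobolevNorm_dil hρ hΩ hw.1).trans_lt (sobolevNorm_lt_top one_pos hw.2)⟩
      eqn := fun φ hφ => IsWeakPlateSolution.dil hρ hΩ hw.1 heq hφ }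
  obtain ⟨h1, h2⟩ := hK θ
  have hU := isOpen_innerPart hΩ (σ * ρ)
  have hV := isOpen_innerPart hΩ (σ / 2 * ρ)
  change HasWeakDerivs (innerPart (dil ρ Ω) σ) 4 (fun x => w (ρ • x)) at h1
  change fracSobolevNorm 1 (innerPart (dil ρ Ω) σ) 4 s (fun x => w (ρ • x)) ≤
    ENNReal.ofReal K * (sobolevNorm 1 (innerPart (dil ρ Ω) (σ / 2)) 2 (fun x => w (ρ • x)) +
      ENNReal.ofReal (ρ ^ 4) * fracSobolevNorm 1 (dil ρ Ω) 0 s fun x => g (ρ • x)) at h2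
  rw [innerPart_dil hρ] at h1
  have h3 := h1.of_dil hρ hU
  rw [innerPart_dil hρ, innerPart_dil hρ, fracSobolevNorm_dil hρ hU h3, fracSobolevNorm_dil hρ hΩ hg.1,
    sobolevNorm_dil hρ hV (hw.1.mono (innerPart_subset _ _))] at h2
  -- Membership is defined by the norm at scale `1`, so finiteness has to be transferred from scale
  -- `ρ`.
  refine ⟨⟨h3, fracSobolevNorm_lt_top hρ (h2.trans_lt ?_)⟩, h2⟩
  refine ENNReal.mul_lt_top ENNReal.ofReal_lt_top (ENNReal.add_lt_top.2
    ⟨?_, ENNReal.mul_lt_top ENNReal.ofReal_lt_top (fracSobolevNorm_lt_top one_pos hg.2)⟩)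
  exact sobolevNorm_lt_top one_pos ((sobolevNorm_mono hV (innerPart_subset _ _) hw.1).trans_lt hw.2)
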